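/- Let $S$ be a set of prime numbers and let $\bar S$ be the set of primes not in $S$. For a set $T$ of primes let $P(T)$ be the set of positive integers all of whose prime factors lie in $T$; thus $P(\bar S)$ is the set of positive integers divisible by no prime in $S$. For a set $T$ of primes and $n\ge 1$, let $Q_n$ be the largest divisor of $n$ all of whose prime factors lie in $T$, let $C_n\le S_n$ be the cyclic group generated by an $n$-cycle, and let $L_n^T$ be the Frobenius characteristic of the $S_n$-module $\exp\left(\frac{2\pi i}{n}Q_n\right)\big\uparrow_{C_n}^{S_n}$ induced from the one-dimensional representation of $C_n$ in which the generator acts as the scalar $\exp\left(\frac{2\pi i}{n}Q_n\right)$. Put $L^T=\sum_{n\ge1}L^T_n$. For a partition $\lambda$ with $m_i$ parts equal to $i$, write $H_\lambda[L^T]=\prod_{i:\,m_i\ge1}h_{m_i}[L_i^T]$ (plethysm), with $H_\emptyset[L^T]=1$, so that $\sum_{\lambda\vdash n}H_\lambda[L^T]$ is the degree $n$ component of the symmetric power $H[L^T]=\sum_{r\ge0}h_r[L^T]$. Then for every $n\ge0$ the following sums of power sum symmetric functions are Schur-positive, i.e. are linear combinations of Schur functions with nonnegative integer coefficients: $$(1)\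 \sum_{\lambda\vdash n:\ \lambda_i\in P(S)}p_\lambda,\qquad\qquad (2)\ \sum_{\lambda\vdash n:\ \lambda_i\in P(\bar S)}p_\lambda .$$ Moreover these sums are the degree $n$ components of the symmetric powers of $L^S$ and of $L^{\bar S}$ respectively: $$\sum_{\lambda\vdash n:\ \lambda_i\in P(S)}p_\lambda=\sum_{\lambda\vdash n}H_\lambda[L^S],\qquad \sum_{\lambda\vdash n:\ \lambda_i\in P(\bar S)}p_\lambda=\sum_{\lambda\vdash n}H_\lambda[L^{\bar S}].$$ -/

import Mathlib

noncomputable section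

/-- Complex formal power series in the countably many variables `x_0, x_1, x_2, …`.
Symmetric functions (with complex coefficients) are regarded as elements of this ring. -/
abbrev SymPS : Type := MvPowerSeries ℕ ℂ

open Classical in
/-- The power sum `p_k = ∑_i x_i ^ k` (for `k ≥ 1`). -/
def powerSum (k : ℕ) : SymPS := fun α => if ∃ i, α = Finsupp.single i k then 1 else 0

/-- `p_lam = ∏_i p_{lam_i}` for a partition `lam`. -/
def powerSumPart {n : ℕ} (lam : n.Partition) : SymPS := (lam.parts.map powerSum).prod

/-- The content of a semistandard tableau `T`, as an exponent vector: `k` has as exponent the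
number of cells of `T` with entry `k`. -/
def tableauContent {mu : YoungDiagram} (T : SemistandardYoungTableau mu) : ℕ →₀ ℕ :=
  ∑ c ∈ mu.cells, Finsupp.single (T c.1 c.2) 1

/-- The Schur function `s_mu = ∑_T x^T`, the sum over all semistandard tableaux of shape `mu`. -/
def schur (mu : YoungDiagram) : SymPS :=
  fun α => (Nat.card {T : SemistandardYoungTableau mu // tableauContent T = α} : ℂ)

/-- `f` is Schur-positive: a (finite) combination of Schur functions with nonnegative integer
coefficients. -/
def SchurPositive (f : SymPS) : Prop :=
  ∃ c : YoungDiagram →₀ ℕ, f = ∑ mu ∈ c.support, (c mu : ℂ) • schur mu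

/-- The plethysm `p_k[f]`, i.e. `f(x_0^k, x_1^k, …)`, for `k ≥ 1` (and `0` for `k = 0`). -/
def powerPlethysm (k : ℕ) (f : SymPS) : SymPS :=
  if hk : k ≠ 0 then MvPowerSeries.expand k hk f else 0

/-- `z_lam = ∏_i i^{m_i} m_i!`, where `m_i` is the number of parts of `lam` equal to `i`. -/
def zPart {n : ℕ} (lam : n.Partition) : ℕ :=
  ∏ i ∈ lam.parts.toFinset, i ^ lam.parts.count i * (lam.parts.count i).factorial

/-- The plethysm `h_m[f]` of the complete homogeneous symmetric function
`h_m = ∑_{lam ⊢ m} z_lam⁻¹ p_lam` with `f`; recall that `g ↦ g[f]` is the algebra homomorphism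
that sends `p_k` to `p_k[f]`. -/
def hPlethysm (m : ℕ) (f : SymPS) : SymPS :=
  ∑ lam : m.Partition, (zPart lam : ℂ)⁻¹ • (lam.parts.map fun k => powerPlethysm k f).prod

/-- `H_lam[Q] = ∏_i h_{m_i}[q_i]`, where `m_i` is the number of parts of `lam` equal to `i`. -/
def higherH (Q : ℕ → SymPS) {n : ℕ} (lam : n.Partition) : SymPS :=
  ∏ i ∈ lam.parts.toFinset, hPlethysm (lam.parts.count i) (Q i)

/-- The component of degree `n` of the symmetric power `H[Q] = ∑_r h_r[Q]` of
`Q = q_1 + q_2 + ⋯` (`q_i` homogeneous of degree `i`), namely `∑_{lam ⊢ n} H_lam[Q]`. -/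
def symmetricPower (Q : ℕ → SymPS) (n : ℕ) : SymPS := ∑ lam : n.Partition, higherH Q lam

/-- The Frobenius characteristic `ch V = (1 / n!) ∑_σ χ_V(σ) p_{cycle type of σ}` of a
representation of the symmetric group on a set `X` with `n` elements. -/
def frobeniusChar {X : Type} [Fintype X] [DecidableEq X] {V : Type} [AddCommGroup V] [Module ℂ V]
    (ρ : Representation ℂ (Equiv.Perm X) V) : SymPS :=
  ((Fintype.card X).factorial : ℂ)⁻¹ •
    ∑ σ : Equiv.Perm X, ρ.character σ • powerSumPart σ.partition

/-- The inclusion of the cyclic group `C_n` into the symmetric group `S_n` of permutations of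
`ZMod n`: the generator is sent to the `n`-cycle `x ↦ 1 + x`. -/
def cyclicInclusion (n : ℕ) : Multiplicative (ZMod n) →* Equiv.Perm (ZMod n) :=
  MulAction.toPermHom (Multiplicative (ZMod n)) (ZMod n)

/-- The one-dimensional representation of `C_n` in which the generator acts as the scalar
`exp ((2 π i / n) * r)`. -/
def cyclicRep (n : ℕ) [NeZero n] (r : ℕ) : Representation ℂ (Multiplicative (ZMod n)) ℂ :=
  ((algebraMap ℂ (Module.End ℂ ℂ)).toMonoidHom).comp
    ((ZMod.stdAddChar (N := n)).mulShift (r : ZMod n)).toMonoidHom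

/-- The `S_n`-module `exp ((2 π i / n) * r) ↑_{C_n}^{S_n}` induced from `C_n`. -/
def foulkesRep (n : ℕ) [NeZero n] (r : ℕ) :
    Representation ℂ (Equiv.Perm (ZMod n))
      (Representation.IndV (cyclicInclusion n) (cyclicRep n r)) :=
  Representation.ind (cyclicInclusion n) (cyclicRep n r)

open Classical in
/-- The factor `Q_n = ∏_{q ∈ S} q ^ {a_q(n)}` of `n = ∏_q q ^ {a_q(n)}`. -/
def primesPart (S : Set ℕ) (n : ℕ) : ℕ :=
  n.factorization.prod fun q a => if q ∈ S then q ^ a else 1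

/-- The sequence `L^S_n = ch (exp ((2 π i / n) * Q_n) ↑_{C_n}^{S_n})`, `n ≥ 1`
(there is no term of degree `0`). -/
def modL (S : Set ℕ) (n : ℕ) : SymPS :=
  if hn : n = 0 then 0 else
    haveI : NeZero n := ⟨hn⟩
    frobeniusChar (foulkesRep n (primesPart S n))

/-- The set of all primes that are not in `S`. -/
def primesCompl (S : Set ℕ) : Set ℕ := {q | q.Prime ∧ q ∉ S}

/-- `P(S)`: the positive integers all of whose prime factors lie in `S`. -/
def primeMonoid (S : Set ℕ) : Set ℕ := {n | 1 ≤ n ∧ ∀ q : ℕ, q.Prime → q ∣ n → q ∈ S}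

open Classical in
/-- `∑ p_lam` over all partitions `lam` of `n` with all parts in `T`. -/
def powerSumSum (T : Set ℕ) (n : ℕ) : SymPS :=
  ∑ lam : n.Partition with ∀ k ∈ lam.parts, k ∈ T, powerSumPart lam

end

/-! Let T be any set of primes. The equality with the symmetric power and the Schur-positivity of
the symmetric power are separate facts, and together they give the theorem.

Equality. Both sides are coefficients of products over part sizes, so logarithmic differentiation
gives each of them a recursion n a_n = ∑_j b_j a_{n-j} with a_0 = 1 (`newton_recursion`). By
`newton_unique` it is enough that the b_j agree. For the power sums, b_j is the sum of i p_i^{j/i}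
over the divisors i of j in P(T). For the symmetric power, b_j is the sum of i p_{j/i}[L_i] over all
divisors i of j. Counting cycles in the cyclic group gives i L_i = ∑ ζ^{Q_i} p_d^{i/d} over the i-th
roots of unity ζ, where d is the order of ζ. Collecting powers of p_l leaves the coefficient ∑
ζ^{Q_{(j/l) d}} over the l-th roots of unity. It equals l if l lies in P(T) and 0 otherwise
(`sum_pow_primesPart`, `sum_powerPlethysm_modL`).

Positivity. Every H_λ[L] is the cycle index of a finite permutation group weighted by a linear
character: cyclic groups give L_i, direct products give products, and wreath products give h_m[·]
(`IsCycleIndex.mul`, `IsCycleIndex.hPlethysm`). Such a cycle index is the Frobenius characteristic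
of an induced representation (`frobeniusChar_ind`), and by Maschke it remains to show that an
irreducible representation has a Schur function as its characteristic
(`frobeniusChar_of_isIrreducible`).

Schur functions are defined here by tableaux, so this last point needs the combinatorial theory. The
power sum of the cycle type of σ enumerates the colorings fixed by σ (`powerSumPart_eq_genSeries`).
Burnside's lemma for pairs of colorings then expresses ∑ z_λ⁻¹ p_λ(x) p_λ(y) through nonnegative
integer matrices, that is, through products of complete symmetric functions, and the Pieri rule
expands these in Schur functions with Kostka numbers (`sum_powerSumPart_eq`). The Kostka matrix is
unitriangular over ℤ, which yields the orthogonality relations of the character table. An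
irreducible character has norm one and pairs with permutation characters in natural numbers, so its
coordinates in Schur functions form an integer vector of norm one; nonnegativity of the pairings
fixes the sign (`exists_sum_eq_schur`). -/

open Equiv

/-! ### Generating series of a weighted type -/

/-- The generating series of a type whose elements have weights in `ℕ →₀ ℕ`. -/
noncomputable def genSeries {Y : Type*} (w : Y → ℕ →₀ ℕ) : SymPS :=
  fun α => (Nat.card {y // w y = α} : ℂ)

theorem coeff_genSeries {Y : Type*} (w : Y → ℕ →₀ ℕ) (α : ℕ →₀ ℕ) :
    MvPowerSeries.coeff α (genSeries w) = (Nat.card {y // w y = α} : ℂ) := rfl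

theorem genSeries_congr {Y Z : Type*} (e : Y ≃ Z) (w : Y → ℕ →₀ ℕ) (v : Z → ℕ →₀ ℕ)
    (h : ∀ y, v (e y) = w y) : genSeries w = genSeries v := by
  ext α
  rw [coeff_genSeries, coeff_genSeries]
  congr 1
  exact Nat.card_congr (e.subtypeEquiv fun y => by rw [h])

/-- The finiteness hypotheses matter because `Nat.card` of an infinite type is 0, so an infinite
fibre would spoil the count on the left. -/
theorem genSeries_prod {Y Z : Type*} (w : Y → ℕ →₀ ℕ) (v : Z → ℕ →₀ ℕ)
    (hw : ∀ α, Finite {y // w y = α}) (hv : ∀ α, Finite {z // v z = α}) :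
    genSeries (fun p : Y × Z => w p.1 + v p.2) = genSeries w * genSeries v := by
  classical
  ext α
  rw [MvPowerSeries.coeff_mul]
  simp only [coeff_genSeries]
  have e : {p : Y × Z // w p.1 + v p.2 = α} ≃
      Σ q : Finset.HasAntidiagonal.antidiagonal α, {y // w y = q.1.1} × {z // v z = q.1.2} :=
    { toFun := fun p => ⟨⟨(w p.1.1, v p.1.2), Finset.HasAntidiagonal.mem_antidiagonal.2 p.2⟩,
        ⟨p.1.1, rfl⟩, ⟨p.1.2, rfl⟩⟩
      invFun := fun q => ⟨(q.2.1.1, q.2.2.1), by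
        rw [q.2.1.2, q.2.2.2]; exact Finset.HasAntidiagonal.mem_antidiagonal.1 q.1.2⟩
      left_inv := fun p => rfl
      right_inv := by
        rintro ⟨⟨⟨a, b⟩, hq⟩, ⟨y, hy⟩, ⟨z, hz⟩⟩
        change w y = a at hy
        change v z = b at hz
        subst hy hz
        rfl }
  rw [Nat.card_congr e, Nat.card_sigma, Nat.cast_sum, ← Finset.sum_coe_sort (Finset.HasAntidiagonal.antidiagonal α)]
  exact Finset.sum_congr rfl fun q _ => by rw [Nat.card_prod, Nat.cast_mul]

theorem expand_genSeries {Y : Type*} (w : Y → ℕ →₀ ℕ) (k : ℕ) (hk : k ≠ 0) :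
    MvPowerSeries.expand k hk (genSeries w) = genSeries fun y => k • w y := by
  ext α
  by_cases h : ∃ β, α = k • β
  · obtain ⟨β, rfl⟩ := h
    rw [MvPowerSeries.coeff_expand_smul, coeff_genSeries, coeff_genSeries]
    congr 1
    refine Nat.card_congr (Equiv.subtypeEquivRight fun y => ⟨fun h => by rw [h], fun h => ?_⟩)
    ext i
    have := DFunLike.congr_fun h i
    simpa [hk] using this
  · have hdvd : ∃ i, ¬ k ∣ α i := by
      by_contra hcon
      push Not at hcon
      choose f hf using hcon
      refine h ⟨α.mapRange (· / k) (by simp), ?_⟩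
      ext i
      have := hf i
      simp [this, Nat.pos_of_ne_zero hk]
    obtain ⟨i, hi⟩ := hdvd
    have : IsEmpty {y // k • w y = α} := ⟨fun y => h ⟨_, y.2.symm⟩⟩
    rw [MvPowerSeries.coeff_expand_of_not_dvd _ _ _ hi, coeff_genSeries]
    simp

theorem powerSum_eq_genSeries (k : ℕ) (hk : k ≠ 0) :
    powerSum k = genSeries fun i : ℕ => Finsupp.single i k := by
  classical
  ext α
  change (if ∃ i, α = Finsupp.single i k then (1 : ℂ) else 0) = _
  rw [coeff_genSeries]
  split_ifs with h
  · obtain ⟨i, rfl⟩ := h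
    have : Unique {y // Finsupp.single y k = Finsupp.single i k} :=
      { default := ⟨i, rfl⟩
        uniq := fun y => Subtype.ext ((Finsupp.single_left_inj hk).1 y.2) }
    simp
  · have : IsEmpty {y // Finsupp.single y k = α} := ⟨fun y => h ⟨_, y.2.symm⟩⟩
    simp

theorem powerPlethysm_powerSum (k l : ℕ) (hk : k ≠ 0) (hl : l ≠ 0) :
    powerPlethysm k (powerSum l) = powerSum (k * l) := by
  rw [powerPlethysm, dif_pos hk, powerSum_eq_genSeries l hl, expand_genSeries,
    powerSum_eq_genSeries _ (mul_ne_zero hk hl)]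
  exact genSeries_congr (Equiv.refl _) _ _ fun y => by simp

/-! ### Cycle types -/

theorem cycleType_permCongr {α β : Type*} [Fintype α] [Fintype β] [DecidableEq α] [DecidableEq β]
    (e : α ≃ β) (σ : Perm α) : (e.permCongr σ).cycleType = σ.cycleType := by
  have h := Perm.cycleType_extendDomain (p := fun _ : β => True)
    (e.trans (Equiv.Set.univ β).symm) (g := σ)
  rw [← h]
  congr 1

theorem parts_partition_eq {α : Type*} [Fintype α] [DecidableEq α] (σ : Perm α) :
    σ.partition.parts =
      σ.cycleType + Multiset.replicate (Fintype.card α - σ.cycleType.sum) 1 := by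
  rw [Perm.parts_partition, Perm.sum_cycleType]

theorem parts_partition_permCongr {α β : Type*} [Fintype α] [Fintype β] [DecidableEq α]
    [DecidableEq β] (e : α ≃ β) (σ : Perm α) :
    (e.permCongr σ).partition.parts = σ.partition.parts := by
  rw [parts_partition_eq, parts_partition_eq, cycleType_permCongr, Fintype.card_congr e]

theorem cycleType_sumCongr {α β : Type*} [Fintype α] [Fintype β] [DecidableEq α] [DecidableEq β]
    (σ : Perm α) (τ : Perm β) :
    (Perm.sumCongr σ τ).cycleType = σ.cycleType + τ.cycleType := by
  have hd : Perm.Disjoint (Perm.sumCongr σ (1 : Perm β)) (Perm.sumCongr (1 : Perm α) τ) := by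
    rintro (a | b) <;> simp
  have hm : Perm.sumCongr σ τ = Perm.sumCongr σ 1 * Perm.sumCongr 1 τ := by
    rw [Perm.sumCongr_mul]; simp
  rw [hm, hd.cycleType_mul]
  congr 1
  · have h := Perm.cycleType_extendDomain (p := fun x : α ⊕ β => x ∈ Set.range Sum.inl)
      (Equiv.ofInjective (Sum.inl : α → α ⊕ β) Sum.inl_injective) (g := σ)
    rw [← h]
    congr 1
    ext (a | b)
    · exact (Perm.extendDomain_apply_image σ
        (Equiv.ofInjective (Sum.inl : α → α ⊕ β) Sum.inl_injective) a).symm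
    · rw [Perm.extendDomain_apply_not_subtype _ _ (by simp)]
      simp
  · have h := Perm.cycleType_extendDomain (p := fun x : α ⊕ β => x ∈ Set.range Sum.inr)
      (Equiv.ofInjective (Sum.inr : β → α ⊕ β) Sum.inr_injective) (g := τ)
    rw [← h]
    congr 1
    ext (a | b)
    · rw [Perm.extendDomain_apply_not_subtype _ _ (by simp)]
      simp
    · exact (Perm.extendDomain_apply_image τ
        (Equiv.ofInjective (Sum.inr : β → α ⊕ β) Sum.inr_injective) b).symm

theorem parts_partition_sumCongr {α β : Type*} [Fintype α] [Fintype β] [DecidableEq α]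
    [DecidableEq β] (σ : Perm α) (τ : Perm β) :
    (Perm.sumCongr σ τ).partition.parts = σ.partition.parts + τ.partition.parts := by
  have h1 := σ.sum_cycleType_le
  have h2 := τ.sum_cycleType_le
  rw [parts_partition_eq, parts_partition_eq, parts_partition_eq, cycleType_sumCongr,
    Fintype.card_sum, Multiset.sum_add, show ∀ a b c d : ℕ, c ≤ a → d ≤ b →
      a + b - (c + d) = (a - c) + (b - d) by omega, Multiset.replicate_add]
  · abel
  · exact h1
  · exact h2

theorem parts_partition_finRotate (k : ℕ) :
    (finRotate (k + 1)).partition.parts = {k + 1} := by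
  rw [parts_partition_eq]
  rcases k with _ | k
  · have h : Perm.cycleType (finRotate (0 + 1)) = 0 :=
      Perm.cycleType_eq_zero.2 (Equiv.ext fun x => Subsingleton.elim (α := Fin 1) _ _)
    rw [h]
    rfl
  · rw [cycleType_finRotate]
    simp

/-- Every permutation is conjugate to a disjoint union of rotations. -/
theorem perm_induction
    {C : ∀ (ι : Type) [Fintype ι] [DecidableEq ι], Perm ι → Prop}
    (congr : ∀ (ι κ : Type) [Fintype ι] [DecidableEq ι] [Fintype κ] [DecidableEq κ] (e : ι ≃ κ)
      (σ : Perm ι), C ι σ → C κ (e.permCongr σ))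
    (empty : C (Fin 0) 1)
    (rotate : ∀ k, C (Fin (k + 1)) (finRotate (k + 1)))
    (sum : ∀ (ι κ : Type) [Fintype ι] [DecidableEq ι] [Fintype κ] [DecidableEq κ] (σ : Perm ι)
      (τ : Perm κ), C ι σ → C κ τ → C (ι ⊕ κ) (Perm.sumCongr σ τ))
    {ι : Type} [Fintype ι] [DecidableEq ι] (σ : Perm ι) : C ι σ := by
  -- Every multiset of positive integers is the cycle type of some union of rotations; permutations
  -- with equal cycle types are then conjugate after identifying the underlying sets.
  have key : ∀ m : Multiset ℕ, (∀ k ∈ m, 0 < k) →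
      ∃ (κ : Type) (_ : Fintype κ) (_ : DecidableEq κ) (τ : Perm κ),
        C κ τ ∧ τ.partition.parts = m := by
    intro m
    induction m using Multiset.induction_on with
    | empty =>
      intro _
      exact ⟨Fin 0, inferInstance, inferInstance, 1, empty, by simp [parts_partition_eq]⟩
    | cons a m ih =>
      intro h
      obtain ⟨κ, i1, i2, τ, hτ, hp⟩ := ih fun k hk => h k (Multiset.mem_cons_of_mem hk)
      obtain ⟨b, rfl⟩ := Nat.exists_eq_succ_of_ne_zero (h a (Multiset.mem_cons_self _ _)).ne'
      refine ⟨Fin (b + 1) ⊕ κ, inferInstance, inferInstance,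
        Perm.sumCongr (finRotate (b + 1)) τ, sum _ _ _ _ (rotate b) hτ, ?_⟩
      rw [parts_partition_sumCongr, parts_partition_finRotate, hp]
      rfl
  obtain ⟨κ, i1, i2, τ, hτ, hp⟩ := key σ.partition.parts fun k hk => σ.partition.parts_pos hk
  have hcard : Fintype.card κ = Fintype.card ι := by
    rw [← τ.partition.parts_sum, hp, σ.partition.parts_sum]
  let e : κ ≃ ι := Fintype.equivOfCardEq hcard
  have hconj : IsConj (e.permCongr τ) σ := by
    rw [Perm.partition_eq_of_isConj, Nat.Partition.ext_iff, parts_partition_permCongr, hp]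
  obtain ⟨g, hg⟩ := isConj_iff.1 hconj
  have : σ = (e.trans g).permCongr τ := by
    rw [← hg]
    ext x
    simp [Equiv.permCongr_apply, Perm.mul_apply, Perm.inv_def]
  rw [this]
  exact congr _ _ _ _ hτ

/-! ### Colorings fixed by a permutation -/

/-- The colorings of `X` fixed by a permutation of `X`. -/
abbrev FixedColoring {X : Type*} (σ : Perm X) : Type _ := {c : X → ℕ // ∀ x, c (σ x) = c x}

/-- The content of a coloring. -/
noncomputable def content {X : Type*} [Fintype X] (c : X → ℕ) : ℕ →₀ ℕ :=
  ∑ x, Finsupp.single (c x) 1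

theorem content_apply {X : Type*} [Fintype X] (c : X → ℕ) (i : ℕ) :
    content c i = Nat.card {x // c x = i} := by
  classical
  simp [content, Finsupp.finsetSum_apply, Finsupp.single_apply, Fintype.card_subtype]

theorem finite_content {X : Type*} [Fintype X] (α : ℕ →₀ ℕ) :
    Finite {c : X → ℕ // content c = α} := by
  refine Finite.of_injective
    (fun c x => (⟨c.1 x, ?_⟩ : α.support) : {c : X → ℕ // content c = α} → X → α.support) ?_
  · have h := content_apply c.1 (c.1 x)
    rw [c.2] at h
    rw [Finsupp.mem_support_iff, h]
    have : Nonempty {y // c.1 y = c.1 x} := ⟨⟨x, rfl⟩⟩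
    exact Nat.card_pos.ne'
  · intro c d h
    ext x
    exact congrArg Subtype.val (congrFun h x)

theorem finite_fixedColoring {X : Type*} [Fintype X] (σ : Perm X) (α : ℕ →₀ ℕ) :
    Finite {c : FixedColoring σ // content c.1 = α} := by
  have := finite_content (X := X) α
  exact Finite.of_injective
    (fun c => (⟨c.1.1, c.2⟩ : {c : X → ℕ // content c = α})) fun c d h => by
      ext x
      exact congrFun (congrArg Subtype.val h) x

/-- A fixed coloring of a disjoint union is a pair of fixed colorings. -/
def fixedColoringSum {X Y : Type*} (σ : Perm X) (τ : Perm Y) :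
    FixedColoring (Perm.sumCongr σ τ) ≃ FixedColoring σ × FixedColoring τ where
  toFun c := ⟨⟨fun x => c.1 (Sum.inl x), fun x => c.2 (Sum.inl x)⟩,
    ⟨fun x => c.1 (Sum.inr x), fun x => c.2 (Sum.inr x)⟩⟩
  invFun p := ⟨Sum.elim p.1.1 p.2.1, by
    rintro (x | x)
    · exact p.1.2 x
    · exact p.2.2 x⟩
  left_inv c := by
    ext (x | x) <;> rfl
  right_inv p := rfl

/-- A fixed coloring is constant on cycles, and a cycle of length k with color i contributes x_i^k.
This is the bridge from power sums to counting fixed points. -/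
theorem powerSumPart_eq_genSeries {X : Type} [Fintype X] [DecidableEq X] (σ : Perm X) :
    powerSumPart σ.partition = genSeries fun c : FixedColoring σ => content c.1 := by
  refine perm_induction (C := fun X _ _ σ =>
    powerSumPart σ.partition = genSeries fun c : FixedColoring σ => content c.1) ?_ ?_ ?_ ?_ σ
  · intro ι κ _ _ _ _ e σ h
    rw [powerSumPart, parts_partition_permCongr, ← powerSumPart, h]
    refine genSeries_congr ((Equiv.arrowCongr e (Equiv.refl ℕ)).subtypeEquiv fun c => ?_) _ _ ?_
    · refine ⟨fun h x => by simpa using h (e.symm x), fun h x => by simpa using h (e x)⟩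
    · intro c
      simp only [content, subtypeEquiv_apply, arrowCongr_apply, coe_refl, Function.comp_apply]
      exact Fintype.sum_equiv e.symm _ _ fun x => rfl
  · rw [powerSumPart]
    ext α
    have hp : (1 : Perm (Fin 0)).partition.parts = 0 := by
      rw [parts_partition_eq, Perm.cycleType_one]; rfl
    rw [hp, coeff_genSeries, Multiset.map_zero, Multiset.prod_zero, MvPowerSeries.coeff_one]
    have : Unique (FixedColoring (1 : Perm (Fin 0))) :=
      { default := ⟨Fin.elim0, fun x => x.elim0⟩
        uniq := fun c => Subtype.ext (funext fun x => x.elim0) }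
    split_ifs with h
    · subst h
      have : Unique {c : FixedColoring (1 : Perm (Fin 0)) // content c.1 = 0} :=
        { default := ⟨default, by simp [content]⟩
          uniq := fun c => Subtype.ext (Subsingleton.elim _ _) }
      simp
    · have : IsEmpty {c : FixedColoring (1 : Perm (Fin 0)) // content c.1 = α} :=
        ⟨fun c => h (by rw [← c.2]; simp [content])⟩
      simp
  · intro k
    rw [powerSumPart, parts_partition_finRotate, Multiset.map_singleton, Multiset.prod_singleton,
      powerSum_eq_genSeries _ k.succ_ne_zero]
    refine genSeries_congr
      { toFun := fun i => ⟨fun _ => i, fun _ => rfl⟩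
        invFun := fun c => c.1 0
        left_inv := fun i => rfl
        right_inv := fun c => ?_ } _ _ ?_
    · ext x
      change c.1 0 = c.1 x
      induction x using Fin.induction with
      | zero => rfl
      | succ i ih =>
        rw [ih, ← c.2 i.castSucc]
        simp
    · intro i
      simp [content]
  · intro ι κ _ _ _ _ σ τ h1 h2
    rw [powerSumPart, parts_partition_sumCongr, Multiset.map_add, Multiset.prod_add,
      ← powerSumPart, ← powerSumPart, h1, h2,
      ← genSeries_prod _ _ (finite_fixedColoring σ) (finite_fixedColoring τ)]
    symm
    refine genSeries_congr (fixedColoringSum σ τ) _ _ fun c => ?_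
    exact (Fintype.sum_sum_type fun x => Finsupp.single (c.1 x) 1).symm

/-! ### Horizontal strips -/

namespace YoungDiagram

theorem ext_rowLen {μ ν : YoungDiagram} (h : ∀ i, μ.rowLen i = ν.rowLen i) : μ = ν := by
  ext ⟨i, j⟩
  rw [mem_cells, mem_cells, mem_iff_lt_rowLen, mem_iff_lt_rowLen, h]

theorem le_iff_rowLen {μ ν : YoungDiagram} : μ ≤ ν ↔ ∀ i, μ.rowLen i ≤ ν.rowLen i := by
  refine ⟨fun h i => ?_, fun h => ?_⟩
  · by_contra! hlt
    have h1 : (i, ν.rowLen i) ∈ μ := mem_iff_lt_rowLen.2 hlt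
    exact lt_irrefl _ (mem_iff_lt_rowLen.1 (h h1))
  · rintro ⟨i, j⟩ hc
    exact mem_iff_lt_rowLen.2 ((mem_iff_lt_rowLen.1 hc).trans_le (h i))

theorem card_mono {μ ν : YoungDiagram} (h : μ ≤ ν) : μ.card ≤ ν.card :=
  Finset.card_le_card (cells_subset_iff.2 h)

@[simp]
theorem rowLen_bot (i : ℕ) : (⊥ : YoungDiagram).rowLen i = 0 := by
  by_contra h
  exact notMem_bot (i, 0) (mem_iff_lt_rowLen.2 (Nat.pos_of_ne_zero h))

/-- Otherwise the first column alone would contain N + 1 cells. -/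
theorem rowLen_eq_zero_of_card_le {μ : YoungDiagram} {N : ℕ} (h : μ.card ≤ N) :
    μ.rowLen N = 0 := by
  by_contra hne
  have hsub : (Finset.range (N + 1)).map ⟨fun i => (i, 0), fun a b h => (Prod.ext_iff.1 h).1⟩
      ⊆ μ.cells := by
    intro c hc
    obtain ⟨i, hi, rfl⟩ := Finset.mem_map.1 hc
    refine μ.up_left_mem (Nat.lt_succ_iff.1 (Finset.mem_range.1 hi)) le_rfl
      (mem_iff_lt_rowLen.2 (Nat.pos_of_ne_zero hne))
  have := Finset.card_le_card hsub
  simp only [Finset.card_map, Finset.card_range] at this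
  have h' : μ.cells.card ≤ N := h
  omega

theorem card_eq_sum_rowLen {μ : YoungDiagram} {N : ℕ} (h : μ.rowLen N = 0) :
    μ.card = ∑ i ∈ Finset.range N, μ.rowLen i := by
  have hmem : ∀ c ∈ μ.cells, c.1 ∈ Finset.range N := by
    rintro ⟨i, j⟩ hc
    rw [Finset.mem_range]
    by_contra! hi
    have h1 := mem_iff_lt_rowLen.1 hc
    have h2 := μ.rowLen_anti _ _ hi
    change j < μ.rowLen i at h1
    change μ.rowLen i ≤ _ at h2
    omega
  rw [YoungDiagram.card, Finset.card_eq_sum_card_fiberwise hmem]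
  exact Finset.sum_congr rfl fun i _ => (μ.rowLen_eq_card).symm

theorem rowLen_le_card (μ : YoungDiagram) (i : ℕ) : μ.rowLen i ≤ μ.card := by
  rw [rowLen_eq_card]
  exact Finset.card_le_card (Finset.filter_subset _ _)

/-- The Young diagram with prescribed row lengths. -/
def ofFun (f : ℕ → ℕ) (hf : Antitone f) (N : ℕ) (_ : f N = 0) : YoungDiagram where
  cells := (Finset.range N ×ˢ Finset.range (f 0)).filter fun c => c.2 < f c.1
  isLowerSet := by
    rintro ⟨a, b⟩ ⟨c, d⟩ ⟨h1, h2⟩ hab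
    simp only [Finset.coe_filter, Finset.mem_product, Finset.mem_range, Set.mem_ofPred_eq] at *
    have := hf h1
    change c ≤ a at h1
    change d ≤ b at h2
    omega

theorem rowLen_ofFun (f : ℕ → ℕ) (hf : Antitone f) (N : ℕ) (hN : f N = 0) (i : ℕ) :
    (ofFun f hf N hN).rowLen i = f i := by
  have key : ∀ j, (i, j) ∈ ofFun f hf N hN ↔ j < f i := by
    intro j
    rw [← mem_cells]
    simp only [ofFun, Finset.mem_filter, Finset.mem_product, Finset.mem_range]
    refine ⟨fun h => h.2, fun h => ⟨⟨?_, h.trans_le (hf (Nat.zero_le i))⟩, h⟩⟩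
    by_contra! hi
    have := hf hi
    omega
  refine le_antisymm ?_ ?_
  · by_contra! h
    exact lt_irrefl _ ((key _).1 (mem_iff_lt_rowLen.2 h))
  · by_contra! h
    exact lt_irrefl _ (mem_iff_lt_rowLen.1 ((key _).2 h))

/-- `IsStrip ν μ`: the skew diagram `μ / ν` is a horizontal strip. -/
def IsStrip (ν μ : YoungDiagram) : Prop :=
  ∀ i, μ.rowLen (i + 1) ≤ ν.rowLen i ∧ ν.rowLen i ≤ μ.rowLen i

theorem IsStrip.le {ν μ : YoungDiagram} (h : IsStrip ν μ) : ν ≤ μ :=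
  le_iff_rowLen.2 fun i => (h i).2

theorem finite_card_eq (n : ℕ) : {μ : YoungDiagram | μ.card = n}.Finite := by
  have hinj : Set.InjOn YoungDiagram.cells {μ : YoungDiagram | μ.card = n} :=
    fun μ _ ν _ h => YoungDiagram.ext h
  refine Set.Finite.of_finite_image ?_ hinj
  refine (Finset.finite_toSet (Finset.range n ×ˢ Finset.range n).powerset).subset ?_
  rintro _ ⟨μ, hμ, rfl⟩
  simp only [Finset.coe_powerset, Set.mem_preimage, Set.mem_powerset_iff, Finset.coe_subset]
  rintro ⟨i, j⟩ hc
  simp only [Finset.mem_product, Finset.mem_range]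
  have h1 := mem_iff_lt_rowLen.1 hc
  refine ⟨?_, (h1.trans_le (μ.rowLen_le_card i)).trans_eq hμ⟩
  by_contra! hi
  have := rowLen_eq_zero_of_card_le (μ := μ) (N := i) (by rw [hμ]; exact hi)
  omega

theorem finite_stripsBelow (μ : YoungDiagram) : {ν | IsStrip ν μ}.Finite := by
  refine (Set.Finite.biUnion (Set.finite_Iic μ.card) fun n _ => finite_card_eq n).subset ?_
  intro ν hν
  exact Set.mem_biUnion (card_mono (IsStrip.le hν)) rfl

/-- The diagrams `ν` such that `μ / ν` is a horizontal strip. -/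
noncomputable def stripsBelow (μ : YoungDiagram) : Finset YoungDiagram :=
  (finite_stripsBelow μ).toFinset

theorem finite_stripsAbove (a : ℕ) (ν : YoungDiagram) :
    {μ | IsStrip ν μ ∧ μ.card = ν.card + a}.Finite := by
  refine (finite_card_eq (ν.card + a)).subset ?_
  rintro μ ⟨-, h⟩
  exact h

/-- The diagrams `μ` such that `μ / ν` is a horizontal strip of size `a`. -/
noncomputable def stripsAbove (a : ℕ) (ν : YoungDiagram) : Finset YoungDiagram :=
  (finite_stripsAbove a ν).toFinset

@[simp]
theorem mem_stripsBelow {μ ν : YoungDiagram} : ν ∈ stripsBelow μ ↔ IsStrip ν μ := by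
  simp [stripsBelow]

@[simp]
theorem mem_stripsAbove {a : ℕ} {μ ν : YoungDiagram} :
    μ ∈ stripsAbove a ν ↔ IsStrip ν μ ∧ μ.card = ν.card + a := by
  simp [stripsAbove]

section Toggle

variable {lam rho : YoungDiagram}

theorem exists_rowLen_eq_zero (lam rho : YoungDiagram) :
    lam.rowLen (lam.card + rho.card) = 0 ∧ rho.rowLen (lam.card + rho.card) = 0 :=
  ⟨rowLen_eq_zero_of_card_le (by omega), rowLen_eq_zero_of_card_le (by omega)⟩

/-- The local rule of the growth diagrams of the Robinson-Schensted-Knuth correspondence. -/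
noncomputable def toggleDown (lam rho mu : YoungDiagram) (h1 : IsStrip lam mu)
    (h2 : IsStrip rho mu) : YoungDiagram :=
  ofFun (fun i => min (lam.rowLen i) (rho.rowLen i) +
      max (lam.rowLen (i + 1)) (rho.rowLen (i + 1)) - mu.rowLen (i + 1))
    (antitone_nat_of_succ_le fun i => by
      have a1 := h1 i
      have a2 := h2 i
      have b1 := h1 (i + 1)
      have b2 := h2 (i + 1)
      have c1 := h1 (i + 1 + 1)
      have c2 := h2 (i + 1 + 1)
      omega) (lam.card + rho.card) (by
      have h := exists_rowLen_eq_zero lam rho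
      have h1 := lam.rowLen_anti _ _ (Nat.le_succ (lam.card + rho.card))
      have h2 := rho.rowLen_anti _ _ (Nat.le_succ (lam.card + rho.card))
      simp only [Nat.succ_eq_add_one] at h1 h2
      omega)

/-- The row lengths of the inverse of the local rule. -/
def toggleUpFun (lam rho nu : YoungDiagram) (j : ℕ) : ℕ → ℕ
  -- The top row has no row of `nu` as partner, so its excess over the maximum is the free parameter
  -- `j`.
  | 0 => max (lam.rowLen 0) (rho.rowLen 0) + j
  | i + 1 => min (lam.rowLen i) (rho.rowLen i) +
        max (lam.rowLen (i + 1)) (rho.rowLen (i + 1)) - nu.rowLen i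

/-- The inverse of the local rule. -/
noncomputable def toggleUp (lam rho nu : YoungDiagram) (h1 : IsStrip nu lam)
    (h2 : IsStrip nu rho) (j : ℕ) : YoungDiagram :=
  ofFun (toggleUpFun lam rho nu j)
    (antitone_nat_of_succ_le fun i => by
      have a1 := h1 i
      have a2 := h2 i
      rcases i with _ | i
      · simp only [toggleUpFun]
        omega
      · have b1 := h1 i
        have b2 := h2 i
        simp only [toggleUpFun]
        omega) (lam.card + rho.card + 1) (by
      have h := exists_rowLen_eq_zero lam rho
      have h1 := lam.rowLen_anti _ _ (Nat.le_succ (lam.card + rho.card))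
      have h2 := rho.rowLen_anti _ _ (Nat.le_succ (lam.card + rho.card))
      simp only [Nat.succ_eq_add_one] at h1 h2
      simp only [toggleUpFun]
      omega)

theorem rowLen_toggleDown {mu : YoungDiagram} (h1 : IsStrip lam mu) (h2 : IsStrip rho mu)
    (i : ℕ) : (toggleDown lam rho mu h1 h2).rowLen i = min (lam.rowLen i) (rho.rowLen i) +
      max (lam.rowLen (i + 1)) (rho.rowLen (i + 1)) - mu.rowLen (i + 1) :=
  rowLen_ofFun _ _ _ _ _

theorem rowLen_toggleUp_zero {nu : YoungDiagram} (h1 : IsStrip nu lam) (h2 : IsStrip nu rho)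
    (j : ℕ) : (toggleUp lam rho nu h1 h2 j).rowLen 0 =
      max (lam.rowLen 0) (rho.rowLen 0) + j :=
  rowLen_ofFun _ _ _ _ _

theorem rowLen_toggleUp_succ {nu : YoungDiagram} (h1 : IsStrip nu lam) (h2 : IsStrip nu rho)
    (j i : ℕ) : (toggleUp lam rho nu h1 h2 j).rowLen (i + 1) =
      min (lam.rowLen i) (rho.rowLen i) +
        max (lam.rowLen (i + 1)) (rho.rowLen (i + 1)) - nu.rowLen i :=
  rowLen_ofFun _ _ _ _ _

/-- Row i + 1 of the larger diagram and row i of the smaller one are confined to the same interval,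
from max(lam_{i+1}, rho_{i+1}) to min(lam_i, rho_i). The local rule reflects this interval, which
preserves the strip conditions and is invertible. -/
theorem isStrip_toggleDown {mu : YoungDiagram} (h1 : IsStrip lam mu) (h2 : IsStrip rho mu) :
    IsStrip (toggleDown lam rho mu h1 h2) lam ∧ IsStrip (toggleDown lam rho mu h1 h2) rho := by
  refine ⟨fun i => ?_, fun i => ?_⟩ <;>
  · rw [rowLen_toggleDown]
    have a1 := h1 i
    have a2 := h2 i
    have b1 := h1 (i + 1)
    have b2 := h2 (i + 1)
    omega

theorem isStrip_toggleUp {nu : YoungDiagram} (h1 : IsStrip nu lam) (h2 : IsStrip nu rho)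
    (j : ℕ) : IsStrip lam (toggleUp lam rho nu h1 h2 j) ∧
      IsStrip rho (toggleUp lam rho nu h1 h2 j) := by
  refine ⟨fun i => ?_, fun i => ?_⟩ <;>
  · rw [rowLen_toggleUp_succ]
    have a1 := h1 i
    have a2 := h2 i
    rcases i with _ | i
    · rw [rowLen_toggleUp_zero]
      omega
    · rw [rowLen_toggleUp_succ]
      have b1 := h1 i
      have b2 := h2 i
      omega

theorem toggleUp_toggleDown {mu : YoungDiagram} (h1 : IsStrip lam mu) (h2 : IsStrip rho mu) :
    toggleUp lam rho (toggleDown lam rho mu h1 h2) (isStrip_toggleDown h1 h2).1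
      (isStrip_toggleDown h1 h2).2 (mu.rowLen 0 - max (lam.rowLen 0) (rho.rowLen 0)) = mu := by
  refine ext_rowLen fun i => ?_
  rcases i with _ | i
  · rw [rowLen_toggleUp_zero]
    have a1 := h1 0
    have a2 := h2 0
    omega
  · rw [rowLen_toggleUp_succ, rowLen_toggleDown]
    have a1 := h1 i
    have a2 := h2 i
    have b1 := h1 (i + 1)
    have b2 := h2 (i + 1)
    omega

theorem toggleDown_toggleUp {nu : YoungDiagram} (h1 : IsStrip nu lam) (h2 : IsStrip nu rho)
    (j : ℕ) : toggleDown lam rho (toggleUp lam rho nu h1 h2 j) (isStrip_toggleUp h1 h2 j).1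
      (isStrip_toggleUp h1 h2 j).2 = nu := by
  refine ext_rowLen fun i => ?_
  rw [rowLen_toggleDown, rowLen_toggleUp_succ]
  have a1 := h1 i
  have a2 := h2 i
  omega

/-- Adding up the rows, the shifted maxima together with the top row supply all the maxima, and min
+ max is the sum of the two row lengths; only `j` is left over. -/
theorem card_toggleUp {nu : YoungDiagram} (h1 : IsStrip nu lam) (h2 : IsStrip nu rho)
    (j : ℕ) : (toggleUp lam rho nu h1 h2 j).card + nu.card = lam.card + rho.card + j := by
  set N := lam.card + rho.card with hN
  have h : lam.rowLen N = 0 ∧ rho.rowLen N = 0 := exists_rowLen_eq_zero lam rho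
  have hl : lam.rowLen (N + 1) = 0 := rowLen_eq_zero_of_card_le (by omega)
  have hr : rho.rowLen (N + 1) = 0 := rowLen_eq_zero_of_card_le (by omega)
  have hn : nu.rowLen N = 0 := by
    have := (h1 N).2
    omega
  have ht : (toggleUp lam rho nu h1 h2 j).rowLen (N + 1) = 0 := by
    rw [rowLen_toggleUp_succ]
    omega
  have e : ∀ i, (toggleUp lam rho nu h1 h2 j).rowLen (i + 1) + nu.rowLen i =
      min (lam.rowLen i) (rho.rowLen i) + max (lam.rowLen (i + 1)) (rho.rowLen (i + 1)) := by
    intro i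
    rw [rowLen_toggleUp_succ]
    have a1 := h1 i
    have a2 := h2 i
    omega
  have e2 : ∀ i, min (lam.rowLen i) (rho.rowLen i) + max (lam.rowLen i) (rho.rowLen i) =
      lam.rowLen i + rho.rowLen i := fun i => min_add_max _ _
  have s1 := Finset.sum_congr (rfl : Finset.range N = _) fun i _ => e i
  have s2 := Finset.sum_congr (rfl : Finset.range N = _) fun i _ => e2 i
  simp only [Finset.sum_add_distrib] at s1 s2
  have s3 := Finset.sum_range_succ' (fun i => max (lam.rowLen i) (rho.rowLen i)) N
  have s4 := Finset.sum_range_succ (fun i => max (lam.rowLen i) (rho.rowLen i)) N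
  rw [card_eq_sum_rowLen ht, Finset.sum_range_succ', rowLen_toggleUp_zero,
    card_eq_sum_rowLen hn]
  have c1 := card_eq_sum_rowLen h.1
  have c2 := card_eq_sum_rowLen h.2
  simp only [h.1, h.2, max_self, add_zero] at s4
  omega

end Toggle

theorem card_eq_zero {μ : YoungDiagram} : μ.card = 0 ↔ μ = ⊥ := by
  rw [YoungDiagram.card, Finset.card_eq_zero, ← cells_bot]
  exact ⟨fun h => YoungDiagram.ext h, fun h => by rw [h]⟩

end YoungDiagram

/-! ### Schur polynomials in finitely many variables and the Pieri rule -/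

open YoungDiagram MvPowerSeries

open Classical in
/-- The Schur polynomial in the variables `x_0, …, x_{k-1}`, defined by branching. -/
noncomputable def schurPoly : ℕ → YoungDiagram → SymPS
  | 0, μ => if μ = ⊥ then 1 else 0
  | k + 1, μ => ∑ ν ∈ stripsBelow μ, X k ^ (μ.card - ν.card) * schurPoly k ν

/-- The complete homogeneous symmetric polynomial in the variables `x_0, …, x_{k-1}`. -/
noncomputable def completePoly : ℕ → ℕ → SymPS
  | 0, a => if a = 0 then 1 else 0
  | k + 1, a => ∑ j ∈ Finset.range (a + 1), X k ^ j * completePoly k (a - j)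

/-- The Pieri rule. -/
theorem completePoly_mul_schurPoly (k a : ℕ) (lam : YoungDiagram) :
    completePoly k a * schurPoly k lam = ∑ μ ∈ stripsAbove a lam, schurPoly k μ := by
  classical
  induction k generalizing a lam with
  | zero =>
    simp only [completePoly, schurPoly, Finset.sum_ite_eq', mem_stripsAbove]
    have : (IsStrip lam ⊥ ∧ (⊥ : YoungDiagram).card = lam.card + a) ↔ (a = 0 ∧ lam = ⊥) := by
      rw [card_eq_zero.2 rfl]
      constructor
      · rintro ⟨_, h⟩
        exact ⟨by omega, card_eq_zero.1 (by omega)⟩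
      · rintro ⟨rfl, rfl⟩
        exact ⟨fun i => by simp, by rw [card_eq_zero.2 rfl]⟩
    rw [if_congr this rfl rfl]
    by_cases ha : a = 0 <;> by_cases hl : lam = ⊥ <;> simp [ha, hl]
  | succ k ih =>
    simp only [completePoly, schurPoly]
    -- Split off the last variable in both factors and apply the Pieri rule in k variables. What
    -- remains is to match triples (j, ν, ρ) with pairs (μ, ρ), where ν lies below both `lam` and ρ,
    -- and μ lies above both.
    have hL : (∑ j ∈ Finset.range (a + 1), X k ^ j * completePoly k (a - j)) *
        (∑ ν ∈ stripsBelow lam, X k ^ (lam.card - ν.card) * schurPoly k ν) =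
        ∑ j ∈ Finset.range (a + 1), ∑ ν ∈ stripsBelow lam, ∑ ρ ∈ stripsAbove (a - j) ν,
          (X k : SymPS) ^ (j + (lam.card - ν.card)) * schurPoly k ρ := by
      rw [Finset.sum_mul_sum]
      refine Finset.sum_congr rfl fun j _ => Finset.sum_congr rfl fun ν _ => ?_
      rw [← Finset.mul_sum, ← ih, pow_add]
      ring
    rw [hL]
    simp only [Finset.sum_sigma']
    -- The local rule is the bijection: j is the excess of the top row of μ, and `card_toggleUp`
    -- matches the exponents of the last variable.
    refine Finset.sum_bij'
      (fun p hp => ⟨toggleUp lam p.2.2 p.2.1 ?_ ?_ p.1, p.2.2⟩)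
      (fun q hq => ⟨q.1.rowLen 0 - max (lam.rowLen 0) (q.2.rowLen 0),
        toggleDown lam q.2 q.1 ?_ ?_, q.2⟩) ?_ ?_ ?_ ?_ ?_
    · simp only [Finset.mem_sigma, mem_stripsBelow] at hp
      exact hp.2.1
    · simp only [Finset.mem_sigma, mem_stripsAbove] at hp
      exact hp.2.2.1
    · simp only [Finset.mem_sigma, mem_stripsAbove] at hq
      exact hq.1.1
    · simp only [Finset.mem_sigma, mem_stripsBelow] at hq
      exact hq.2
    · rintro ⟨j, ν, ρ⟩ hp
      simp only [Finset.mem_sigma, mem_stripsBelow, mem_stripsAbove, Finset.mem_range] at hp ⊢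
      obtain ⟨hj, h1, h2, h3⟩ := hp
      have hc := card_toggleUp h1 h2 j
      exact ⟨⟨(isStrip_toggleUp h1 h2 j).1, by omega⟩, (isStrip_toggleUp h1 h2 j).2⟩
    · rintro ⟨μ, ρ⟩ hq
      simp only [Finset.mem_sigma, mem_stripsBelow, mem_stripsAbove, Finset.mem_range] at hq ⊢
      obtain ⟨⟨h1, h2⟩, h3⟩ := hq
      have hd := isStrip_toggleDown h1 h3
      have hc := card_toggleUp hd.1 hd.2 (μ.rowLen 0 - max (lam.rowLen 0) (ρ.rowLen 0))
      rw [toggleUp_toggleDown] at hc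
      have hle := card_mono hd.2.le
      exact ⟨by omega, hd.1, hd.2, by omega⟩
    · rintro ⟨j, ν, ρ⟩ hp
      simp only [Finset.mem_sigma, mem_stripsBelow, mem_stripsAbove, Finset.mem_range] at hp
      obtain ⟨hj, h1, h2, h3⟩ := hp
      simp only [toggleDown_toggleUp, rowLen_toggleUp_zero, Nat.add_sub_cancel_left]
    · rintro ⟨μ, ρ⟩ hq
      simp only [toggleUp_toggleDown]
    · rintro ⟨j, ν, ρ⟩ hp
      simp only [Finset.mem_sigma, mem_stripsBelow, mem_stripsAbove, Finset.mem_range] at hp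
      obtain ⟨hj, h1, h2, h3⟩ := hp
      have hc := card_toggleUp h1 h2 j
      have hle := card_mono h1.le
      dsimp only
      congr 2
      omega

/-! ### Semistandard tableaux and the branching rule -/

theorem genSeries_sigma {ι : Type*} [Fintype ι] {Y : ι → Type*} (w : ∀ i, Y i → ℕ →₀ ℕ)
    (hw : ∀ i α, Finite {y // w i y = α}) :
    genSeries (fun p : Σ i, Y i => w p.1 p.2) = ∑ i, genSeries (w i) := by
  ext α
  rw [map_sum]
  simp only [coeff_genSeries]
  let e : {p : Σ i, Y i // w p.1 p.2 = α} ≃ Σ i, {y // w i y = α} :=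
    { toFun := fun p => ⟨p.1.1, p.1.2, p.2⟩
      invFun := fun p => ⟨⟨p.1, p.2.1⟩, p.2.2⟩
      left_inv := fun _ => rfl
      right_inv := fun _ => rfl }
  rw [Nat.card_congr e, Nat.card_sigma, Nat.cast_sum]

theorem genSeries_const_add {Y : Type*} (w : Y → ℕ →₀ ℕ) (β : ℕ →₀ ℕ) :
    genSeries (fun y => β + w y) = monomial β 1 * genSeries w := by
  classical
  ext α
  rw [coeff_monomial_mul, coeff_genSeries, one_mul]
  split_ifs with h
  · rw [coeff_genSeries]
    congr 1
    refine Nat.card_congr (Equiv.subtypeEquivRight fun y => ?_)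
    rw [eq_tsub_iff_add_eq_of_le h, add_comm]
  · have : IsEmpty {y // β + w y = α} := ⟨fun y => h (y.2 ▸ le_self_add)⟩
    simp

namespace YoungDiagram

theorem isStrip_iff {ν μ : YoungDiagram} :
    IsStrip ν μ ↔ ν ≤ μ ∧ ∀ i j, (i + 1, j) ∈ μ → (i, j) ∈ ν := by
  refine ⟨fun h => ⟨h.le, fun i j hc => ?_⟩, fun h i => ⟨?_, le_iff_rowLen.1 h.1 i⟩⟩
  · exact mem_iff_lt_rowLen.2 ((mem_iff_lt_rowLen.1 hc).trans_le (h i).1)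
  · by_contra! hlt
    exact lt_irrefl _ (mem_iff_lt_rowLen.1 (h.2 i _ (mem_iff_lt_rowLen.2 hlt)))

end YoungDiagram

/-- The semistandard tableaux with entries less than `k`. -/
def BoundedTableau (k : ℕ) (μ : YoungDiagram) : Type :=
  {T : SemistandardYoungTableau μ // ∀ i j, (i, j) ∈ μ → T i j < k}

instance (k : ℕ) (μ : YoungDiagram) : Finite (BoundedTableau k μ) := by
  refine Finite.of_injective
    (fun T (c : μ.cells) => (⟨T.1 c.1.1 c.1.2, T.2 _ _ ((mem_cells _).1 c.2)⟩ : Fin k)) ?_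
  intro S T h
  refine Subtype.ext (SemistandardYoungTableau.ext fun i j => ?_)
  by_cases hc : (i, j) ∈ μ
  · exact congrArg Fin.val (congrFun h ⟨(i, j), (mem_cells _).2 hc⟩)
  · rw [S.1.zeros hc, T.1.zeros hc]

/-- Fill the strip `μ / ν` with the entry `k`. -/
noncomputable def fillStrip {k : ℕ} {μ ν : YoungDiagram} (h : IsStrip ν μ)
    (T : BoundedTableau k ν) : BoundedTableau (k + 1) μ := by
  classical
  exact
  ⟨{ entry := fun i j => if (i, j) ∈ ν then T.1 i j else if (i, j) ∈ μ then k else 0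
     row_weak' := by
      intro i j1 j2 hj hc
      have hc1 := μ.up_left_mem le_rfl hj.le hc
      by_cases h2 : (i, j2) ∈ ν
      · have h1 := ν.up_left_mem le_rfl hj.le h2
        simp only [h1, h2, if_true]
        exact T.1.row_weak hj h2
      · simp only [h2, hc, hc1, if_true, if_false]
        split_ifs with h1
        · exact (T.2 _ _ h1).le
        · exact le_rfl
     col_strict' := by
      intro i1 i2 j hi hc
      by_cases h2 : (i2, j) ∈ ν
      · have h1 := ν.up_left_mem hi.le le_rfl h2
        simp only [h1, h2, if_true]
        exact T.1.col_strict hi h2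
      · have h1 : (i1, j) ∈ ν :=
          (isStrip_iff.1 h).2 _ _ (μ.up_left_mem hi le_rfl hc)
        simp only [h1, h2, hc, if_true, if_false]
        exact T.2 _ _ h1
     zeros' := by
      intro i j hc
      have h2 : (i, j) ∉ ν := fun h2 => hc (h.le h2)
      simp only [h2, hc, if_false] },
    by
      intro i j hc
      change (if (i, j) ∈ ν then T.1 i j else if (i, j) ∈ μ then k else 0) < k + 1
      split_ifs with h1
      · exact (T.2 _ _ h1).trans (Nat.lt_succ_self k)
      · exact Nat.lt_succ_self k⟩

open Classical in
theorem fillStrip_apply {k : ℕ} {μ ν : YoungDiagram} (h : IsStrip ν μ)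
    (T : BoundedTableau k ν) (i j : ℕ) : (fillStrip h T).1 i j =
      if (i, j) ∈ ν then T.1 i j else if (i, j) ∈ μ then k else 0 := rfl

theorem fillStrip_lt_iff {k : ℕ} {μ ν : YoungDiagram} (h : IsStrip ν μ)
    (T : BoundedTableau k ν) {i j : ℕ} (hc : (i, j) ∈ μ) :
    (fillStrip h T).1 i j < k ↔ (i, j) ∈ ν := by
  rw [fillStrip_apply]
  by_cases h1 : (i, j) ∈ ν
  · simp only [h1, if_true, iff_true]
    exact T.2 _ _ h1
  · simp [h1, hc]

theorem tableauContent_fillStrip {k : ℕ} {μ ν : YoungDiagram} (h : IsStrip ν μ)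
    (T : BoundedTableau k ν) : tableauContent (fillStrip h T).1 =
      Finsupp.single k (μ.card - ν.card) + tableauContent T.1 := by
  classical
  have hsub := cells_subset_iff.2 h.le
  rw [tableauContent, ← Finset.sum_sdiff hsub, tableauContent]
  congr 1
  · rw [Finset.sum_congr rfl (g := fun _ => Finsupp.single k 1)]
    · rw [Finset.sum_const, Finset.card_sdiff_of_subset hsub, Finsupp.smul_single, smul_eq_mul,
        mul_one]
    · rintro ⟨i, j⟩ hc
      rw [Finset.mem_sdiff, mem_cells, mem_cells] at hc
      simp only [fillStrip_apply, hc.1, hc.2, if_true, if_false]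
  · refine Finset.sum_congr rfl ?_
    rintro ⟨i, j⟩ hc
    rw [mem_cells] at hc
    simp only [fillStrip_apply, hc, if_true]

/-- The cells with entry less than k form a diagram ν because entries increase along rows and
columns, and μ / ν is a horizontal strip because columns are strict. So removing the largest entry
inverts the filling. -/
theorem bijective_fillStrip (k : ℕ) (μ : YoungDiagram) :
    Function.Bijective (fun p : (Σ ν : stripsBelow μ, BoundedTableau k ν.1) =>
      fillStrip (mem_stripsBelow.1 p.1.2) p.2) := by
  classical
  constructor
  · rintro ⟨⟨ν, hν⟩, S⟩ ⟨⟨ρ, hρ⟩, T⟩ h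
    have hs := mem_stripsBelow.1 hν
    have ht := mem_stripsBelow.1 hρ
    change fillStrip hs S = fillStrip ht T at h
    have hνρ : ν = ρ := by
      ext ⟨i, j⟩
      rw [mem_cells, mem_cells]
      by_cases hc : (i, j) ∈ μ
      · rw [← fillStrip_lt_iff hs S hc, ← fillStrip_lt_iff ht T hc, h]
      · exact ⟨fun h1 => (hc (hs.le h1)).elim, fun h1 => (hc (ht.le h1)).elim⟩
    subst hνρ
    congr 1
    refine Subtype.ext (SemistandardYoungTableau.ext fun i j => ?_)
    by_cases hc : (i, j) ∈ ν
    · have := congrArg (fun U => U.1 i j) h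
      simpa only [fillStrip_apply, hc, if_true] using this
    · rw [S.1.zeros hc, T.1.zeros hc]
  · intro T
    let ν : YoungDiagram :=
      { cells := μ.cells.filter fun c => T.1 c.1 c.2 < k
        isLowerSet := by
          rintro ⟨a, b⟩ ⟨c, d⟩ ⟨h1, h2⟩ hab
          change c ≤ a at h1
          change d ≤ b at h2
          simp only [Finset.coe_filter, mem_cells, Set.mem_ofPred_eq] at hab ⊢
          refine ⟨μ.up_left_mem h1 h2 hab.1, lt_of_le_of_lt ?_ hab.2⟩
          exact (T.1.row_weak_of_le h2 (μ.up_left_mem h1 le_rfl hab.1)).trans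
            (T.1.col_weak h1 hab.1) }
    have hν : ∀ i j, (i, j) ∈ ν ↔ (i, j) ∈ μ ∧ T.1 i j < k := by
      intro i j
      rw [← mem_cells, Finset.mem_filter, mem_cells]
    have hs : IsStrip ν μ := by
      rw [isStrip_iff]
      refine ⟨?_, fun i j hc => ?_⟩
      · rintro ⟨i, j⟩ hc
        exact ((hν i j).1 hc).1
      · rw [hν]
        refine ⟨μ.up_left_mem (Nat.le_succ i) le_rfl hc, ?_⟩
        have h1 := T.1.col_strict (Nat.lt_succ_self i) hc
        have h2 := T.2 _ _ hc
        simp only [Nat.succ_eq_add_one] at h1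
        omega
    let S : BoundedTableau k ν :=
      ⟨{ entry := fun i j => if (i, j) ∈ ν then T.1 i j else 0
         row_weak' := by
          intro i j1 j2 hj hc
          have hc1 := ν.up_left_mem le_rfl hj.le hc
          simp only [hc, hc1, if_true]
          exact T.1.row_weak hj ((hν _ _).1 hc).1
         col_strict' := by
          intro i1 i2 j hi hc
          have hc1 := ν.up_left_mem hi.le le_rfl hc
          simp only [hc, hc1, if_true]
          exact T.1.col_strict hi ((hν _ _).1 hc).1
         zeros' := by
          intro i j hc
          simp only [hc, if_false] }, by
        intro i j hc
        change (if (i, j) ∈ ν then T.1 i j else 0) < k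
        simp only [hc, if_true]
        exact ((hν _ _).1 hc).2⟩
    refine ⟨⟨⟨ν, mem_stripsBelow.2 hs⟩, S⟩, ?_⟩
    refine Subtype.ext (SemistandardYoungTableau.ext fun i j => ?_)
    change (fillStrip hs S).1 i j = _
    rw [fillStrip_apply]
    by_cases hc : (i, j) ∈ μ
    · by_cases h1 : (i, j) ∈ ν
      · change (if (i, j) ∈ ν then (if (i, j) ∈ ν then T.1 i j else 0) else _) = _
        simp only [h1, if_true]
      · simp only [h1, hc, if_true, if_false]
        have h2 := T.2 _ _ hc
        rw [hν] at h1
        push Not at h1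
        have h3 := h1 hc
        omega
    · have h1 : (i, j) ∉ ν := fun h1 => hc (hs.le h1)
      simp only [h1, hc, if_false]
      exact (T.1.zeros hc).symm

theorem genSeries_boundedTableau (k : ℕ) (μ : YoungDiagram) :
    genSeries (fun T : BoundedTableau k μ => tableauContent T.1) = schurPoly k μ := by
  classical
  induction k generalizing μ with
  | zero =>
    rw [schurPoly]
    ext α
    rw [coeff_genSeries]
    split_ifs with h
    · subst h
      have hc : ∀ T : BoundedTableau 0 ⊥, tableauContent T.1 = 0 := fun T => by
        simp [tableauContent]
      have : Unique (BoundedTableau 0 ⊥) :=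
        { default := ⟨default, fun i j h => (notMem_bot _ h).elim⟩
          uniq := fun T => Subtype.ext (SemistandardYoungTableau.ext fun i j => by
            rw [T.1.zeros (notMem_bot _), SemistandardYoungTableau.zeros _ (notMem_bot _)]) }
      rw [coeff_one]
      split_ifs with hα
      · subst hα
        rw [Nat.card_congr (Equiv.subtypeUnivEquiv hc), Nat.card_unique, Nat.cast_one]
      · have : IsEmpty {T : BoundedTableau 0 ⊥ // tableauContent T.1 = α} :=
          ⟨fun T => hα (by rw [← T.2, hc])⟩
        simp
    · have : IsEmpty (BoundedTableau 0 μ) := ⟨fun T => by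
        have hne : μ.card ≠ 0 := fun h0 => h (card_eq_zero.1 h0)
        obtain ⟨⟨i, j⟩, hc⟩ := Finset.card_pos.1 (Nat.pos_of_ne_zero hne)
        exact Nat.not_lt_zero _ (T.2 i j ((mem_cells _).1 hc))⟩
      simp
  | succ k ih =>
    rw [schurPoly, ← Finset.sum_coe_sort]
    rw [← genSeries_congr (Equiv.ofBijective _ (bijective_fillStrip k μ))
      (fun p => Finsupp.single k (μ.card - p.1.1.card) + tableauContent p.2.1) _
      fun p => tableauContent_fillStrip (mem_stripsBelow.1 p.1.2) p.2]
    rw [genSeries_sigma (fun (ν : stripsBelow μ) (T : BoundedTableau k ν.1) =>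
      Finsupp.single k (μ.card - ν.1.card) + tableauContent T.1)
      fun ν α => inferInstance]
    refine Finset.sum_congr rfl fun ν _ => ?_
    rw [genSeries_const_add (fun T : BoundedTableau k ν.1 => tableauContent T.1), ih, X_pow_eq]

theorem tableauContent_apply {μ : YoungDiagram} (T : SemistandardYoungTableau μ) (r : ℕ) :
    tableauContent T r = (μ.cells.filter fun c => T c.1 c.2 = r).card := by
  rw [tableauContent, Finsupp.finsetSum_apply, Finset.card_filter]
  exact Finset.sum_congr rfl fun c _ => by rw [Finsupp.single_apply]

/-- Every entry of a tableau of content α lies in the support of α, so restricting to k variables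
loses no tableau. -/
theorem coeff_schur_eq {k : ℕ} (μ : YoungDiagram) {α : ℕ →₀ ℕ}
    (hα : α.support ⊆ Finset.range k) : coeff α (schur μ) = coeff α (schurPoly k μ) := by
  rw [← genSeries_boundedTableau, coeff_genSeries]
  change (Nat.card {T : SemistandardYoungTableau μ // tableauContent T = α} : ℂ) = _
  congr 1
  refine Nat.card_congr
    { toFun := fun T => ⟨⟨T.1, fun i j hc => ?_⟩, T.2⟩
      invFun := fun T => ⟨T.1.1, T.2⟩
      left_inv := fun _ => rfl
      right_inv := fun _ => rfl }
  rw [← Finset.mem_range]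
  apply hα
  have h := tableauContent_apply T.1 (T.1 i j)
  rw [T.2] at h
  rw [Finsupp.mem_support_iff, h]
  refine Finset.card_ne_zero_of_mem (a := (i, j)) ?_
  exact Finset.mem_filter.2 ⟨(mem_cells _).2 hc, rfl⟩

/-! ### Kostka numbers -/

open Classical in
/-- The number of chains of `k` horizontal strips of sizes `α 0, …, α (k - 1)` from the empty
diagram to `μ`. -/
noncomputable def stripChains : ℕ → (ℕ → ℕ) → YoungDiagram → ℕ
  | 0, _, μ => if μ = ⊥ then 1 else 0
  | k + 1, α, μ => ∑ ν ∈ stripsBelow μ, if ν.card + α k = μ.card then stripChains k α ν else 0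

theorem stripChains_congr {k : ℕ} {α β : ℕ → ℕ} (h : ∀ i < k, α i = β i) (μ : YoungDiagram) :
    stripChains k α μ = stripChains k β μ := by
  induction k generalizing μ with
  | zero => rfl
  | succ k ih =>
    simp only [stripChains]
    refine Finset.sum_congr rfl fun ν _ => ?_
    rw [h k (Nat.lt_succ_self k), ih fun i hi => h i (hi.trans (Nat.lt_succ_self k))]

theorem support_subset_range_iff {k : ℕ} {α : ℕ →₀ ℕ} :
    α.support ⊆ Finset.range k ↔ ∀ i, k ≤ i → α i = 0 := by
  constructor
  · intro h i hi
    by_contra hne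
    have := Finset.mem_range.1 (h (Finsupp.mem_support_iff.2 hne))
    omega
  · intro h i hi
    rw [Finset.mem_range]
    by_contra! hk
    exact Finsupp.mem_support_iff.1 hi (h i hk)

-- Extracting the exponent of the last variable forces the size of the last strip, so the branching
-- recursion turns into the recursion for chains of strips.
open Classical in
theorem coeff_schurPoly (k : ℕ) (α : ℕ →₀ ℕ) (μ : YoungDiagram) :
    coeff α (schurPoly k μ) =
      if α.support ⊆ Finset.range k then (stripChains k α μ : ℂ) else 0 := by
  induction k generalizing α μ with
  | zero =>
    rw [schurPoly, stripChains]
    by_cases h : μ = ⊥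
    · simp only [h, if_true, Finset.range_zero, Finset.subset_empty, Finsupp.support_eq_empty,
        Nat.cast_one]
      rw [coeff_one]
    · simp [h]
  | succ k ih =>
    rw [schurPoly, stripChains, map_sum]
    by_cases hα : α.support ⊆ Finset.range (k + 1)
    · rw [if_pos hα, Nat.cast_sum]
      refine Finset.sum_congr rfl fun ν hν => ?_
      have hle := card_mono (mem_stripsBelow.1 hν).le
      rw [X_pow_eq, coeff_monomial_mul, one_mul, ih]
      rw [support_subset_range_iff] at hα
      have hsub : ∀ i, (α - Finsupp.single k (μ.card - ν.card)) i =
          α i - if k = i then μ.card - ν.card else 0 := fun i => by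
        rw [Finsupp.tsub_apply, Finsupp.single_apply]
      have hch : stripChains k (⇑(α - Finsupp.single k (μ.card - ν.card))) ν =
          stripChains k α ν :=
        stripChains_congr (fun i hi => by rw [hsub, if_neg hi.ne', Nat.sub_zero]) ν
      rw [hch]
      have hiff : Finsupp.single k (μ.card - ν.card) ≤ α ↔ μ.card - ν.card ≤ α k :=
        Finsupp.single_le_iff
      rw [if_congr hiff rfl rfl]
      simp only [support_subset_range_iff]
      by_cases hc : ν.card + α k = μ.card
      · have hall : ∀ i, k ≤ i → (α - Finsupp.single k (μ.card - ν.card)) i = 0 := by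
          intro i hi
          rw [hsub]
          rcases hi.eq_or_lt with rfl | hi
          · rw [if_pos rfl]
            omega
          · rw [hα i hi, Nat.zero_sub]
        rw [if_pos (by omega), if_pos hall, if_pos hc]
      · rw [if_neg hc, Nat.cast_zero]
        split_ifs with h1 h2
        · exfalso
          have := h2 k le_rfl
          rw [hsub, if_pos rfl] at this
          omega
        · rfl
        · rfl
    · rw [if_neg hα]
      refine Finset.sum_eq_zero fun ν hν => ?_
      rw [X_pow_eq, coeff_monomial_mul, one_mul, ih]
      split_ifs with h1 h2
      · exfalso
        refine hα (support_subset_range_iff.2 fun i hi => ?_)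
        have := support_subset_range_iff.1 h2 i (by omega)
        rw [Finsupp.tsub_apply, Finsupp.single_apply, if_neg (by omega), Nat.sub_zero] at this
        exact this
      · rfl
      · rfl

open Classical in
theorem coeff_completePoly (k a : ℕ) (α : ℕ →₀ ℕ) : coeff α (completePoly k a) =
    if α.support ⊆ Finset.range k ∧ ∑ i ∈ Finset.range k, α i = a then (1 : ℂ) else 0 := by
  induction k generalizing α a with
  | zero =>
    rw [completePoly]
    by_cases ha : a = 0
    · subst ha
      simp [coeff_one]
    · simp [ha, Ne.symm ha]
  | succ k ih =>
    rw [completePoly, map_sum]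
    have hterm : ∀ j ∈ Finset.range (a + 1), coeff α (X k ^ j * completePoly k (a - j)) =
        if j = α k then (if α.support ⊆ Finset.range (k + 1) ∧
          ∑ i ∈ Finset.range (k + 1), α i = a then (1 : ℂ) else 0) else 0 := by
      intro j hj
      rw [Finset.mem_range] at hj
      rw [X_pow_eq, coeff_monomial_mul, one_mul, ih]
      have hsub : ∀ i, (α - Finsupp.single k j) i = α i - if k = i then j else 0 := fun i => by
        rw [Finsupp.tsub_apply, Finsupp.single_apply]
      have hsum : ∑ i ∈ Finset.range k, (α - Finsupp.single k j) i =
          ∑ i ∈ Finset.range k, α i := by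
        refine Finset.sum_congr rfl fun i hi => ?_
        rw [hsub, if_neg (Finset.mem_range.1 hi).ne', Nat.sub_zero]
      have hiff : Finsupp.single k j ≤ α ↔ j ≤ α k := Finsupp.single_le_iff
      rw [if_congr hiff rfl rfl, hsum, Finset.sum_range_succ]
      simp only [support_subset_range_iff]
      by_cases hjk : j = α k
      · subst hjk
        rw [if_pos le_rfl, if_pos rfl]
        refine if_congr (and_congr ⟨fun h i hi => ?_, fun h i hi => ?_⟩ (by omega)) rfl rfl
        · have := h i (by omega)
          rw [hsub, if_neg (by omega)] at this
          exact this
        · rw [hsub]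
          split_ifs with hki
          · rw [hki]; omega
          · rw [h i (by omega)]
      · rw [if_neg hjk]
        split_ifs with h1 h2
        · exfalso
          have := h2.1 k le_rfl
          rw [hsub, if_pos rfl] at this
          omega
        · rfl
        · rfl
    rw [Finset.sum_congr rfl hterm, Finset.sum_ite_eq']
    split_ifs with h1 h2 h2
    · rfl
    · rfl
    · exfalso
      rw [Finset.mem_range] at h1
      have := h2.2
      rw [Finset.sum_range_succ] at this
      omega
    · rfl

/-- Iterate the Pieri rule, starting from the empty diagram. The coefficients do not depend on the
number k of variables, which is what identifies them with Kostka numbers later. -/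
theorem prod_completePoly (k r : ℕ) (α : ℕ → ℕ) :
    ∏ i ∈ Finset.range r, completePoly k (α i) =
      ∑ μ ∈ (finite_card_eq (∑ i ∈ Finset.range r, α i)).toFinset,
        (stripChains r α μ : SymPS) * schurPoly k μ := by
  classical
  induction r with
  | zero =>
    rw [Finset.prod_range_zero, Finset.sum_eq_single ⊥]
    · rw [stripChains, if_pos rfl, Nat.cast_one, one_mul]
      -- In every number of variables the Schur polynomial of the empty diagram is 1.
      clear * -
      induction k with
      | zero => rw [schurPoly, if_pos rfl]
      | succ k ih =>
        rw [schurPoly, Finset.sum_eq_single ⊥]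
        · rw [Nat.sub_self, pow_zero, one_mul, ih]
        · intro ν hν hne
          exact (hne (le_bot_iff.1 (mem_stripsBelow.1 hν).le)).elim
        · intro h
          exact (h (mem_stripsBelow.2 fun i => by simp)).elim
    · intro μ hμ hne
      rw [stripChains, if_neg hne, Nat.cast_zero, zero_mul]
    · intro h
      refine (h ?_).elim
      simp
  | succ r ih =>
    rw [Finset.prod_range_succ, ih, Finset.sum_mul]
    have h1 : ∀ ν, (stripChains r α ν : SymPS) * schurPoly k ν * completePoly k (α r) =
        ∑ μ ∈ stripsAbove (α r) ν, (stripChains r α ν : SymPS) * schurPoly k μ := by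
      intro ν
      rw [← Finset.mul_sum, ← completePoly_mul_schurPoly]
      ring
    rw [Finset.sum_congr rfl fun ν _ => h1 ν]
    simp only [stripChains, Nat.cast_sum, Finset.sum_mul]
    rw [Finset.sum_comm' (t' := (finite_card_eq (∑ i ∈ Finset.range (r + 1), α i)).toFinset)
      (s' := fun μ => (stripsBelow μ).filter fun ν => ν.card + α r = μ.card)]
    · refine Finset.sum_congr rfl fun μ _ => ?_
      rw [Finset.sum_filter]
      refine Finset.sum_congr rfl fun ν _ => ?_
      split_ifs <;> simp
    · intro ν μ
      simp only [Set.Finite.mem_toFinset, Set.mem_ofPred_eq, mem_stripsAbove, Finset.mem_filter,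
        mem_stripsBelow, Finset.sum_range_succ]
      constructor
      · rintro ⟨h1, h2, h3⟩
        exact ⟨⟨h2, h3.symm⟩, by omega⟩
      · rintro ⟨⟨h2, h3⟩, h1⟩
        exact ⟨by omega, h2, h3.symm⟩

/-- The exponent vector of a Young diagram. -/
noncomputable def YoungDiagram.weight (μ : YoungDiagram) : ℕ →₀ ℕ :=
  Finsupp.onFinset (Finset.range μ.card) μ.rowLen fun i hi => by
    rw [Finset.mem_range]
    by_contra! h
    exact hi (rowLen_eq_zero_of_card_le h)

@[simp]
theorem YoungDiagram.weight_apply (μ : YoungDiagram) (i : ℕ) : μ.weight i = μ.rowLen i := rfl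

/-- The Kostka number: the number of semistandard tableaux of shape `μ` and content `ν`. -/
noncomputable def kostka (μ ν : YoungDiagram) : ℕ :=
  Nat.card {T : SemistandardYoungTableau μ // tableauContent T = ν.weight}

theorem coeff_schur (μ ν : YoungDiagram) : coeff ν.weight (schur μ) = (kostka μ ν : ℂ) := rfl

/-- The number of cells with an entry at most `r`. -/
theorem sum_tableauContent {μ : YoungDiagram} (T : SemistandardYoungTableau μ) (r : ℕ) :
    ∑ i ∈ Finset.range r, tableauContent T i =
      (μ.cells.filter fun c => T c.1 c.2 < r).card := by
  rw [Finset.card_eq_sum_card_fiberwise (f := fun c => T c.1 c.2) (t := Finset.range r)]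
  · refine Finset.sum_congr rfl fun i hi => ?_
    rw [tableauContent_apply, Finset.filter_filter]
    congr 1
    refine Finset.filter_congr fun c _ => ⟨fun h => ⟨?_, h⟩, fun h => h.2⟩
    rw [h]
    exact Finset.mem_range.1 hi
  · intro c hc
    exact Finset.mem_coe.2 (Finset.mem_range.2 (Finset.mem_filter.1 (Finset.mem_coe.1 hc)).2)

theorem sum_rowLen_eq_card (μ : YoungDiagram) (r : ℕ) :
    ∑ i ∈ Finset.range r, μ.rowLen i = (μ.cells.filter fun c => c.1 < r).card := by
  rw [Finset.card_eq_sum_card_fiberwise (f := fun c => c.1) (t := Finset.range r)]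
  · refine Finset.sum_congr rfl fun i hi => ?_
    rw [rowLen_eq_card, row, Finset.filter_filter]
    congr 1
    refine Finset.filter_congr fun c _ => ⟨fun h => ⟨?_, h⟩, fun h => h.2⟩
    rw [h]
    exact Finset.mem_range.1 hi
  · intro c hc
    exact Finset.mem_coe.2 (Finset.mem_range.2 (Finset.mem_filter.1 (Finset.mem_coe.1 hc)).2)

theorem SemistandardYoungTableau.le_entry {μ : YoungDiagram} (T : SemistandardYoungTableau μ)
    {i j : ℕ} (hc : (i, j) ∈ μ) : i ≤ T i j := by
  induction i with
  | zero => exact Nat.zero_le _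
  | succ i ih =>
    have h1 := ih (μ.up_left_mem (Nat.le_succ i) le_rfl hc)
    have h2 := T.col_strict (Nat.lt_succ_self i) hc
    simp only [Nat.succ_eq_add_one] at h2
    omega

theorem filter_entry_subset {μ : YoungDiagram} (T : SemistandardYoungTableau μ) (r : ℕ) :
    (μ.cells.filter fun c => T c.1 c.2 < r) ⊆ μ.cells.filter fun c => c.1 < r := by
  rintro ⟨i, j⟩ hc
  rw [Finset.mem_filter] at hc ⊢
  exact ⟨hc.1, (T.le_entry ((mem_cells _).1 hc.1)).trans_lt hc.2⟩

/-- Kostka numbers are triangular for the dominance order. -/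
theorem sum_rowLen_le_of_kostka_ne_zero {μ ν : YoungDiagram} (h : kostka μ ν ≠ 0) (r : ℕ) :
    ∑ i ∈ Finset.range r, ν.rowLen i ≤ ∑ i ∈ Finset.range r, μ.rowLen i := by
  obtain ⟨⟨T, hT⟩⟩ := (Nat.card_ne_zero.1 h).1
  have h1 := sum_tableauContent T r
  rw [hT] at h1
  simp only [weight_apply] at h1
  rw [h1, sum_rowLen_eq_card]
  exact Finset.card_le_card (filter_entry_subset T r)

/-- An entry is never smaller than its row index. When the content is the shape itself, the cells
with entry below r are as many as the cells in the first r rows, so the two sets coincide for every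
r and each entry equals its row index. -/
theorem kostka_self (μ : YoungDiagram) : kostka μ μ = 1 := by
  have huniq : ∀ T : SemistandardYoungTableau μ, tableauContent T = μ.weight →
      ∀ i j, (i, j) ∈ μ → T i j = i := by
    intro T hT i j hc
    have h1 := sum_tableauContent T (i + 1)
    rw [hT] at h1
    simp only [weight_apply] at h1
    rw [sum_rowLen_eq_card] at h1
    have h2 := Finset.eq_of_subset_of_card_le (filter_entry_subset T (i + 1)) h1.le
    have h3 : (i, j) ∈ μ.cells.filter fun c => c.1 < i + 1 :=
      Finset.mem_filter.2 ⟨(mem_cells _).2 hc, Nat.lt_succ_self i⟩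
    rw [← h2] at h3
    exact le_antisymm (Nat.lt_succ_iff.1 (Finset.mem_filter.1 h3).2) (T.le_entry hc)
  have hw : tableauContent (SemistandardYoungTableau.highestWeight μ) = μ.weight := by
    ext i
    rw [tableauContent_apply, weight_apply, rowLen_eq_card, row]
    congr 1
    refine Finset.filter_congr fun c hc => ?_
    rw [SemistandardYoungTableau.highestWeight_apply, if_pos ((mem_cells _).1 hc)]
  rw [kostka, Nat.card_eq_one_iff_unique]
  refine ⟨⟨fun S T => Subtype.ext (SemistandardYoungTableau.ext fun i j => ?_)⟩, ⟨⟨_, hw⟩⟩⟩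
  by_cases hc : (i, j) ∈ μ
  · rw [huniq S.1 S.2 i j hc, huniq T.1 T.2 i j hc]
  · rw [S.1.zeros hc, T.1.zeros hc]

/-! ### Counting pairs of colorings -/

theorem content_eq_iff {X : Type*} [Fintype X] (c : X → ℕ) (α : ℕ →₀ ℕ) :
    content c = α ↔ Finset.univ.val.map c = α.toMultiset := by
  classical
  rw [← Multiset.toFinsupp_eq_iff, eq_comm, @eq_comm _ _ α]
  suffices h : content c = Multiset.toFinsupp (Finset.univ.val.map c) by rw [h]
  ext i
  rw [content_apply, Multiset.toFinsupp_apply, Multiset.count_map, Nat.card_eq_fintype_card,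
    Fintype.card_subtype, Finset.card, Finset.filter_val]
  simp only [eq_comm]

theorem exists_perm_of_map_eq {X Y : Type*} [Fintype X] {c d : X → Y}
    (h : Finset.univ.val.map c = Finset.univ.val.map d) : ∃ σ : Perm X, ∀ x, d (σ x) = c x := by
  classical
  have hcard : ∀ y, Nonempty ({x // c x = y} ≃ {x // d x = y}) := by
    intro y
    rw [← Fintype.card_eq, Fintype.card_subtype, Fintype.card_subtype]
    have h1 := congrArg (Multiset.count y) h
    rw [Multiset.count_map, Multiset.count_map] at h1
    simp only [Finset.card, Finset.filter_val]
    simpa only [eq_comm] using h1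
  let e := fun y => Classical.choice (hcard y)
  exact ⟨Equiv.ofFiberEquiv e, fun x => Equiv.ofFiberEquiv_map e x⟩

theorem exists_map_eq {X Y : Type*} [Fintype X] (s : Multiset Y)
    (hs : Multiset.card s = Fintype.card X) : ∃ c : X → Y, Finset.univ.val.map c = s := by
  obtain ⟨l, rfl⟩ := Quot.exists_rep s
  change l.length = _ at hs
  let e : X ≃ Fin l.length := (Fintype.equivFin X).trans (finCongr hs.symm)
  refine ⟨fun x => l.get (e x), ?_⟩
  have h1 : (Finset.univ.val.map fun x => l.get (e x)) =
      (Finset.univ.val.map e).map l.get := by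
    rw [Multiset.map_map]
    rfl
  have h2 : Finset.univ.val.map e = (Finset.univ : Finset (Fin l.length)).val := by
    rw [← Finset.map_univ_equiv e]
    rfl
  rw [h1, h2]
  change Multiset.map l.get (↑(List.finRange l.length)) = _
  rw [Multiset.map_coe, List.map_get_finRange]
  rfl

/-- Matrices of nonnegative integers with given row and column sums, as multisets of positions. -/
abbrev MarginMultiset (α β : ℕ →₀ ℕ) : Type :=
  {s : Multiset (ℕ × ℕ) // s.map Prod.fst = α.toMultiset ∧ s.map Prod.snd = β.toMultiset}

/-- Pairs of colorings with given contents. -/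
abbrev ColoringPair (X : Type*) [Fintype X] (α β : ℕ →₀ ℕ) : Type _ :=
  {c : X → ℕ × ℕ // content (fun x => (c x).1) = α ∧ content (fun x => (c x).2) = β}

theorem content_comp_perm {X : Type*} [Fintype X] (c : X → ℕ) (σ : Perm X) :
    content (fun x => c (σ x)) = content c :=
  Fintype.sum_equiv σ _ _ fun _ => rfl

instance (X : Type*) [Fintype X] (α β : ℕ →₀ ℕ) : MulAction (Perm X) (ColoringPair X α β) where
  smul σ c := ⟨fun x => c.1 (σ⁻¹ x),
    (content_comp_perm (fun x => (c.1 x).1) σ⁻¹).trans c.2.1,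
    (content_comp_perm (fun x => (c.1 x).2) σ⁻¹).trans c.2.2⟩
  one_smul c := rfl
  mul_smul σ τ c := Subtype.ext (funext fun x => by
    change c.1 ((σ * τ)⁻¹ x) = c.1 (τ⁻¹ (σ⁻¹ x))
    rw [mul_inv_rev]
    rfl)

theorem ColoringPair.smul_apply {X : Type*} [Fintype X] {α β : ℕ →₀ ℕ} (σ : Perm X)
    (c : ColoringPair X α β) (x : X) : (σ • c).1 x = c.1 (σ⁻¹ x) := rfl

instance (X : Type*) [Fintype X] (α β : ℕ →₀ ℕ) : Finite (ColoringPair X α β) := by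
  have h1 := finite_content (X := X) α
  have h2 := finite_content (X := X) β
  refine Finite.of_injective (fun c : ColoringPair X α β =>
    ((⟨_, c.2.1⟩, ⟨_, c.2.2⟩) : {c : X → ℕ // content c = α} × {c : X → ℕ // content c = β})) ?_
  intro c d h
  rw [Prod.ext_iff] at h
  refine Subtype.ext (funext fun x => Prod.ext ?_ ?_)
  · exact congrFun (congrArg Subtype.val h.1) x
  · exact congrFun (congrArg Subtype.val h.2) x

/-- An orbit of pairs of colorings is determined by the multiset of color pairs. The hypothesis on α
ensures that every admissible multiset has as many elements as X and hence comes from a coloring. -/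
theorem card_orbits_coloringPair (X : Type*) [Fintype X] {α β : ℕ →₀ ℕ}
    (hα : Multiset.card α.toMultiset = Fintype.card X) :
    Nat.card (MulAction.orbitRel.Quotient (Perm X) (ColoringPair X α β)) =
      Nat.card (MarginMultiset α β) := by
  let f : ColoringPair X α β → MarginMultiset α β := fun c =>
    ⟨Finset.univ.val.map c.1, by
      rw [Multiset.map_map, Multiset.map_map]
      exact ⟨(content_eq_iff _ _).1 c.2.1, (content_eq_iff _ _).1 c.2.2⟩⟩
  have hf : ∀ (σ : Perm X) c, f (σ • c) = f c := by
    intro σ c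
    refine Subtype.ext ?_
    change Finset.univ.val.map (fun x => c.1 (σ⁻¹ x)) = Finset.univ.val.map c.1
    rw [← Function.comp_def c.1, ← Multiset.map_map]
    congr 1
    conv_rhs => rw [← Finset.map_univ_equiv σ⁻¹]
    rfl
  refine Nat.card_congr (Equiv.ofBijective (Quotient.lift f ?_) ⟨?_, ?_⟩)
  · rintro c d ⟨σ, hσ⟩
    rw [← hσ]
    exact hf σ d
  · intro c d
    refine Quotient.inductionOn₂ c d fun c d h => Quotient.sound ?_
    obtain ⟨σ, hσ⟩ := exists_perm_of_map_eq (congrArg Subtype.val h)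
    refine ⟨σ⁻¹, Subtype.ext (funext fun x => ?_)⟩
    change d.1 (σ⁻¹⁻¹ x) = c.1 x
    rw [inv_inv, hσ]
  · rintro ⟨s, h1, h2⟩
    have hs : Multiset.card s = Fintype.card X := by
      rw [← hα, ← h1, Multiset.card_map]
    obtain ⟨c, hc⟩ := exists_map_eq (X := X) s hs
    refine ⟨Quotient.mk _ ⟨c, ?_, ?_⟩, Subtype.ext hc⟩
    · rw [content_eq_iff, ← h1, ← hc, Multiset.map_map]
      rfl
    · rw [content_eq_iff, ← h2, ← hc, Multiset.map_map]
      rfl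

/-- The number of colorings of content `α` fixed by `σ`. -/
noncomputable def numFixed {X : Type*} [Fintype X] (α : ℕ →₀ ℕ) (σ : Perm X) : ℕ :=
  Nat.card {c : FixedColoring σ // content c.1 = α}

theorem coeff_powerSumPart {X : Type} [Fintype X] [DecidableEq X] (α : ℕ →₀ ℕ) (σ : Perm X) :
    coeff α (powerSumPart σ.partition) = (numFixed α σ : ℂ) := by
  rw [powerSumPart_eq_genSeries, coeff_genSeries, numFixed]

/-- Burnside's lemma for the action on pairs of colorings: a pair is fixed exactly when both of its
components are. -/
theorem sum_numFixed_mul_numFixed (X : Type*) [Fintype X] [DecidableEq X] {α β : ℕ →₀ ℕ}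
    (hα : Multiset.card α.toMultiset = Fintype.card X) :
    ∑ σ : Perm X, numFixed α σ * numFixed β σ =
      Nat.card (MarginMultiset α β) * (Fintype.card X).factorial := by
  classical
  have := Fintype.ofFinite (ColoringPair X α β)
  have h := MulAction.sum_card_fixedBy_eq_card_orbits_mul_card_group (Perm X) (ColoringPair X α β)
  rw [Fintype.card_perm, ← Nat.card_eq_fintype_card, card_orbits_coloringPair X hα] at h
  rw [← h]
  refine Finset.sum_congr rfl fun σ _ => ?_
  rw [← Nat.card_eq_fintype_card, numFixed, numFixed, ← Nat.card_prod]
  refine Nat.card_congr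
    { toFun := fun p => ⟨⟨fun x => (p.1.1.1 x, p.2.1.1 x), p.1.2, p.2.2⟩, ?_⟩
      invFun := fun c => (⟨⟨fun x => (c.1.1 x).1, ?_⟩, c.1.2.1⟩,
        ⟨⟨fun x => (c.1.1 x).2, ?_⟩, c.1.2.2⟩)
      left_inv := fun p => rfl
      right_inv := fun c => rfl }
  · refine Subtype.ext (funext fun x => ?_)
    have h1 := p.1.1.2 (σ⁻¹ x)
    have h2 := p.2.1.2 (σ⁻¹ x)
    rw [Equiv.Perm.inv_def, Equiv.apply_symm_apply] at h1 h2
    exact Prod.ext h1.symm h2.symm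
  all_goals
    intro x
    have h1 := congrFun (congrArg Subtype.val c.2) (σ x)
    rw [ColoringPair.smul_apply, Equiv.Perm.inv_def, Equiv.symm_apply_apply] at h1
    first
    | exact (congrArg Prod.fst h1).symm
    | exact (congrArg Prod.snd h1).symm

/-- Multisets of pairs as matrices. -/
noncomputable def pairMultisetEquiv : Multiset (ℕ × ℕ) ≃+ (ℕ →₀ ℕ →₀ ℕ) :=
  Multiset.toFinsupp.trans Finsupp.curryAddEquiv

theorem pairMultisetEquiv_singleton (p : ℕ × ℕ) :
    pairMultisetEquiv {p} = Finsupp.single p.1 (Finsupp.single p.2 1) := by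
  rw [pairMultisetEquiv, AddEquiv.trans_apply, Multiset.toFinsupp_singleton]
  exact Finsupp.curry_single _ _

theorem degree_pairMultisetEquiv (s : Multiset (ℕ × ℕ)) (i : ℕ) :
    (pairMultisetEquiv s i).degree = (s.map Prod.fst).toFinsupp i := by
  classical
  induction s using Multiset.induction_on with
  | empty => simp
  | cons p s ih =>
    rw [← Multiset.singleton_add, map_add, Multiset.map_add, map_add, Finsupp.add_apply,
      Finsupp.add_apply, map_add, ih, pairMultisetEquiv_singleton, Multiset.map_singleton,
      Multiset.toFinsupp_singleton, Finsupp.single_apply, Finsupp.single_apply]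
    split_ifs <;> simp

theorem sum_pairMultisetEquiv (s : Multiset (ℕ × ℕ)) :
    Finsupp.liftAddHom (fun _ => AddMonoidHom.id (ℕ →₀ ℕ)) (pairMultisetEquiv s) =
      (s.map Prod.snd).toFinsupp := by
  classical
  induction s using Multiset.induction_on with
  | empty => simp
  | cons p s ih =>
    rw [← Multiset.singleton_add, map_add, Multiset.map_add, map_add, map_add, ih,
      pairMultisetEquiv_singleton, Multiset.map_singleton, Multiset.toFinsupp_singleton]
    simp

/-- Choosing a monomial of degree α_i from the i-th factor is choosing row i of a matrix with row
sums α; the product of these monomials records the column sums. -/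
theorem coeff_prod_completePoly {k r : ℕ} {α β : ℕ →₀ ℕ} (hα : α.support ⊆ Finset.range r)
    (hβ : β.support ⊆ Finset.range k) :
    coeff β (∏ i ∈ Finset.range r, completePoly k (α i)) =
      (Nat.card (MarginMultiset α β) : ℂ) := by
  classical
  rw [coeff_prod]
  simp only [coeff_completePoly, Finset.prod_boole]
  rw [Finset.sum_boole]
  congr 1
  rw [← Fintype.card_coe, ← Nat.card_eq_fintype_card]
  refine (Nat.card_congr (pairMultisetEquiv.toEquiv.subtypeEquiv fun s => ?_)).symm
  change _ ↔ pairMultisetEquiv s ∈ _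
  have h1 := degree_pairMultisetEquiv s
  have h2 := sum_pairMultisetEquiv s
  rw [Finset.mem_filter, Finset.mem_finsuppAntidiag]
  have e1 : s.map Prod.fst = α.toMultiset ↔ ∀ i, (pairMultisetEquiv s i).degree = α i := by
    rw [← Multiset.toFinsupp.injective.eq_iff, Finsupp.toMultiset_toFinsupp, DFunLike.ext_iff]
    simp only [h1]
  have e2 : s.map Prod.snd = β.toMultiset ↔
      Finsupp.liftAddHom (fun _ => AddMonoidHom.id (ℕ →₀ ℕ)) (pairMultisetEquiv s) = β := by
    rw [← Multiset.toFinsupp.injective.eq_iff, Finsupp.toMultiset_toFinsupp, h2]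
  rw [e1, e2]
  generalize pairMultisetEquiv s = l
  have hsum : l.support ⊆ Finset.range r → (Finset.range r).sum l =
      Finsupp.liftAddHom (fun _ => AddMonoidHom.id (ℕ →₀ ℕ)) l := by
    intro hl
    rw [Finsupp.liftAddHom_apply, Finsupp.sum]
    exact (Finset.sum_subset hl fun i _ hi => by
      rw [Finsupp.notMem_support_iff] at hi; exact hi).symm
  have hdeg : ∀ i, (l i).support ⊆ Finset.range k →
      (l i).degree = ∑ j ∈ Finset.range k, l i j := by
    intro i hi
    rw [Finsupp.degree_apply]
    exact Finset.sum_subset hi fun j _ hj => Finsupp.notMem_support_iff.1 hj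
  rw [support_subset_range_iff] at hα
  constructor
  · rintro ⟨ha, hb⟩
    have hl : l.support ⊆ Finset.range r := by
      intro i hi
      rw [Finset.mem_range]
      by_contra! hr
      have h0 := ha i
      rw [hα i hr, Finsupp.degree_eq_zero_iff] at h0
      exact Finsupp.mem_support_iff.1 hi h0
    refine ⟨⟨(hsum hl).trans hb, hl⟩, fun i hi => ?_⟩
    have hsupp : (l i).support ⊆ Finset.range k := by
      intro j hj
      refine hβ (Finsupp.mem_support_iff.2 fun h0 => Finsupp.mem_support_iff.1 hj ?_)
      rw [← hb, ← hsum hl, Finsupp.finsetSum_apply, Finset.sum_eq_zero_iff] at h0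
      exact h0 i hi
    exact ⟨hsupp, (hdeg i hsupp).symm.trans (ha i)⟩
  · rintro ⟨⟨hb, hl⟩, ha⟩
    refine ⟨fun i => ?_, (hsum hl).symm.trans hb⟩
    by_cases hi : i ∈ Finset.range r
    · rw [hdeg i (ha i hi).1, (ha i hi).2]
    · rw [Finsupp.notMem_support_iff.1 fun h => hi (hl h), hα i (by simpa using hi), map_zero]

/-! ### Sums over conjugacy classes -/

/-- `Perm.cycleType` omits fixed points, so the parts equal to 1 are split off; their contribution
to z is the factorial of the number of fixed points. -/
theorem card_partition_eq_mul_zPart {X : Type*} [Fintype X] [DecidableEq X]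
    (lam : (Fintype.card X).Partition) :
    (Finset.univ.filter fun σ : Perm X => σ.partition = lam).card * zPart lam =
      (Fintype.card X).factorial := by
  classical
  set m := lam.parts.filter fun k => 2 ≤ k with hm
  have hrest : lam.parts.filter (fun k => ¬ 2 ≤ k) =
      Multiset.replicate (lam.parts.count 1) 1 := by
    rw [← Multiset.filter_eq']
    refine Multiset.filter_congr fun k hk => ?_
    have := lam.parts_pos hk
    omega
  have hparts : m + Multiset.replicate (lam.parts.count 1) 1 = lam.parts := by
    rw [hm, ← hrest, Multiset.filter_add_not]
  have hsum : m.sum + lam.parts.count 1 = Fintype.card X := by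
    have := congrArg Multiset.sum hparts
    rwa [Multiset.sum_add, Multiset.sum_replicate, smul_eq_mul, mul_one, lam.parts_sum] at this
  have hfilter : (Finset.univ.filter fun σ : Perm X => σ.partition = lam) =
      Finset.univ.filter fun σ : Perm X => σ.cycleType = m := by
    refine Finset.filter_congr fun σ _ => ⟨?_, fun h => ?_⟩
    · rintro rfl
      exact Perm.filter_parts_partition_eq_cycleType.symm
    · rw [Nat.Partition.ext_iff, parts_partition_eq, h, ← hparts]
      congr 2
      omega
  have h := Perm.card_of_cycleType_mul_eq X m
  rw [if_pos ⟨by omega, fun a ha => (Multiset.mem_filter.1 ha).2⟩] at h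
  rw [hfilter, ← h]
  congr 1
  have hcount : ∀ k, 2 ≤ k → lam.parts.count k = m.count k := fun k hk => by
    rw [hm, Multiset.count_filter_of_pos hk]
  rw [zPart, Finset.prod_mul_distrib, ← Finset.prod_multiset_count]
  have hprod : lam.parts.prod = m.prod := by
    rw [← hparts, Multiset.prod_add, Multiset.prod_replicate, one_pow, mul_one]
  have hfact : ∏ i ∈ lam.parts.toFinset, (lam.parts.count i).factorial =
      (lam.parts.count 1).factorial * ∏ i ∈ m.toFinset, (m.count i).factorial := by
    have h1 : 1 ∉ m.toFinset := by
      rw [Multiset.mem_toFinset, hm, Multiset.mem_filter]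
      omega
    have h2 : lam.parts.toFinset ⊆ insert 1 m.toFinset := by
      intro k hk
      rw [Multiset.mem_toFinset] at hk
      have := lam.parts_pos hk
      rw [Finset.mem_insert, Multiset.mem_toFinset, hm, Multiset.mem_filter]
      by_cases hk1 : k = 1
      · exact Or.inl hk1
      · exact Or.inr ⟨hk, by omega⟩
    rw [Finset.prod_subset h2, Finset.prod_insert h1]
    · congr 1
      refine Finset.prod_congr rfl fun k hk => ?_
      rw [hcount k (Multiset.mem_filter.1 (Multiset.mem_toFinset.1 hk)).2]
    · intro k _ hk
      rw [Multiset.mem_toFinset, ← Multiset.count_eq_zero] at hk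
      rw [hk, Nat.factorial_zero]
  rw [hprod, hfact, show Fintype.card X - m.sum = lam.parts.count 1 by omega]
  ring

theorem zPart_ne_zero {n : ℕ} (lam : n.Partition) : zPart lam ≠ 0 := by
  rw [zPart, Finset.prod_ne_zero_iff]
  intro i hi
  have := lam.parts_pos (Multiset.mem_toFinset.1 hi)
  have := Nat.factorial_ne_zero (lam.parts.count i)
  positivity

theorem sum_perm_eq_sum_partition {X : Type*} [Fintype X] [DecidableEq X] {M : Type*}
    [AddCommGroup M] [Module ℂ M] (F : (Fintype.card X).Partition → M) :
    ((Fintype.card X).factorial : ℂ)⁻¹ • ∑ σ : Perm X, F σ.partition =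
      ∑ lam, (zPart lam : ℂ)⁻¹ • F lam := by
  rw [← Finset.sum_fiberwise (s := Finset.univ) (g := fun σ : Perm X => σ.partition),
    Finset.smul_sum]
  refine Finset.sum_congr rfl fun lam _ => ?_
  rw [Finset.sum_congr rfl (g := fun _ => F lam) fun σ hσ => by rw [(Finset.mem_filter.1 hσ).2],
    Finset.sum_const, ← Nat.cast_smul_eq_nsmul ℂ, smul_smul]
  congr 1
  have h := card_partition_eq_mul_zPart lam
  have hz := zPart_ne_zero lam
  have hn := (Fintype.card X).factorial_ne_zero
  rw [← h] at hn ⊢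
  push_cast
  have hz' : (zPart lam : ℂ) ≠ 0 := Nat.cast_ne_zero.2 hz
  have hc : ((Finset.univ.filter fun σ : Perm X => σ.partition = lam).card : ℂ) ≠ 0 :=
    Nat.cast_ne_zero.2 (left_ne_zero_of_mul hn)
  field_simp

/-! ### The transition matrix between power sums and Schur functions -/

/-- Young diagrams with `n` cells. -/
abbrev DiagramOfCard (n : ℕ) : Type := {μ : YoungDiagram // μ.card = n}

noncomputable instance (n : ℕ) : Fintype (DiagramOfCard n) := (finite_card_eq n).fintype

theorem card_toMultiset_weight (μ : YoungDiagram) :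
    Multiset.card μ.weight.toMultiset = μ.card := by
  rw [Finsupp.card_toMultiset, Finsupp.sum, card_eq_sum_rowLen (rowLen_eq_zero_of_card_le le_rfl)]
  refine Finset.sum_subset (Finsupp.support_onFinset_subset) fun i _ hi => ?_
  exact Finsupp.notMem_support_iff.1 hi

theorem support_weight_subset (μ : YoungDiagram) : μ.weight.support ⊆ Finset.range μ.card :=
  Finsupp.support_onFinset_subset

/-- The matrix count is a coefficient of the product of the complete symmetric functions indexed by
the rows of μ, which the Pieri rule expands in Schur functions. -/
theorem card_marginMultiset (μ : YoungDiagram) (β : ℕ →₀ ℕ) :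
    (Nat.card (MarginMultiset μ.weight β) : ℂ) =
      ∑ κ : DiagramOfCard μ.card, (kostka κ.1 μ : ℂ) * coeff β (schur κ.1) := by
  classical
  -- Enough variables to see all of β.
  obtain ⟨k, hk⟩ : ∃ k, β.support ⊆ Finset.range k :=
    ⟨β.support.sup id + 1, fun i hi => Finset.mem_range.2
      (Nat.lt_succ_of_le (Finset.le_sup (f := id) hi))⟩
  rw [← coeff_prod_completePoly (support_weight_subset μ) hk, prod_completePoly, map_sum]
  have hsum : ∑ i ∈ Finset.range μ.card, μ.weight i = μ.card :=
    (card_eq_sum_rowLen (rowLen_eq_zero_of_card_le le_rfl)).symm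
  rw [hsum, ← Finset.sum_coe_sort]
  refine Fintype.sum_equiv (Equiv.subtypeEquivRight fun κ => by simp) _ _ fun κ => ?_
  change _ = (kostka κ.1 μ : ℂ) * coeff β (schur κ.1)
  rw [coeff_schur_eq κ.1 hk, ← coeff_schur, coeff_schur_eq κ.1 (support_weight_subset μ),
    coeff_schurPoly, if_pos (support_weight_subset μ), ← coeff_C_mul]
  rw [map_natCast]

/-- A form of the Cauchy identity: averaging over the symmetric group turns the left side into the
Burnside count of matrices with margins μ and β. -/
theorem sum_powerSumPart_eq (n : ℕ) (μ : DiagramOfCard n) (β : ℕ →₀ ℕ) :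
    ∑ lam : n.Partition, (zPart lam : ℂ)⁻¹ *
        (coeff μ.1.weight (powerSumPart lam) * coeff β (powerSumPart lam)) =
      ∑ κ : DiagramOfCard n, (kostka κ.1 μ.1 : ℂ) * coeff β (schur κ.1) := by
  obtain ⟨μ, rfl⟩ := μ
  rw [← card_marginMultiset]
  have key : ∀ (X : Type) [Fintype X] [DecidableEq X], Fintype.card X = μ.card →
      ∑ lam : (Fintype.card X).Partition, (zPart lam : ℂ)⁻¹ *
        (coeff μ.weight (powerSumPart lam) * coeff β (powerSumPart lam)) =
      (Nat.card (MarginMultiset μ.weight β) : ℂ) := by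
    intro X _ _ hX
    have h := sum_perm_eq_sum_partition (X := X)
      fun lam => coeff μ.weight (powerSumPart lam) * coeff β (powerSumPart lam)
    simp only [smul_eq_mul, coeff_powerSumPart] at h
    rw [← h]
    have h2 := sum_numFixed_mul_numFixed X (α := μ.weight) (β := β)
      (by rw [card_toMultiset_weight, hX])
    have hn : ((Fintype.card X).factorial : ℂ) ≠ 0 :=
      Nat.cast_ne_zero.2 (Fintype.card X).factorial_ne_zero
    rw [inv_mul_eq_iff_eq_mul₀ hn, mul_comm]
    exact_mod_cast h2
  have h := key (Fin μ.card) (Fintype.card_fin _)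
  rw [Fintype.card_fin] at h
  exact h

theorem sum_rowLens (μ : YoungDiagram) : μ.rowLens.sum = μ.card := by
  have h0 : μ.rowLen (μ.colLen 0) = 0 := by
    by_contra h
    exact lt_irrefl _ (mem_iff_lt_colLen.1 (mem_iff_lt_rowLen.2 (Nat.pos_of_ne_zero h)))
  rw [card_eq_sum_rowLen h0, rowLens]
  rfl

/-- Young diagrams with `n` cells correspond to partitions of `n`. -/
theorem nonempty_diagramOfCard_equiv (n : ℕ) : Nonempty (DiagramOfCard n ≃ n.Partition) := by
  let f : DiagramOfCard n → n.Partition := fun μ =>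
    { parts := μ.1.rowLens
      parts_pos := fun {i} hi => μ.1.pos_of_mem_rowLens i (Multiset.mem_coe.1 hi)
      parts_sum := by rw [Multiset.sum_coe, sum_rowLens, μ.2] }
  refine ⟨Equiv.ofBijective f ⟨fun μ ν h => ?_, fun lam => ?_⟩⟩
  · have h' : (μ.1.rowLens : Multiset ℕ) = ν.1.rowLens := congrArg Nat.Partition.parts h
    have h2 := (Multiset.coe_eq_coe.1 h').eq_of_sortedGE μ.1.rowLens_sorted ν.1.rowLens_sorted
    exact Subtype.ext (equivListRowLens.injective (Subtype.ext h2))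
  · have hs : (lam.parts.sort (· ≥ ·)).SortedGE := (Multiset.pairwise_sort _ _).sortedGE
    have hr : (ofRowLens _ hs).rowLens = lam.parts.sort (· ≥ ·) :=
      rowLens_ofRowLens_eq_self fun x hx => lam.parts_pos ((Multiset.mem_sort _).1 hx)
    have hsum : (ofRowLens _ hs).card = n := by
      rw [← sum_rowLens, hr, ← Multiset.sum_coe, Multiset.sort_eq, lam.parts_sum]
    refine ⟨⟨_, hsum⟩, Nat.Partition.ext ?_⟩
    change ((ofRowLens _ hs).rowLens : Multiset ℕ) = lam.parts
    rw [hr, Multiset.sort_eq]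

noncomputable instance (n : ℕ) : LinearOrder (DiagramOfCard n) :=
  LinearOrder.lift' (fun μ => toLex μ.1.rowLen) fun _ _ h =>
    Subtype.ext (ext_rowLen fun i => congrFun (toLex.injective h) i)

/-- The matrix of Kostka numbers. -/
noncomputable def kostkaMatrix (n : ℕ) : Matrix (DiagramOfCard n) (DiagramOfCard n) ℤ :=
  fun μ κ => kostka κ.1 μ.1

/-- The lexicographic order on row lengths refines dominance, so the matrix is upper triangular,
with diagonal entries 1. Hence its inverse is integral. -/
theorem det_kostkaMatrix (n : ℕ) : (kostkaMatrix n).det = 1 := by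
  rw [Matrix.det_of_isUpperTriangular]
  · refine Finset.prod_eq_one fun μ _ => ?_
    rw [kostkaMatrix, kostka_self, Nat.cast_one]
  · intro μ κ hlt
    by_contra hne
    have hne' : kostka κ.1 μ.1 ≠ 0 := by
      intro h
      exact hne (by rw [kostkaMatrix, h, Nat.cast_zero])
    obtain ⟨r, hr, hr'⟩ := (hlt : toLex κ.1.rowLen < toLex μ.1.rowLen)
    have hr2 : ∀ j < r, κ.1.rowLen j = μ.1.rowLen j := hr
    have hr2' : κ.1.rowLen r < μ.1.rowLen r := hr'
    have h := sum_rowLen_le_of_kostka_ne_zero hne' (r + 1)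
    have hs : ∑ i ∈ Finset.range r, κ.1.rowLen i = ∑ i ∈ Finset.range r, μ.1.rowLen i :=
      Finset.sum_congr rfl fun i hi => hr2 i (Finset.mem_range.1 hi)
    rw [Finset.sum_range_succ, Finset.sum_range_succ, hs] at h
    omega

theorem isUnit_det_kostkaMatrix (n : ℕ) : IsUnit (kostkaMatrix n).det := by
  rw [det_kostkaMatrix]
  exact isUnit_one

/-- Coefficients of power sums at the weights of diagrams: the values of the permutation
characters. -/
noncomputable def permCharMatrix (n : ℕ) : Matrix (DiagramOfCard n) n.Partition ℂ :=
  fun μ lam => coeff μ.1.weight (powerSumPart lam)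

/-- The character table of the symmetric group. -/
noncomputable def charTable (n : ℕ) : Matrix (DiagramOfCard n) n.Partition ℂ :=
  (kostkaMatrix n)⁻¹.map (Int.castRingHom ℂ) * permCharMatrix n

/-- The diagonal matrix with entries `z_lam⁻¹`. -/
noncomputable def invZMatrix (n : ℕ) : Matrix n.Partition n.Partition ℂ :=
  Matrix.diagonal fun lam => (zPart lam : ℂ)⁻¹

theorem map_inv_mul_map_kostkaMatrix (n : ℕ) :
    (kostkaMatrix n)⁻¹.map (Int.castRingHom ℂ) * (kostkaMatrix n).map (Int.castRingHom ℂ) = 1 := by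
  rw [← Matrix.map_mul, Matrix.nonsing_inv_mul _ (isUnit_det_kostkaMatrix n),
    Matrix.map_one _ (map_zero _) (map_one _)]

theorem permCharMatrix_mulVec (n : ℕ) (β : ℕ →₀ ℕ) :
    (permCharMatrix n * invZMatrix n).mulVec (fun lam => coeff β (powerSumPart lam)) =
      ((kostkaMatrix n).map (Int.castRingHom ℂ)).mulVec fun κ => coeff β (schur κ.1) := by
  ext μ
  have h := sum_powerSumPart_eq n μ β
  simp only [Matrix.mulVec, dotProduct, invZMatrix, Matrix.mul_diagonal, permCharMatrix,
    Matrix.map_apply, kostkaMatrix, Int.coe_castRingHom, Int.cast_natCast]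
  rw [← h]
  exact Finset.sum_congr rfl fun lam _ => by ring

theorem charTable_mulVec (n : ℕ) (β : ℕ →₀ ℕ) :
    (charTable n * invZMatrix n).mulVec (fun lam => coeff β (powerSumPart lam)) =
      fun κ => coeff β (schur κ.1) := by
  rw [charTable, Matrix.mul_assoc, ← Matrix.mulVec_mulVec, permCharMatrix_mulVec,
    Matrix.mulVec_mulVec, map_inv_mul_map_kostkaMatrix, Matrix.one_mulVec]

/-- Row orthogonality. Pairing with the permutation characters gives the transposed Kostka matrix,
which the remaining inverse Kostka factor cancels. -/
theorem charTable_mul_transpose (n : ℕ) :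
    charTable n * invZMatrix n * (charTable n).transpose = 1 := by
  have h : charTable n * invZMatrix n * (permCharMatrix n).transpose =
      ((kostkaMatrix n).map (Int.castRingHom ℂ)).transpose := by
    ext κ ν
    have h := congrFun (charTable_mulVec n ν.1.weight) κ
    rw [coeff_schur] at h
    have h2 : (kostka κ.1 ν.1 : ℂ) = ((kostkaMatrix n).map (Int.castRingHom ℂ)).transpose κ ν := by
      simp [kostkaMatrix]
    rw [← h2, ← h]
    rfl
  conv_lhs => rw [charTable, Matrix.transpose_mul, ← charTable, ← Matrix.mul_assoc, h]
  rw [← Matrix.transpose_mul, map_inv_mul_map_kostkaMatrix, Matrix.transpose_one]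

/-- Column orthogonality follows from row orthogonality because diagrams and partitions of n are
equinumerous, so a one-sided inverse is two-sided. -/
theorem transpose_charTable_mul (n : ℕ) :
    (charTable n).transpose * (charTable n * invZMatrix n) = 1 :=
  (Matrix.mul_eq_one_comm_of_equiv (nonempty_diagramOfCard_equiv n).some).1
    (charTable_mul_transpose n)

/-- The inverse of the expansion of Schur functions in terms of power sums. -/
theorem powerSumPart_eq_sum_schur {n : ℕ} (lam : n.Partition) :
    powerSumPart lam = ∑ κ, charTable n κ lam • schur κ.1 := by
  ext β
  have h := congrArg (fun v => (charTable n).transpose.mulVec v lam) (charTable_mulVec n β)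
  simp only [Matrix.mulVec_mulVec, transpose_charTable_mul, Matrix.one_mulVec] at h
  rw [h, map_sum]
  exact Finset.sum_congr rfl fun κ _ => by
    rw [coeff_smul]
    rfl

/-- A class function of norm one, all of whose scalar products with the permutation characters
are natural numbers, has a Schur function as its Frobenius characteristic. -/
theorem exists_sum_eq_schur {n : ℕ} (χ : n.Partition → ℂ) (m : DiagramOfCard n → ℕ)
    (hm : ∀ ν : DiagramOfCard n,
      ∑ lam, (zPart lam : ℂ)⁻¹ * (coeff ν.1.weight (powerSumPart lam) * χ lam) = m ν)
    (hχ : ∑ lam, (zPart lam : ℂ)⁻¹ * (χ lam * χ lam) = 1) :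
    ∃ μ : YoungDiagram, ∑ lam, (zPart lam : ℂ)⁻¹ • χ lam • powerSumPart lam = schur μ := by
  set d : DiagramOfCard n → ℤ := fun ν => m ν with hd
  -- The coordinates in Schur functions; they are integers because the Kostka matrix is invertible
  -- over ℤ.
  set c : DiagramOfCard n → ℤ := (kostkaMatrix n)⁻¹.mulVec d with hc
  have hcast : ∀ (M : Matrix (DiagramOfCard n) (DiagramOfCard n) ℤ) (v : DiagramOfCard n → ℤ),
      (M.map (Int.castRingHom ℂ)).mulVec (fun κ => (v κ : ℂ)) =
        fun κ => ((M.mulVec v κ : ℤ) : ℂ) := by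
    intro M v
    ext κ
    simp [Matrix.mulVec, dotProduct]
  have hdχ : (permCharMatrix n * invZMatrix n).mulVec χ = fun κ => (d κ : ℂ) := by
    ext ν
    rw [hd]
    simp only [Int.cast_natCast]
    rw [← hm ν]
    simp only [Matrix.mulVec, dotProduct, invZMatrix, Matrix.mul_diagonal, permCharMatrix]
    exact Finset.sum_congr rfl fun lam _ => by ring
  have hcχ : (charTable n * invZMatrix n).mulVec χ = fun κ => (c κ : ℂ) := by
    rw [charTable, Matrix.mul_assoc, ← Matrix.mulVec_mulVec, hdχ, hcast]
  have hexp : ∑ lam, (zPart lam : ℂ)⁻¹ • χ lam • powerSumPart lam =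
      ∑ κ, (c κ : ℂ) • schur κ.1 := by
    simp_rw [powerSumPart_eq_sum_schur, Finset.smul_sum]
    rw [Finset.sum_comm]
    refine Finset.sum_congr rfl fun κ _ => ?_
    rw [← congrFun hcχ κ]
    simp only [smul_smul, ← Finset.sum_smul, Matrix.mulVec, dotProduct, invZMatrix,
      Matrix.mul_diagonal]
    congr 1
    exact Finset.sum_congr rfl fun lam _ => by ring
  have hnorm : ∑ κ, c κ * c κ = 1 := by
    have h1 : (fun κ => (c κ : ℂ)) ⬝ᵥ (fun κ => (c κ : ℂ)) = 1 := by
      rw [← hcχ]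
      nth_rewrite 1 [← Matrix.vecMul_transpose]
      rw [Matrix.transpose_mul, ← Matrix.dotProduct_mulVec, ← Matrix.mulVec_mulVec,
        Matrix.mulVec_mulVec χ, transpose_charTable_mul, Matrix.one_mulVec, ← hχ]
      simp only [Matrix.mulVec, dotProduct, invZMatrix, Matrix.diagonal_transpose,
        Matrix.diagonal_apply, ite_mul, zero_mul, Finset.sum_ite_eq, Finset.mem_univ, if_true]
      exact Finset.sum_congr rfl fun lam _ => by ring
    have h2 : ((∑ κ, c κ * c κ : ℤ) : ℂ) = 1 := by
      rw [← h1]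
      simp [dotProduct]
    exact_mod_cast h2
  obtain ⟨κ, hκ⟩ : ∃ κ, c κ ≠ 0 := by
    by_contra! h
    simp [h] at hnorm
  -- A second nonzero coordinate would raise the sum of squares to at least 2.
  have hzero : ∀ ν, ν ≠ κ → c ν = 0 := by
    intro ν hν
    by_contra h
    have h3 : c κ * c κ + c ν * c ν ≤ ∑ κ, c κ * c κ := by
      rw [← Finset.sum_pair (f := fun κ => c κ * c κ) hν.symm]
      exact Finset.sum_le_sum_of_subset_of_nonneg (Finset.subset_univ _)
        fun i _ _ => mul_self_nonneg _
    have := mul_self_pos.2 h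
    have := mul_self_pos.2 hκ
    omega
  -- The only nonzero coordinate is 1 or -1. The diagonal Kostka number being 1, it equals the
  -- pairing `d κ`, a natural number, so it is not -1.
  have hone : c κ = 1 := by
    rw [Finset.sum_eq_single κ (fun ν _ h => by rw [hzero ν h, zero_mul]) (by simp)] at hnorm
    have hK : (kostkaMatrix n).mulVec c κ = d κ := by
      rw [hc, Matrix.mulVec_mulVec, Matrix.mul_nonsing_inv _ (isUnit_det_kostkaMatrix n),
        Matrix.one_mulVec]
    rw [Matrix.mulVec, dotProduct,
      Finset.sum_eq_single κ (fun ν _ h => by rw [hzero ν h, mul_zero]) (by simp),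
      kostkaMatrix, kostka_self, Nat.cast_one, one_mul] at hK
    have : 0 ≤ c κ := by rw [hK]; exact Int.natCast_nonneg _
    nlinarith
  refine ⟨κ.1, ?_⟩
  rw [hexp, Finset.sum_eq_single κ (fun ν _ h => by rw [hzero ν h, Int.cast_zero, zero_smul])
    (by simp), hone, Int.cast_one, one_smul]

/-! ### Frobenius characteristics of arbitrary representations -/

theorem trace_mapDomainLinearMap {Y : Type*} [Finite Y] (f : Y → Y) :
    LinearMap.trace ℂ (MonoidAlgebra ℂ Y) (MonoidAlgebra.mapDomainLinearMap ℂ ℂ f) =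
      Nat.card {y // f y = y} := by
  classical
  have := Fintype.ofFinite Y
  rw [LinearMap.trace_eq_matrix_trace ℂ (MonoidAlgebra.basis Y ℂ), Matrix.trace,
    Nat.card_eq_fintype_card, Fintype.card_subtype, Finset.card_filter, Nat.cast_sum]
  refine Finset.sum_congr rfl fun y _ => ?_
  rw [Matrix.diag_apply, LinearMap.toMatrix_apply, MonoidAlgebra.basis_apply,
    show MonoidAlgebra.mapDomainLinearMap ℂ ℂ f (MonoidAlgebra.single y 1) =
      MonoidAlgebra.single (f y) 1 by simp]
  change ((MonoidAlgebra.single (f y) 1 : MonoidAlgebra ℂ Y).coeff y) = _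
  rw [MonoidAlgebra.coeff_single, Finsupp.single_apply, Nat.cast_ite, Nat.cast_one, Nat.cast_zero]

instance {Y : Type*} [Finite Y] : FiniteDimensional ℂ (MonoidAlgebra ℂ Y) :=
  Module.Finite.of_basis (MonoidAlgebra.basis Y ℂ)

theorem character_ofMulAction {G Y : Type*} [Group G] [MulAction G Y] [Finite Y] (g : G) :
    (Representation.ofMulAction ℂ G Y).character g = Nat.card {y : Y // g • y = y} := by
  rw [← trace_mapDomainLinearMap]
  rfl

/-- Colorings with given content. -/
abbrev ContentColoring (X : Type*) [Fintype X] (α : ℕ →₀ ℕ) : Type _ :=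
  {c : X → ℕ // content c = α}

instance (X : Type*) [Fintype X] (α : ℕ →₀ ℕ) : MulAction (Perm X) (ContentColoring X α) where
  smul σ c := ⟨fun x => c.1 (σ⁻¹ x),
    (Equiv.sum_comp σ⁻¹ fun x => Finsupp.single (c.1 x) 1).trans c.2⟩
  one_smul c := rfl
  mul_smul σ τ c := Subtype.ext (funext fun x => by
    change c.1 ((σ * τ)⁻¹ x) = c.1 (τ⁻¹ (σ⁻¹ x))
    rw [mul_inv_rev, Perm.mul_apply])

instance (X : Type*) [Fintype X] (α : ℕ →₀ ℕ) : Finite (ContentColoring X α) :=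
  finite_content α

theorem card_fixed_contentColoring {X : Type*} [Fintype X] (α : ℕ →₀ ℕ) (σ : Perm X) :
    Nat.card {c : ContentColoring X α // σ⁻¹ • c = c} = numFixed α σ := by
  refine Nat.card_congr
    { toFun := fun c => ⟨⟨c.1.1, fun x => ?_⟩, c.1.2⟩
      invFun := fun c => ⟨⟨c.1.1, c.2⟩, Subtype.ext (funext fun x => ?_)⟩
      left_inv := fun c => rfl
      right_inv := fun c => rfl }
  · exact congrFun (congrArg Subtype.val c.2) x
  · exact c.1.2 x

section

variable {X : Type} [Fintype X] [DecidableEq X] {V : Type} [AddCommGroup V] [Module ℂ V]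

theorem character_eq_of_partition_eq (ρ : Representation ℂ (Perm X) V) {σ τ : Perm X}
    (h : σ.partition = τ.partition) : ρ.character σ = ρ.character τ := by
  obtain ⟨π, rfl⟩ := isConj_iff.1 (Perm.partition_eq_of_isConj.2 h)
  rw [Representation.char_conj]

theorem character_inv_perm (ρ : Representation ℂ (Perm X) V) (σ : Perm X) :
    ρ.character σ⁻¹ = ρ.character σ :=
  character_eq_of_partition_eq ρ (Perm.partition_eq_of_isConj.1
    (Perm.isConj_iff_cycleType_eq.2 (Perm.cycleType_inv σ)))

theorem exists_partition_eq (lam : (Fintype.card X).Partition) :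
    ∃ σ : Perm X, σ.partition = lam := by
  have h := card_partition_eq_mul_zPart lam
  obtain ⟨σ, hσ⟩ := Finset.card_pos.1 (Nat.pos_of_ne_zero (left_ne_zero_of_mul
    (h ▸ (Fintype.card X).factorial_ne_zero)))
  exact ⟨σ, (Finset.mem_filter.1 hσ).2⟩

theorem exists_classFunction (ρ : Representation ℂ (Perm X) V) :
    ∃ χ : (Fintype.card X).Partition → ℂ, ∀ σ : Perm X, χ σ.partition = ρ.character σ := by
  choose f hf using exists_partition_eq (X := X)
  exact ⟨fun lam => ρ.character (f lam), fun σ => character_eq_of_partition_eq ρ (hf _)⟩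

/-- The norm is 1 by orthonormality of irreducible characters and because each permutation is
conjugate to its inverse. The pairings with permutation characters are dimensions of spaces of
intertwining maps, hence natural numbers. -/
theorem frobeniusChar_of_isIrreducible [FiniteDimensional ℂ V] (ρ : Representation ℂ (Perm X) V)
    [ρ.IsIrreducible] : ∃ μ : YoungDiagram, frobeniusChar ρ = schur μ := by
  obtain ⟨χ, hχ⟩ := exists_classFunction ρ
  have hcard : Nat.card (Perm X) = (Fintype.card X).factorial := by
    rw [Nat.card_eq_fintype_card, Fintype.card_perm]
  let : Invertible (Nat.card (Perm X) : ℂ) :=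
    invertibleOfNonzero (Nat.cast_ne_zero.2 (by rw [hcard]; exact Nat.factorial_ne_zero _))
  obtain ⟨μ, hμ⟩ := exists_sum_eq_schur χ (fun ν => Module.finrank ℂ (Representation.IntertwiningMap
      (Representation.ofMulAction ℂ (Perm X) (ContentColoring X ν.1.weight)) ρ))
    (fun ν => by
      rw [← Representation.card_inv_mul_sum_char_mul_char_eq_finrank, hcard]
      simp only [← smul_eq_mul ((zPart _ : ℂ)⁻¹)]
      rw [← sum_perm_eq_sum_partition fun lam => coeff ν.1.weight (powerSumPart lam) * χ lam, smul_eq_mul]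
      congr 1
      refine Finset.sum_congr rfl fun σ _ => ?_
      rw [coeff_powerSumPart, hχ, character_ofMulAction, card_fixed_contentColoring, mul_comm])
    (by
      have h := Representation.char_orthonormal ρ ρ
      rw [if_pos ⟨Representation.Equiv.refl ρ⟩, hcard] at h
      have h2 := sum_perm_eq_sum_partition (X := X) fun lam => χ lam * χ lam
      simp only [smul_eq_mul] at h2
      rw [← h2, ← h]
      congr 1
      refine Finset.sum_congr rfl fun σ _ => ?_
      rw [hχ, character_inv_perm])
  refine ⟨μ, ?_⟩
  rw [← hμ, ← sum_perm_eq_sum_partition fun lam => χ lam • powerSumPart lam, frobeniusChar]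
  simp only [hχ]

/-! ### Schur-positivity and complete reducibility -/

theorem schurPositive_zero : SchurPositive 0 := ⟨0, by simp⟩

theorem schurPositive_schur (μ : YoungDiagram) : SchurPositive (schur μ) := by
  classical
  refine ⟨Finsupp.single μ 1, ?_⟩
  rw [Finsupp.support_single _ one_ne_zero, Finset.sum_singleton,
    Finsupp.single_eq_same, Nat.cast_one, one_smul]

theorem SchurPositive.add {f g : SymPS} (hf : SchurPositive f) (hg : SchurPositive g) :
    SchurPositive (f + g) := by
  obtain ⟨c, rfl⟩ := hf
  obtain ⟨d, rfl⟩ := hg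
  refine ⟨c + d, ?_⟩
  have key : ∀ e : YoungDiagram →₀ ℕ, ∑ μ ∈ e.support, (e μ : ℂ) • schur μ =
      e.sum fun μ k => (k : ℂ) • schur μ := fun e => rfl
  rw [key, key, key, Finsupp.sum_add_index']
  · intro μ
    rw [Nat.cast_zero, zero_smul]
  · intro μ a b
    rw [Nat.cast_add, add_smul]

theorem schurPositive_sum {ι : Type*} (s : Finset ι) (f : ι → SymPS)
    (h : ∀ i ∈ s, SchurPositive (f i)) : SchurPositive (∑ i ∈ s, f i) :=
  Finset.sum_induction f SchurPositive (fun _ _ => SchurPositive.add) schurPositive_zero h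

theorem trace_eq_add_of_isCompl {W : Type*} [AddCommGroup W] [Module ℂ W] [FiniteDimensional ℂ W]
    {p q : Submodule ℂ W} (h : IsCompl p q) (f : W →ₗ[ℂ] W) (hp : ∀ x ∈ p, f x ∈ p)
    (hq : ∀ x ∈ q, f x ∈ q) :
    LinearMap.trace ℂ W f =
      LinearMap.trace ℂ p (f.restrict hp) + LinearMap.trace ℂ q (f.restrict hq) := by
  rw [← LinearMap.trace_prodMap', ← LinearMap.trace_conj' _ (Submodule.prodEquivOfIsCompl p q h)]
  congr 1
  ext x
  obtain ⟨⟨a, b⟩, rfl⟩ := (Submodule.prodEquivOfIsCompl p q h).surjective x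
  rw [LinearEquiv.conj_apply_apply, LinearEquiv.symm_apply_apply]
  simp

theorem frobeniusChar_eq_add_of_isCompl [FiniteDimensional ℂ V]
    (ρ : Representation ℂ (Perm X) V) {p q : Subrepresentation ρ} (h : IsCompl p q) :
    frobeniusChar ρ = frobeniusChar p.toRepresentation + frobeniusChar q.toRepresentation := by
  have h' : IsCompl p.toSubmodule q.toSubmodule := by
    rw [isCompl_iff, disjoint_iff, codisjoint_iff] at h ⊢
    exact ⟨congrArg Subrepresentation.toSubmodule h.1, congrArg Subrepresentation.toSubmodule h.2⟩
  rw [frobeniusChar, frobeniusChar, frobeniusChar, ← smul_add, ← Finset.sum_add_distrib]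
  congr 1
  refine Finset.sum_congr rfl fun σ _ => ?_
  rw [← add_smul]
  congr 1
  exact trace_eq_add_of_isCompl h' (ρ σ) (p.apply_mem_toSubmodule σ) (q.apply_mem_toSubmodule σ)

end

/-- Strong induction on the dimension: by Maschke a proper nonzero subrepresentation has a
complement, and the characteristic is additive over the two smaller summands. -/
theorem schurPositive_frobeniusChar {X : Type} [Fintype X] [DecidableEq X] (d : ℕ) :
    ∀ {V : Type} [AddCommGroup V] [Module ℂ V] [FiniteDimensional ℂ V]
      (ρ : Representation ℂ (Perm X) V), Module.finrank ℂ V = d →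
      SchurPositive (frobeniusChar ρ) := by
  induction d using Nat.strong_induction_on with
  | _ d ih =>
    intro V _ _ _ ρ hd
    by_cases hirr : ρ.IsIrreducible
    · obtain ⟨μ, hμ⟩ := frobeniusChar_of_isIrreducible ρ
      exact hμ ▸ schurPositive_schur μ
    by_cases hsub : Subsingleton V
    · have : frobeniusChar ρ = 0 := by
        rw [frobeniusChar, Finset.sum_eq_zero, smul_zero]
        intro σ _
        have : ρ σ = 0 := Subsingleton.elim _ _
        rw [Representation.character, this, map_zero, zero_smul]
      exact this ▸ schurPositive_zero
    have hnt : Nontrivial (Subrepresentation ρ) := by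
      refine ⟨⊥, ⊤, fun h => hsub ?_⟩
      have h2 : (⊥ : Submodule ℂ V) = ⊤ := congrArg Subrepresentation.toSubmodule h
      exact (Submodule.subsingleton_iff ℂ).1 (subsingleton_of_bot_eq_top h2)
    obtain ⟨p, hp⟩ : ∃ p : Subrepresentation ρ, ¬ (p = ⊥ ∨ p = ⊤) := by
      by_contra! h
      exact hirr ⟨h⟩
    push Not at hp
    have : NeZero (Nat.card (Perm X) : ℂ) := ⟨Nat.cast_ne_zero.2 Nat.card_pos.ne'⟩
    obtain ⟨q, hpq⟩ := exists_isCompl p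
    have hlt : ∀ r : Subrepresentation ρ, r ≠ ⊤ → Module.finrank ℂ r.toSubmodule < d := by
      intro r hr
      rw [← hd]
      refine Submodule.finrank_lt fun h => hr ?_
      exact Subrepresentation.toSubmodule_injective h
    have hq : q ≠ ⊤ := by
      rintro rfl
      exact hp.1 (by simpa using hpq.inf_eq_bot)
    rw [frobeniusChar_eq_add_of_isCompl ρ hpq]
    exact (ih _ (hlt p hp.2) _ rfl).add (ih _ (hlt q hq) _ rfl)

/-! ### Frobenius characteristics of induced representations -/

/-- Averaging over G factors through the coinvariants and gives a section of the quotient map.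
Cyclicity of the trace then moves the computation to W. -/
theorem trace_coinvariants_map {G W : Type*} [Group G] [Fintype G] [AddCommGroup W] [Module ℂ W]
    [FiniteDimensional ℂ W] (τ : Representation ℂ G W) (f : Representation.IntertwiningMap τ τ) :
    LinearMap.trace ℂ _ (Representation.Coinvariants.map τ τ f) =
      (Fintype.card G : ℂ)⁻¹ * ∑ g, LinearMap.trace ℂ W (f.toLinearMap ∘ₗ τ g) := by
  have hG : (Fintype.card G : ℂ) ≠ 0 := Nat.cast_ne_zero.2 Fintype.card_ne_zero
  set avg : W →ₗ[ℂ] W := (Fintype.card G : ℂ)⁻¹ • ∑ g, τ g with havg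
  have havg_comp : ∀ x, avg ∘ₗ τ x = avg := by
    intro x
    have h : (∑ g, τ g) ∘ₗ τ x = ∑ g, τ g ∘ₗ τ x := Finset.sum_mul _ _ _
    rw [havg, LinearMap.smul_comp, h]
    congr 1
    refine Fintype.sum_equiv (Equiv.mulRight x) _ _ fun g => ?_
    rw [Equiv.coe_mulRight, map_mul]
    rfl
  set s := Representation.Coinvariants.lift τ avg havg_comp with hs
  have hsec : Representation.Coinvariants.mk τ ∘ₗ s = LinearMap.id := by
    ext v
    simp only [LinearMap.comp_apply, hs, Representation.Coinvariants.lift_mk, LinearMap.id_apply,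
      havg, LinearMap.smul_apply, LinearMap.sum_apply, map_smul, map_sum,
      Representation.Coinvariants.mk_self_apply]
    rw [Finset.sum_const, Finset.card_univ, ← Nat.cast_smul_eq_nsmul ℂ, smul_smul,
      inv_mul_cancel₀ hG, one_smul]
  have h1 : Representation.Coinvariants.map τ τ f =
      (Representation.Coinvariants.mk τ ∘ₗ f.toLinearMap) ∘ₗ s := by
    conv_lhs => rw [← LinearMap.comp_id (Representation.Coinvariants.map τ τ f), ← hsec]
    rfl
  have h2 : s ∘ₗ (Representation.Coinvariants.mk τ ∘ₗ f.toLinearMap) = avg ∘ₗ f.toLinearMap := rfl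
  rw [h1, LinearMap.trace_comp_comm', h2, LinearMap.trace_comp_comm', havg, LinearMap.comp_smul,
    map_smul, smul_eq_mul]
  congr 1
  have h3 : f.toLinearMap ∘ₗ ∑ g, τ g = ∑ g, f.toLinearMap ∘ₗ τ g := Finset.mul_sum _ _ _
  rw [h3, map_sum]

section

variable {G X : Type} [Group G] [Fintype G] [Fintype X] [DecidableEq X] {A : Type}
  [AddCommGroup A] [Module ℂ A] [FiniteDimensional ℂ A]

/-- The induced space consists of the coinvariants of G on ℂ[S_X] ⊗ A. The trace of each averaged
operator is a fixed point count for π ↦ φ(g) π σ⁻¹ times a value of the character of ρ. -/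
theorem character_ind (φ : G →* Perm X) (ρ : Representation ℂ G A) (σ : Perm X) :
    (Representation.ind φ ρ).character σ =
      (Fintype.card G : ℂ)⁻¹ *
        ∑ g, (Nat.card {π : Perm X // π⁻¹ * φ g * π = σ} : ℂ) * ρ.character g := by
  rw [Representation.character, Representation.ind_apply, trace_coinvariants_map]
  congr 1
  refine Finset.sum_congr rfl fun g _ => ?_
  have h : (LinearMap.rTensor A (MonoidAlgebra.mapDomainLinearMap ℂ ℂ fun x : Perm X => x * σ⁻¹))
      ∘ₗ (Representation.tprod ((Representation.leftRegular ℂ (Perm X)).comp φ) ρ) g =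
      TensorProduct.map (MonoidAlgebra.mapDomainLinearMap ℂ ℂ fun x : Perm X => φ g * x * σ⁻¹)
        (ρ g) := by
    ext π a
    simp
  refine (congrArg (LinearMap.trace ℂ _) h).trans ?_
  rw [LinearMap.trace_tensorProduct', trace_mapDomainLinearMap]
  congr 2
  refine Nat.card_congr (Equiv.subtypeEquivRight fun π => ?_)
  rw [mul_inv_eq_iff_eq_mul, mul_assoc, inv_mul_eq_iff_eq_mul]

theorem frobeniusChar_ind (φ : G →* Perm X) (ρ : Representation ℂ G A) :
    frobeniusChar (Representation.ind φ ρ) =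
      (Fintype.card G : ℂ)⁻¹ • ∑ g, ρ.character g • powerSumPart (φ g).partition := by
  have hX : ((Fintype.card X).factorial : ℂ) ≠ 0 := Nat.cast_ne_zero.2 (Nat.factorial_ne_zero _)
  have key : ∀ g, ∑ σ : Perm X, (Nat.card {π : Perm X // π⁻¹ * φ g * π = σ} : ℂ) •
      powerSumPart σ.partition =
      ((Fintype.card X).factorial : ℂ) • powerSumPart (φ g).partition := by
    intro g
    have h : ∀ π : Perm X, powerSumPart (π⁻¹ * φ g * π).partition =
        powerSumPart (φ g).partition := by
      intro π
      rw [(Perm.partition_eq_of_isConj (σ := π⁻¹ * φ g * π) (τ := φ g)).1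
        (isConj_iff.2 ⟨π, by group⟩)]
    have hcard : (Fintype.card X).factorial = (Finset.univ : Finset (Perm X)).card := by
      rw [Finset.card_univ, Fintype.card_perm]
    have h2 := Finset.sum_fiberwise (Finset.univ : Finset (Perm X))
      (fun π : Perm X => π⁻¹ * φ g * π) fun π => powerSumPart (π⁻¹ * φ g * π).partition
    rw [Nat.cast_smul_eq_nsmul, hcard, ← Finset.sum_const,
      ← Finset.sum_congr rfl fun π _ => h π, ← h2]
    refine Finset.sum_congr rfl fun σ _ => ?_
    symm
    rw [Finset.sum_congr rfl (g := fun _ => powerSumPart σ.partition)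
      fun π hπ => by rw [(Finset.mem_filter.1 hπ).2], Finset.sum_const, Nat.card_eq_fintype_card,
      Fintype.card_subtype, Nat.cast_smul_eq_nsmul]
  rw [frobeniusChar, inv_smul_eq_iff₀ hX]
  simp only [character_ind, mul_smul, Finset.sum_smul]
  rw [← Finset.smul_sum, Finset.sum_comm, smul_comm]
  congr 1
  rw [Finset.smul_sum]
  refine Finset.sum_congr rfl fun g _ => ?_
  rw [smul_comm, ← key, Finset.smul_sum]
  exact Finset.sum_congr rfl fun σ _ => smul_comm _ _ _

theorem schurPositive_frobeniusChar_ind (φ : G →* Perm X) (ρ : Representation ℂ G A) :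
    SchurPositive (frobeniusChar (Representation.ind φ ρ)) :=
  schurPositive_frobeniusChar _ _ rfl

end

/-! ### Weighted cycle indices -/

/-- `f` is the cycle index of a finite permutation group weighted by a linear character. -/
def IsCycleIndex (f : SymPS) : Prop :=
  ∃ (G X : Type) (_ : Group G) (_ : Fintype G) (_ : Fintype X) (_ : DecidableEq X)
    (φ : G →* Perm X) (ξ : G →* ℂ),
    f = (Fintype.card G : ℂ)⁻¹ • ∑ g, ξ g • powerSumPart (φ g).partition

/-- The one-dimensional representation given by a linear character. -/
noncomputable def linearRep {G : Type} [Group G] (ξ : G →* ℂ) : Representation ℂ G ℂ :=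
  ((algebraMap ℂ (Module.End ℂ ℂ)).toMonoidHom).comp ξ

theorem character_linearRep {G : Type} [Group G] (ξ : G →* ℂ) (g : G) :
    (linearRep ξ).character g = ξ g := by
  have h : linearRep ξ g = ξ g • LinearMap.id := rfl
  rw [Representation.character, h, map_smul, LinearMap.trace_id, Module.finrank_self, Nat.cast_one,
    smul_eq_mul, mul_one]

theorem IsCycleIndex.schurPositive {f : SymPS} (hf : IsCycleIndex f) : SchurPositive f := by
  obtain ⟨G, X, _, _, _, _, φ, ξ, rfl⟩ := hf
  have h := frobeniusChar_ind φ (linearRep ξ)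
  simp only [character_linearRep] at h
  rw [← h]
  exact schurPositive_frobeniusChar_ind _ _

theorem powerSumPart_eq_of_parts_eq {m n : ℕ} {a : m.Partition} {b : n.Partition}
    (h : a.parts = b.parts) : powerSumPart a = powerSumPart b := by
  rw [powerSumPart, powerSumPart, h]

theorem isCycleIndex_one : IsCycleIndex 1 := by
  refine ⟨Unit, Fin 0, inferInstance, inferInstance, inferInstance, inferInstance, 1, 1, ?_⟩
  have h : (1 : Perm (Fin 0)).partition.parts = 0 := by
    rw [parts_partition_eq]
    simp
  simp [powerSumPart, h]

theorem powerSumPart_sumCongr {X Y : Type*} [Fintype X] [DecidableEq X] [Fintype Y]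
    [DecidableEq Y] (σ : Perm X) (τ : Perm Y) :
    powerSumPart (Perm.sumCongr σ τ).partition =
      powerSumPart σ.partition * powerSumPart τ.partition := by
  rw [powerSumPart, parts_partition_sumCongr, Multiset.map_add, Multiset.prod_add]
  rfl

/-- The direct product acts on the disjoint union, weighted by the product of the two characters. -/
theorem IsCycleIndex.mul {f g : SymPS} (hf : IsCycleIndex f) (hg : IsCycleIndex g) :
    IsCycleIndex (f * g) := by
  obtain ⟨G, X, _, _, _, _, φ, ξ, rfl⟩ := hf
  obtain ⟨H, Y, _, _, _, _, ψ, η, rfl⟩ := hg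
  refine ⟨G × H, X ⊕ Y, inferInstance, inferInstance, inferInstance, inferInstance,
    (Perm.sumCongrHom X Y).comp (φ.prodMap ψ), (ξ.comp (MonoidHom.fst G H)) *
      (η.comp (MonoidHom.snd G H)), ?_⟩
  rw [smul_mul_smul_comm, Fintype.card_prod, Nat.cast_mul, mul_inv, Finset.sum_mul_sum,
    Fintype.sum_prod_type]
  congr 1
  refine Finset.sum_congr rfl fun a _ => Finset.sum_congr rfl fun b _ => ?_
  rw [smul_mul_smul_comm]
  congr 1
  exact (powerSumPart_sumCongr _ _).symm

theorem isCycleIndex_prod {ι : Type*} (s : Finset ι) (f : ι → SymPS)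
    (h : ∀ i ∈ s, IsCycleIndex (f i)) : IsCycleIndex (∏ i ∈ s, f i) :=
  Finset.prod_induction f IsCycleIndex (fun _ _ => IsCycleIndex.mul) isCycleIndex_one h

/-! ### Wreath products and plethysm -/

theorem powerPlethysm_eq (k : ℕ) (hk : k ≠ 0) (f : SymPS) :
    powerPlethysm k f = MvPowerSeries.expand k hk f := dif_pos hk

theorem powerSumPart_permCongr {X Y : Type*} [Fintype X] [DecidableEq X] [Fintype Y]
    [DecidableEq Y] (e : X ≃ Y) (σ : Perm X) :
    powerSumPart (e.permCongr σ).partition = powerSumPart σ.partition :=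
  powerSumPart_eq_of_parts_eq (parts_partition_permCongr e σ)

/-- The permutation `(i, x) ↦ (τ i, g (τ i) x)`. -/
def wreathPerm {ι X : Type*} (τ : Perm ι) (g : ι → Perm X) : Perm (ι × X) :=
  Equiv.prodShear τ fun i => g (τ i)

theorem wreathPerm_apply {ι X : Type*} (τ : Perm ι) (g : ι → Perm X) (i : ι) (x : X) :
    wreathPerm τ g (i, x) = (τ i, g (τ i) x) := rfl

section

variable {G : Type*} [Group G]

/-- The sequence of group elements with given partial products. -/
def partialQuotients {k : ℕ} (u : Fin (k + 1) → G) : Fin (k + 1) → G :=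
  Fin.cases (u 0) fun i => u i.succ * (u i.castSucc)⁻¹

theorem partialQuotients_zero {k : ℕ} (u : Fin (k + 1) → G) : partialQuotients u 0 = u 0 := rfl

theorem partialQuotients_succ {k : ℕ} (u : Fin (k + 1) → G) (i : Fin k) :
    partialQuotients u i.succ = u i.succ * (u i.castSucc)⁻¹ := rfl

theorem partialQuotients_bijective (k : ℕ) :
    Function.Bijective (partialQuotients : (Fin (k + 1) → G) → Fin (k + 1) → G) := by
  constructor
  · intro u v h
    funext i
    induction i using Fin.induction with
    | zero => exact congrFun h 0
    | succ i ih =>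
      have h2 := congrFun h i.succ
      rw [partialQuotients_succ, partialQuotients_succ, ih] at h2
      exact mul_right_cancel h2
  · intro g
    refine ⟨fun i => Fin.induction (motive := fun _ => G) (g 0) (fun i p => g i.succ * p) i,
      funext fun i => ?_⟩
    refine Fin.cases rfl (fun i => ?_) i
    rw [partialQuotients_succ, Fin.induction_succ, mul_inv_cancel_right]

theorem prod_partialQuotients (ξ : G →* ℂ) (k : ℕ) (u : Fin (k + 1) → G) :
    ∏ i, ξ (partialQuotients u i) = ξ (u (Fin.last k)) := by
  have key : ∀ j : Fin (k + 1), ∏ i ∈ Finset.Iic j, ξ (partialQuotients u i) = ξ (u j) := by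
    intro j
    induction j using Fin.induction with
    | zero =>
      have : Finset.Iic (0 : Fin (k + 1)) = {0} := by
        ext i
        simp
      rw [this, Finset.prod_singleton, partialQuotients_zero]
    | succ j ih =>
      have : Finset.Iic j.succ = insert j.succ (Finset.Iic j.castSucc) := by
        ext i
        simp only [Finset.mem_Iic, Finset.mem_insert, Fin.le_def, Fin.ext_iff, Fin.val_succ,
          Fin.val_castSucc]
        omega
      rw [this, Finset.prod_insert (by simp [Fin.le_def]), ih, partialQuotients_succ, ← map_mul,
        inv_mul_cancel_right]
  have h := key (Fin.last k)
  rwa [show Finset.Iic (Fin.last k) = Finset.univ by ext i; simp [Fin.le_last]] at h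

end

/-- Colorings fixed by a cyclic wreath permutation correspond to colorings fixed by the total
product. -/
def fixedColoringRotate {X : Type*} {k : ℕ} (u : Fin (k + 1) → Perm X) :
    FixedColoring (u (Fin.last k)) ≃
      FixedColoring (wreathPerm (finRotate (k + 1)) (partialQuotients u)) where
  toFun d := ⟨fun p => d.1 ((u p.1)⁻¹ p.2), by
    rintro ⟨i, x⟩
    rw [wreathPerm_apply]
    refine Fin.lastCases ?_ (fun i => ?_) i
    · rw [finRotate_last]
      change d.1 ((u 0)⁻¹ (u 0 x)) = d.1 ((u (Fin.last k))⁻¹ x)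
      rw [← d.2 ((u (Fin.last k))⁻¹ x), ← Perm.mul_apply, ← Perm.mul_apply, inv_mul_cancel,
        mul_inv_cancel]
    · rw [finRotate_apply, Fin.coeSucc_eq_succ, partialQuotients_succ]
      change d.1 (((u i.succ)⁻¹ * (u i.succ * (u i.castSucc)⁻¹)) x) = _
      rw [inv_mul_cancel_left]⟩
  invFun c := ⟨fun x => c.1 (Fin.last k, u (Fin.last k) x), by
    intro x
    -- The wreath permutation carries (i, u_i y) to (i + 1, u_{i+1} y), so the color is constant
    -- along this path.
    have key : ∀ (i : Fin (k + 1)) (y : X), c.1 (i, u i y) = c.1 (0, u 0 y) := by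
      intro i y
      induction i using Fin.induction with
      | zero => rfl
      | succ i ih =>
        rw [← ih, ← c.2 (i.castSucc, _), wreathPerm_apply, finRotate_apply,
          Fin.coeSucc_eq_succ, partialQuotients_succ, Perm.mul_apply, ← Perm.mul_apply _ (u _),
          inv_mul_cancel, Perm.one_apply]
    change c.1 (Fin.last k, u (Fin.last k) (u (Fin.last k) x)) = c.1 (Fin.last k, u (Fin.last k) x)
    rw [key, ← c.2 (Fin.last k, u (Fin.last k) x), wreathPerm_apply, finRotate_last]
    rfl⟩
  left_inv d := Subtype.ext (funext fun x => by
    change d.1 ((u (Fin.last k))⁻¹ (u (Fin.last k) x)) = d.1 x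
    rw [← Perm.mul_apply, inv_mul_cancel, Perm.one_apply])
  right_inv c := Subtype.ext (funext fun p => by
    obtain ⟨i, x⟩ := p
    have key : ∀ (i : Fin (k + 1)) (y : X), c.1 (i, u i y) = c.1 (0, u 0 y) := by
      intro i y
      induction i using Fin.induction with
      | zero => rfl
      | succ i ih =>
        rw [← ih, ← c.2 (i.castSucc, _), wreathPerm_apply, finRotate_apply,
          Fin.coeSucc_eq_succ, partialQuotients_succ, Perm.mul_apply, ← Perm.mul_apply _ (u _),
          inv_mul_cancel, Perm.one_apply]
    change c.1 (Fin.last k, u (Fin.last k) ((u i)⁻¹ x)) = c.1 (i, x)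
    rw [key, ← key i, ← Perm.mul_apply, mul_inv_cancel, Perm.one_apply])

theorem powerSumPart_wreathPerm_finRotate {X : Type} [Fintype X] [DecidableEq X] {k : ℕ}
    (u : Fin (k + 1) → Perm X) :
    powerSumPart (wreathPerm (finRotate (k + 1)) (partialQuotients u)).partition =
      powerPlethysm (k + 1) (powerSumPart (u (Fin.last k)).partition) := by
  rw [powerPlethysm_eq _ k.succ_ne_zero, powerSumPart_eq_genSeries, powerSumPart_eq_genSeries,
    expand_genSeries]
  refine (genSeries_congr (fixedColoringRotate u) _ _ fun d => ?_).symm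
  change ∑ p : Fin (k + 1) × X, Finsupp.single (d.1 ((u p.1)⁻¹ p.2)) 1 = (k + 1) • content d.1
  rw [Fintype.sum_prod_type, Finset.sum_congr rfl (g := fun _ => content d.1)
    fun i _ => Equiv.sum_comp (u i)⁻¹ fun x => Finsupp.single (d.1 x) 1, Finset.sum_const,
    Finset.card_univ, Fintype.card_fin]

theorem powerPlethysm_smul (k : ℕ) (c : ℂ) (f : SymPS) :
    powerPlethysm k (c • f) = c • powerPlethysm k f := by
  rw [powerPlethysm, powerPlethysm]
  split
  · exact map_smul _ c f
  · rw [smul_zero]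

theorem powerPlethysm_sum (k : ℕ) {ι : Type*} (s : Finset ι) (f : ι → SymPS) :
    powerPlethysm k (∑ i ∈ s, f i) = ∑ i ∈ s, powerPlethysm k (f i) := by
  simp only [powerPlethysm]
  split
  · exact map_sum _ f s
  · rw [Finset.sum_const_zero]

/-- For fixed τ the sum factors over the cycles of τ. On a cycle of length k only the product of the
group elements around the cycle matters; its cycles in X become k times as long, which is plethysm
by p_k. -/
theorem sum_wreathPerm {G X : Type} [Group G] [Fintype G] [Fintype X] [DecidableEq X]
    (φ : G →* Perm X) (ξ : G →* ℂ) {ι : Type} [Fintype ι] [DecidableEq ι] (τ : Perm ι) :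
    ∑ g : ι → G, (∏ i, ξ (g i)) • powerSumPart (wreathPerm τ fun i => φ (g i)).partition =
      (Fintype.card G : ℂ) ^ Fintype.card ι • (τ.partition.parts.map fun k =>
        powerPlethysm k ((Fintype.card G : ℂ)⁻¹ • ∑ g, ξ g • powerSumPart (φ g).partition)).prod := by
  classical
  have hG : (Fintype.card G : ℂ) ≠ 0 := Nat.cast_ne_zero.2 Fintype.card_ne_zero
  refine perm_induction (C := fun ι _ _ τ => ∑ g : ι → G, (∏ i, ξ (g i)) •
      powerSumPart (wreathPerm τ fun i => φ (g i)).partition =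
    (Fintype.card G : ℂ) ^ Fintype.card ι • (τ.partition.parts.map fun k =>
      powerPlethysm k ((Fintype.card G : ℂ)⁻¹ • ∑ g, ξ g • powerSumPart (φ g).partition)).prod)
    ?_ ?_ ?_ ?_ τ
  · intro ι κ _ _ _ _ e σ h
    rw [parts_partition_permCongr, ← Fintype.card_congr e, ← h]
    refine (Fintype.sum_equiv (e.arrowCongr (Equiv.refl G)) _ _ fun g => ?_).symm
    congr 1
    · refine Fintype.prod_equiv e _ _ fun i => ?_
      simp
    · rw [← powerSumPart_permCongr (e.prodCongr (Equiv.refl X))]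
      congr 2
      ext1 ⟨i, x⟩
      simp [wreathPerm_apply, Equiv.permCongr_apply]
  · have h : (1 : Perm (Fin 0)).partition.parts = 0 := by
      rw [parts_partition_eq]
      simp
    have h2 : ∀ σ : Perm (Fin 0 × X), σ.partition.parts = 0 := by
      intro σ
      rw [parts_partition_eq, Subsingleton.elim σ 1]
      simp
    simp [powerSumPart, h, h2]
  · intro k
    -- Parametrize by partial products: the summand depends only on the last one, and the other k
    -- are free, giving the factor |G|^k.
    rw [parts_partition_finRotate, Multiset.map_singleton, Multiset.prod_singleton,
      powerPlethysm_smul, powerPlethysm_sum, smul_smul, Fintype.card_fin, pow_succ, mul_assoc,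
      mul_inv_cancel₀ hG, mul_one,
      ← Fintype.sum_equiv (Equiv.ofBijective _ (partialQuotients_bijective (G := G) k))
        (fun u => ξ (u (Fin.last k)) • powerPlethysm (k + 1)
          (powerSumPart (φ (u (Fin.last k))).partition)) _ fun u => ?_]
    · rw [← Fintype.sum_equiv (Fin.snocEquiv fun _ => G) (fun p : G × (Fin k → G) =>
        ξ p.1 • powerPlethysm (k + 1) (powerSumPart (φ p.1).partition)) _ fun p => ?_]
      · rw [Fintype.sum_prod_type, Finset.smul_sum]
        refine Finset.sum_congr rfl fun g _ => ?_
        rw [powerPlethysm_smul]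
        change ∑ _f : Fin k → G, ξ g • powerPlethysm (k + 1) (powerSumPart (φ g).partition) = _
        rw [Finset.sum_const, Finset.card_univ, Fintype.card_pi, Finset.prod_const,
          Finset.card_univ, Fintype.card_fin, ← Nat.cast_smul_eq_nsmul ℂ, Nat.cast_pow]
      · simp
    · rw [Equiv.ofBijective_apply, prod_partialQuotients]
      congr 1
      rw [← powerSumPart_wreathPerm_finRotate fun i => φ (u i)]
      congr 3
      funext i
      refine Fin.cases rfl (fun i => ?_) i
      rw [partialQuotients_succ, partialQuotients_succ, map_mul, map_inv]
  · intro ι κ _ _ _ _ σ τ hσ hτ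
    rw [parts_partition_sumCongr, Multiset.map_add, Multiset.prod_add, Fintype.card_sum, pow_add,
      ← smul_mul_smul_comm, ← hσ, ← hτ, Finset.sum_mul_sum, ← Fintype.sum_prod_type']
    refine Fintype.sum_equiv (Equiv.sumArrowEquivProdArrow ι κ G) _ _ fun g => ?_
    rw [smul_mul_smul_comm, Fintype.prod_sum_type, ← powerSumPart_sumCongr]
    congr 1
    rw [← powerSumPart_permCongr (Equiv.sumProdDistrib ι κ X)]
    congr 2
    ext1 (⟨i, x⟩ | ⟨i, x⟩) <;> rfl

theorem hPlethysm_eq_sum_perm (m : ℕ) (f : SymPS) :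
    hPlethysm m f = (m.factorial : ℂ)⁻¹ • ∑ τ : Perm (Fin m),
      (τ.partition.parts.map fun k => powerPlethysm k f).prod := by
  have h : _ = hPlethysm (Fintype.card (Fin m)) f := sum_perm_eq_sum_partition (X := Fin m)
    fun lam => (lam.parts.map fun k => powerPlethysm k f).prod
  have h2 : hPlethysm (Fintype.card (Fin m)) f = hPlethysm m f := by rw [Fintype.card_fin]
  rw [← h2, ← h]
  congr 4
  exact Fintype.card_fin m

/-- The action of the wreath product of `G` with the permutations of `ι`. -/
def wreathHom {G X ι : Type*} [Group G] (φ : G →* Perm X) :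
    (ι → G) ⋊[mulAutArrow] Perm ι →* Perm (ι × X) where
  toFun w := wreathPerm w.right fun i => φ (w.left i)
  map_one' := by
    ext1 ⟨i, x⟩
    simp [wreathPerm_apply]
  map_mul' a b := by
    ext1 ⟨i, x⟩
    rw [Perm.mul_apply, wreathPerm_apply, wreathPerm_apply, wreathPerm_apply,
      SemidirectProduct.mul_left, SemidirectProduct.mul_right, Pi.mul_apply, map_mul,
      Perm.mul_apply, Perm.mul_apply]
    have h : (mulAutArrow a.right b.left) (a.right (b.right i)) = b.left (b.right i) := by
      change b.left (a.right⁻¹ (a.right (b.right i))) = _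
      rw [← Perm.mul_apply, inv_mul_cancel, Perm.one_apply]
    rw [h]

/-- The linear character of the wreath product obtained from a linear character. -/
def wreathChar {G ι : Type*} [Group G] [Fintype ι] (ξ : G →* ℂ) :
    (ι → G) ⋊[mulAutArrow] Perm ι →* ℂ where
  toFun w := ∏ i, ξ (w.left i)
  map_one' := by simp
  map_mul' a b := by
    simp only [SemidirectProduct.mul_left, Pi.mul_apply, map_mul, Finset.prod_mul_distrib]
    congr 1
    exact Equiv.prod_comp a.right⁻¹ fun i => ξ (b.left i)

/-- The wreath product with S_m acts on m copies of X; averaging `sum_wreathPerm` over S_m gives the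
plethysm. -/
theorem IsCycleIndex.hPlethysm {f : SymPS} (hf : IsCycleIndex f) (m : ℕ) :
    IsCycleIndex (hPlethysm m f) := by
  classical
  obtain ⟨G, X, _, _, _, _, φ, ξ, rfl⟩ := hf
  have hG : (Fintype.card G : ℂ) ≠ 0 := Nat.cast_ne_zero.2 Fintype.card_ne_zero
  let : Fintype ((Fin m → G) ⋊[mulAutArrow] Perm (Fin m)) :=
    Fintype.ofEquiv _ SemidirectProduct.equivProd.symm
  refine ⟨(Fin m → G) ⋊[mulAutArrow] Perm (Fin m), Fin m × X, inferInstance, inferInstance,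
    inferInstance, inferInstance, wreathHom φ, wreathChar ξ, ?_⟩
  have h := Fintype.sum_equiv SemidirectProduct.equivProd
    (fun w : (Fin m → G) ⋊[mulAutArrow] Perm (Fin m) =>
      wreathChar ξ w • powerSumPart (wreathHom φ w).partition)
    (fun p : (Fin m → G) × Perm (Fin m) =>
      (∏ i, ξ (p.1 i)) • powerSumPart (wreathPerm p.2 fun i => φ (p.1 i)).partition) fun w => rfl
  rw [hPlethysm_eq_sum_perm, h, Fintype.sum_prod_type_right]
  simp only [sum_wreathPerm]
  rw [← Finset.smul_sum, smul_smul, Fintype.card_congr SemidirectProduct.equivProd,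
    Fintype.card_prod, Fintype.card_perm, Fintype.card_pi, Finset.prod_const, Finset.card_univ]
  congr 1
  rw [Fintype.card_fin]
  push_cast
  field_simp

/-! ### Newton's recursion for sums over partitions -/

section

variable {R : Type*} [CommRing R]

/-- The product over the parts of `s` of weights depending on part and multiplicity. -/
def multiplicityWeight (f : ℕ → ℕ → R) (s : Multiset ℕ) : R :=
  ∏ i ∈ s.toFinset, f i (s.count i)

/-- The multisets of parts of the partitions of `n`. -/
def partitionParts (n : ℕ) : Finset (Multiset ℕ) :=
  (Finset.univ : Finset n.Partition).map ⟨Nat.Partition.parts, fun _ _ => Nat.Partition.ext⟩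

theorem mem_partitionParts {n : ℕ} {s : Multiset ℕ} :
    s ∈ partitionParts n ↔ (∀ i ∈ s, 0 < i) ∧ s.sum = n := by
  rw [partitionParts, Finset.mem_map]
  constructor
  · rintro ⟨lam, -, rfl⟩
    exact ⟨fun i hi => lam.parts_pos hi, lam.parts_sum⟩
  · rintro ⟨h1, h2⟩
    exact ⟨⟨s, fun {i} hi => h1 i hi, h2⟩, Finset.mem_univ _, rfl⟩

theorem sum_partition_eq (n : ℕ) (F : Multiset ℕ → R) :
    ∑ lam : n.Partition, F lam.parts = ∑ s ∈ partitionParts n, F s := by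
  rw [partitionParts, Finset.sum_map]
  rfl

theorem multiplicityWeight_eq_prod {f : ℕ → ℕ → R} (hf : ∀ i, f i 0 = 1) {s : Multiset ℕ}
    {t : Finset ℕ} (h : s.toFinset ⊆ t) : multiplicityWeight f s = ∏ i ∈ t, f i (s.count i) := by
  refine Finset.prod_subset h fun i _ hi => ?_
  rw [Multiset.mem_toFinset] at hi
  rw [Multiset.count_eq_zero_of_notMem hi, hf]

theorem sum_mul_multiplicityWeight {f c : ℕ → ℕ → R} (hf : ∀ i, f i 0 = 1)
    (hc : ∀ i m : ℕ, (m : R) * f i m = ∑ k ∈ Finset.Icc 1 m, c i k * f i (m - k)) (s : Multiset ℕ) :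
    (s.sum : R) * multiplicityWeight f s = ∑ i ∈ s.toFinset, ∑ k ∈ Finset.Icc 1 (s.count i),
      i * c i k * multiplicityWeight f (s - Multiset.replicate k i) := by
  rw [Finset.sum_multiset_count, Nat.cast_sum, Finset.sum_mul]
  refine Finset.sum_congr rfl fun i hi => ?_
  have h1 : multiplicityWeight f s =
      f i (s.count i) * ∏ a ∈ s.toFinset.erase i, f a (s.count a) :=
    (Finset.mul_prod_erase _ _ hi).symm
  have h2 : ∀ k, multiplicityWeight f (s - Multiset.replicate k i) =
      f i (s.count i - k) * ∏ a ∈ s.toFinset.erase i, f a (s.count a) := by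
    intro k
    rw [multiplicityWeight_eq_prod hf (t := s.toFinset), ← Finset.mul_prod_erase _ _ hi]
    · rw [Multiset.count_sub, Multiset.count_replicate_self]
      congr 1
      refine Finset.prod_congr rfl fun a ha => ?_
      rw [Multiset.count_sub, Multiset.count_replicate, if_neg (Finset.ne_of_mem_erase ha).symm,
        Nat.sub_zero]
    · intro a ha
      rw [Multiset.mem_toFinset] at ha ⊢
      exact Multiset.mem_of_le (Multiset.sub_le_self _ _) ha
  rw [h1, smul_eq_mul, Nat.cast_mul]
  simp only [h2]
  calc _ = (i : R) * ((s.count i : R) * f i (s.count i)) *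
        ∏ a ∈ s.toFinset.erase i, f a (s.count a) := by ring
    _ = _ := by
      rw [hc, Finset.mul_sum, Finset.sum_mul]
      exact Finset.sum_congr rfl fun k _ => by ring

/-- With F_i(t) = ∑ f_{i,m} t^m, the sums over partitions are the coefficients of ∏ F_i(t^i), and
`hc` says that t F_i' / F_i = ∑ c_{i,k} t^k. The claim is the logarithmic derivative of the product;
combinatorially, k copies of the part i are removed, with j = ik. -/
theorem newton_recursion {f c : ℕ → ℕ → R} (hf : ∀ i, f i 0 = 1)
    (hc : ∀ i m : ℕ, (m : R) * f i m = ∑ k ∈ Finset.Icc 1 m, c i k * f i (m - k)) (n : ℕ) :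
    (n : R) * ∑ lam : n.Partition, multiplicityWeight f lam.parts =
      ∑ j ∈ Finset.Icc 1 n, (∑ i ∈ j.divisors, i * c i (j / i)) *
        ∑ lam : (n - j).Partition, multiplicityWeight f lam.parts := by
  simp only [sum_partition_eq _ (multiplicityWeight f)]
  rw [Finset.mul_sum, Finset.sum_congr rfl fun s hs => by
    rw [← (mem_partitionParts.1 hs).2, sum_mul_multiplicityWeight hf hc]]
  simp only [Finset.sum_mul_sum]
  simp only [Finset.sum_sigma']
  have hle : ∀ {s : Multiset ℕ} {i k : ℕ}, k ≤ s.count i →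
      s - Multiset.replicate k i + Multiset.replicate k i = s := fun h =>
    tsub_add_cancel_of_le (Multiset.le_count_iff_replicate_le.1 h)
  refine Finset.sum_bij'
    (fun x _ => ⟨x.2.1 * x.2.2, x.2.1, x.1 - Multiset.replicate x.2.2 x.2.1⟩)
    (fun y _ => ⟨y.2.2 + Multiset.replicate (y.1 / y.2.1) y.2.1, y.2.1, y.1 / y.2.1⟩)
    ?_ ?_ ?_ ?_ ?_
  · rintro ⟨s, i, k⟩ hx
    simp only [Finset.mem_sigma, Multiset.mem_toFinset, Finset.mem_Icc, mem_partitionParts,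
      Nat.mem_divisors] at hx ⊢
    obtain ⟨⟨hpos, hsum⟩, his, hk1, hk2⟩ := hx
    have hi := hpos i his
    have h := congrArg Multiset.sum (hle hk2)
    rw [Multiset.sum_add, Multiset.sum_replicate, smul_eq_mul, mul_comm k, hsum] at h
    have hik : 0 < i * k := Nat.mul_pos hi hk1
    exact ⟨⟨hik, by omega⟩, ⟨Dvd.intro _ rfl, hik.ne'⟩,
      fun a ha => hpos a (Multiset.mem_of_le (Multiset.sub_le_self _ _) ha), by omega⟩
  · rintro ⟨j, i, t⟩ hy
    simp only [Finset.mem_sigma, Multiset.mem_toFinset, Finset.mem_Icc, mem_partitionParts,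
      Nat.mem_divisors] at hy ⊢
    obtain ⟨⟨hj1, hj2⟩, ⟨⟨k, rfl⟩, hj0⟩, hpos, hsum⟩ := hy
    have hi : 0 < i := Nat.pos_of_ne_zero (left_ne_zero_of_mul hj0)
    have hk : 0 < k := Nat.pos_of_ne_zero (right_ne_zero_of_mul hj0)
    rw [Nat.mul_div_cancel_left k hi, Multiset.sum_add, Multiset.sum_replicate, smul_eq_mul,
      mul_comm k, Multiset.count_add, Multiset.count_replicate_self]
    refine ⟨⟨fun a ha => ?_, by omega⟩, ?_, hk, Nat.le_add_left _ _⟩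
    · rcases Multiset.mem_add.1 ha with ha | ha
      · exact hpos a ha
      · rwa [Multiset.eq_of_mem_replicate ha]
    · exact Multiset.mem_add.2 (Or.inr (Multiset.mem_replicate.2 ⟨hk.ne', rfl⟩))
  · rintro ⟨s, i, k⟩ hx
    simp only [Finset.mem_sigma, Multiset.mem_toFinset, Finset.mem_Icc, mem_partitionParts] at hx
    have hi := hx.1.1 i hx.2.1
    simp only [Nat.mul_div_cancel_left k hi, hle hx.2.2.2]
  · rintro ⟨j, i, t⟩ hy
    simp only [Finset.mem_sigma, Nat.mem_divisors] at hy
    simp only [Nat.mul_div_cancel' hy.2.1.1, add_tsub_cancel_right]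
  · rintro ⟨s, i, k⟩ hx
    simp only [Finset.mem_sigma, Multiset.mem_toFinset, mem_partitionParts] at hx
    simp only [Nat.mul_div_cancel_left k (hx.1.1 i hx.2.1)]

/-- A sequence satisfying Newton's recursion is determined by the coefficients. -/
theorem newton_unique {b a a' : ℕ → SymPS} (h0 : a 0 = a' 0)
    (h : ∀ n : ℕ, (n : SymPS) * a n = ∑ j ∈ Finset.Icc 1 n, b j * a (n - j))
    (h' : ∀ n : ℕ, (n : SymPS) * a' n = ∑ j ∈ Finset.Icc 1 n, b j * a' (n - j)) (n : ℕ) :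
    a n = a' n := by
  induction n using Nat.strong_induction_on with
  | _ n ih =>
    rcases Nat.eq_zero_or_pos n with rfl | hn
    · exact h0
    have h1 : (n : SymPS) * a n = (n : SymPS) * a' n := by
      rw [h, h']
      refine Finset.sum_congr rfl fun j hj => ?_
      rw [Finset.mem_Icc] at hj
      rw [ih (n - j) (by omega)]
    have hn' : (n : ℂ) ≠ 0 := Nat.cast_ne_zero.2 hn.ne'
    rw [← nsmul_eq_mul, ← nsmul_eq_mul, ← Nat.cast_smul_eq_nsmul ℂ, ← Nat.cast_smul_eq_nsmul ℂ] at h1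
    rw [← inv_smul_smul₀ hn' (a n), h1, inv_smul_smul₀ hn']

end

theorem hPlethysm_zero (f : SymPS) : hPlethysm 0 f = 1 := by
  simp [hPlethysm, zPart]

theorem natCast_mul_hPlethysm (m : ℕ) (f : SymPS) :
    (m : SymPS) * hPlethysm m f =
      ∑ k ∈ Finset.Icc 1 m, powerPlethysm k f * hPlethysm (m - k) f := by
  have key : ∀ n, hPlethysm n f = ∑ lam : n.Partition, multiplicityWeight
      (fun i a => ((i ^ a * a.factorial : ℕ) : ℂ)⁻¹ • powerPlethysm i f ^ a) lam.parts := by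
    intro n
    refine Finset.sum_congr rfl fun lam _ => ?_
    rw [multiplicityWeight, zPart, Finset.prod_multiset_map_count, Finset.prod_smul,
      Nat.cast_prod, Finset.prod_inv_distrib]
  simp only [key]
  -- The weights are the coefficients of exp(p_i[f] t / i), whose logarithmic derivative has only a
  -- linear term.
  rw [newton_recursion (c := fun i k => if k = 1 then (i : ℂ)⁻¹ • powerPlethysm i f else 0)]
  · refine Finset.sum_congr rfl fun j hj => ?_
    have hj0 : j ≠ 0 := by
      rw [Finset.mem_Icc] at hj
      omega
    congr 1
    rw [Finset.sum_eq_single j]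
    · rw [Nat.div_self (Nat.pos_of_ne_zero hj0), if_pos rfl, ← nsmul_eq_mul,
        ← Nat.cast_smul_eq_nsmul ℂ, smul_inv_smul₀ (Nat.cast_ne_zero.2 hj0)]
    · intro i hi hij
      rw [if_neg, mul_zero]
      intro h
      exact hij (by rw [← Nat.div_mul_cancel (Nat.mem_divisors.1 hi).1, h, one_mul])
    · intro h
      exact absurd (Nat.mem_divisors_self j hj0) h
  · intro i
    simp
  · intro i m
    rcases m with _ | m
    · simp
    rw [Finset.sum_eq_single 1]
    · rw [if_pos rfl, Nat.add_sub_cancel, smul_mul_smul_comm, ← nsmul_eq_mul,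
        ← Nat.cast_smul_eq_nsmul ℂ, smul_smul, ← pow_succ']
      congr 1
      have hm : ((m : ℂ) + 1) ≠ 0 := Nat.cast_add_one_ne_zero m
      rw [Nat.factorial_succ, pow_succ]
      push_cast
      rw [mul_inv, mul_inv, mul_inv, mul_inv]
      field_simp
    · intro k _ hk
      rw [if_neg hk, zero_mul]
    · intro h
      exact absurd (Finset.mem_Icc.2 ⟨le_rfl, Nat.le_add_left _ _⟩) h

/-! ### The modules induced from cyclic groups -/

theorem modL_eq_sum (S : Set ℕ) (n : ℕ) [NeZero n] :
    modL S n = (n : ℂ)⁻¹ • ∑ k : Multiplicative (ZMod n),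
      ((ZMod.stdAddChar (N := n)).mulShift (primesPart S n : ZMod n)).toMonoidHom k •
        powerSumPart (cyclicInclusion n k).partition := by
  rw [modL, dif_neg (NeZero.ne n)]
  have h := frobeniusChar_ind (cyclicInclusion n) (linearRep
    ((ZMod.stdAddChar (N := n)).mulShift (primesPart S n : ZMod n)).toMonoidHom)
  simp only [character_linearRep] at h
  have hc : (Fintype.card (Multiplicative (ZMod n)) : ℂ) = n := by
    rw [Fintype.card_multiplicative, ZMod.card]
  rw [hc] at h
  exact h

theorem isCycleIndex_modL (S : Set ℕ) {n : ℕ} (hn : n ≠ 0) : IsCycleIndex (modL S n) := by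
  have : NeZero n := ⟨hn⟩
  refine ⟨Multiplicative (ZMod n), ZMod n, inferInstance, inferInstance, inferInstance,
    inferInstance, cyclicInclusion n,
    ((ZMod.stdAddChar (N := n)).mulShift (primesPart S n : ZMod n)).toMonoidHom, ?_⟩
  have hc : (Fintype.card (Multiplicative (ZMod n)) : ℂ) = n := by
    rw [Fintype.card_multiplicative, ZMod.card]
  rw [modL_eq_sum, hc]

theorem schurPositive_symmetricPower_modL (S : Set ℕ) (n : ℕ) :
    SchurPositive (symmetricPower (modL S) n) := by
  refine schurPositive_sum _ _ fun lam _ => (isCycleIndex_prod _ _ fun i hi => ?_).schurPositive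
  exact (isCycleIndex_modL S (lam.parts_pos (Multiset.mem_toFinset.1 hi)).ne').hPlethysm _

theorem genSeries_content (Q : Type) [Fintype Q] :
    genSeries (fun c : Q → ℕ => content c) = powerSum 1 ^ Fintype.card Q := by
  classical
  have h1 : powerSumPart (1 : Perm Q).partition = powerSum 1 ^ Fintype.card Q := by
    rw [powerSumPart, parts_partition_eq]
    simp
  rw [← h1, powerSumPart_eq_genSeries]
  exact genSeries_congr ⟨fun c => ⟨c, fun _ => rfl⟩, fun c => c.1, fun _ => rfl, fun _ => rfl⟩ _ _
    fun _ => rfl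

theorem powerPlethysm_powerSum_pow {k l : ℕ} (hk : k ≠ 0) (hl : l ≠ 0) (m : ℕ) :
    powerPlethysm k (powerSum l ^ m) = powerSum (k * l) ^ m := by
  rw [← powerPlethysm_powerSum k l hk hl, powerPlethysm_eq k hk, powerPlethysm_eq k hk, map_pow]

/-- The power sum of a translation of a finite group. -/
theorem powerSumPart_translation {A : Type} [AddCommGroup A] [Fintype A] [DecidableEq A] (a : A)
    (σ : Perm A) (hσ : ∀ x, σ x = a + x) :
    powerSumPart σ.partition = powerSum (addOrderOf a) ^ (Fintype.card A / addOrderOf a) := by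
  classical
  have h0 : addOrderOf a ≠ 0 := (addOrderOf_pos a).ne'
  have hcard : Fintype.card (A ⧸ AddSubgroup.zmultiples a) = Fintype.card A / addOrderOf a := by
    have h := AddSubgroup.card_eq_card_quotient_mul_card_addSubgroup (AddSubgroup.zmultiples a)
    rw [Nat.card_zmultiples, Nat.card_eq_fintype_card, Nat.card_eq_fintype_card] at h
    rw [h, Nat.mul_div_cancel _ (addOrderOf_pos a)]
  -- Fixed colorings are the colorings of the quotient by the subgroup generated by `a`; each coset
  -- has `addOrderOf a` elements, which scales the content by that factor.
  have hfix : ∀ (c : FixedColoring σ) (x y : A),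
      (QuotientAddGroup.leftRel (AddSubgroup.zmultiples a)).r x y → c.1 x = c.1 y := by
    intro c x y hxy
    have hz : ∀ (m : ℕ) (x : A), c.1 (m • a + x) = c.1 x := by
      intro m x
      induction m with
      | zero => rw [zero_smul, zero_add]
      | succ m ih => rw [succ_nsmul', add_assoc, ← hσ, c.2, ih]
    obtain ⟨m, hm⟩ := (AddSubmonoid.mem_multiples_iff _ _).1
      (mem_multiples_iff_mem_zmultiples.2 (QuotientAddGroup.leftRel_apply.1 hxy))
    rw [← hz m x, hm, neg_add_cancel_comm]
  have hfiber : ∀ q : A ⧸ AddSubgroup.zmultiples a,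
      (Finset.univ.filter fun x : A => (x : A ⧸ AddSubgroup.zmultiples a) = q).card =
        addOrderOf a := by
    intro q
    induction q using QuotientAddGroup.induction_on with
    | _ y =>
    rw [← Nat.card_zmultiples, ← Fintype.card_subtype, ← Nat.card_eq_fintype_card]
    refine Nat.card_congr
      { toFun := fun x => ⟨-y + x.1, QuotientAddGroup.eq.1 x.2.symm⟩
        invFun := fun s => ⟨y + s.1, ?_⟩
        left_inv := fun x => Subtype.ext (add_neg_cancel_left y x.1)
        right_inv := fun s => Subtype.ext (neg_add_cancel_left y s.1) }
    exact QuotientAddGroup.mk_add_of_mem y s.2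
  rw [powerSumPart_eq_genSeries, ← hcard]
  have h1 := powerPlethysm_powerSum_pow h0 one_ne_zero (Fintype.card (A ⧸ AddSubgroup.zmultiples a))
  rw [mul_one] at h1
  rw [← h1, ← genSeries_content, powerPlethysm_eq _ h0, expand_genSeries]
  have hq : ∀ x : A, (σ x : A ⧸ AddSubgroup.zmultiples a) = x := fun x => by
    rw [hσ, add_comm a, QuotientAddGroup.mk_add_of_mem x (AddSubgroup.mem_zmultiples a)]
  refine (genSeries_congr (Y := A ⧸ AddSubgroup.zmultiples a → ℕ) (Z := FixedColoring σ)
    { toFun := fun f => ⟨fun x => f (x : A ⧸ AddSubgroup.zmultiples a), fun x => congrArg f (hq x)⟩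
      invFun := fun c => Quotient.lift c.1 (hfix c)
      left_inv := fun f => funext fun q => Quotient.inductionOn q fun _ => rfl
      right_inv := fun c => Subtype.ext rfl } _ _ fun f => ?_).symm
  change ∑ x : A, Finsupp.single (f (x : A ⧸ AddSubgroup.zmultiples a)) 1 = _
  rw [← Finset.sum_fiberwise (Finset.univ : Finset A)
    fun x => (x : A ⧸ AddSubgroup.zmultiples a), content, Finset.smul_sum]
  refine Finset.sum_congr rfl fun q _ => ?_
  rw [Finset.sum_congr rfl (g := fun _ => Finsupp.single (f q) 1)
    fun x hx => by rw [(Finset.mem_filter.1 hx).2], Finset.sum_const, hfiber]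

/-- The standard additive character identifies the cyclic group with the n-th roots of unity and
preserves orders; an element of order d acts with n / d cycles of length d. -/
theorem modL_eq_sum_nthRootsFinset (S : Set ℕ) {n : ℕ} (hn : n ≠ 0) :
    (n : ℂ) • modL S n = ∑ ζ ∈ Polynomial.nthRootsFinset n (1 : ℂ),
      ζ ^ primesPart S n • powerSum (orderOf ζ) ^ (n / orderOf ζ) := by
  have : NeZero n := ⟨hn⟩
  have hn' : (n : ℂ) ≠ 0 := Nat.cast_ne_zero.2 hn
  rw [modL_eq_sum, smul_inv_smul₀ hn']
  have hmem : ∀ k : Multiplicative (ZMod n), ZMod.stdAddChar (Multiplicative.toAdd k) ∈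
      Polynomial.nthRootsFinset n (1 : ℂ) := by
    intro k
    rw [Polynomial.mem_nthRootsFinset (Nat.pos_of_ne_zero hn), ← AddChar.map_nsmul_eq_pow]
    simp
  have hinj : Function.Injective fun k : Multiplicative (ZMod n) =>
      ZMod.stdAddChar (Multiplicative.toAdd k) := ZMod.injective_stdAddChar
  have himage : Finset.univ.image (fun k : Multiplicative (ZMod n) =>
      ZMod.stdAddChar (Multiplicative.toAdd k)) = Polynomial.nthRootsFinset n (1 : ℂ) := by
    refine Finset.eq_of_subset_of_card_le (Finset.image_subset_iff.2 fun k _ => hmem k) ?_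
    rw [Finset.card_image_of_injective _ hinj, Finset.card_univ, Fintype.card_multiplicative,
      ZMod.card, Polynomial.nthRootsFinset_def]
    exact (Multiset.toFinset_card_le _).trans (Polynomial.card_nthRoots n 1)
  rw [← himage, Finset.sum_image hinj.injOn]
  refine Finset.sum_congr rfl fun k _ => ?_
  have ho : orderOf (ZMod.stdAddChar (N := n) (Multiplicative.toAdd k) : ℂ) =
      addOrderOf (Multiplicative.toAdd k) :=
    orderOf_injective (AddChar.toMonoidHom (ZMod.stdAddChar (N := n))) hinj k
  rw [ho, powerSumPart_translation (Multiplicative.toAdd k) _ fun x => rfl, ZMod.card]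
  congr 1
  exact AddChar.mulShift_spec' (ZMod.stdAddChar (N := n)) (primesPart S n) (Multiplicative.toAdd k)

/-! ### Sums over roots of unity -/

theorem primesPart_mul (T : Set ℕ) {a b : ℕ} (ha : a ≠ 0) (hb : b ≠ 0) :
    primesPart T (a * b) = primesPart T a * primesPart T b := by
  classical
  rw [primesPart, Nat.factorization_mul ha hb, Finsupp.prod_add_index']
  · rfl
  · intro q
    simp
  · intro q x y
    split
    · exact pow_add _ _ _
    · rw [one_mul]

theorem primesPart_dvd_of_dvd (T : Set ℕ) {a b : ℕ} (hb : b ≠ 0) (h : a ∣ b) :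
    primesPart T a ∣ primesPart T b := by
  obtain ⟨c, rfl⟩ := h
  rw [primesPart_mul T (left_ne_zero_of_mul hb) (right_ne_zero_of_mul hb)]
  exact Dvd.intro _ rfl

theorem primesPart_of_prime_of_notMem {T : Set ℕ} {q : ℕ} (hq : q.Prime) (h : q ∉ T) :
    primesPart T q = 1 := by
  rw [primesPart, hq.factorization, Finsupp.prod_single_index (by simp), if_neg h]

theorem primesPart_of_mem {T : Set ℕ} {n : ℕ} (h : n ∈ primeMonoid T) : primesPart T n = n := by
  have hn : n ≠ 0 := Nat.one_le_iff_ne_zero.1 h.1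
  conv_rhs => rw [← Nat.prod_factorization_pow_eq_self hn]
  rw [primesPart, Finsupp.prod, Finsupp.prod]
  refine Finset.prod_congr rfl fun q hq => ?_
  have hq' := Nat.mem_primeFactors.1 (Nat.support_factorization n ▸ hq)
  exact if_pos (h.2 q hq'.1 hq'.2.1)

theorem not_dvd_primesPart {T : Set ℕ} {q : ℕ} (hq : q.Prime) (h : q ∉ T) (n : ℕ) :
    ¬ q ∣ primesPart T n := by
  classical
  intro hdvd
  rw [primesPart, Finsupp.prod] at hdvd
  obtain ⟨p, hp, hqp⟩ := (Prime.dvd_finsetProd_iff hq.prime _).1 hdvd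
  have hp' := Nat.mem_primeFactors.1 (Nat.support_factorization n ▸ hp)
  split at hqp
  · next hpT =>
    have := (Nat.prime_dvd_prime_iff_eq hq hp'.1).1 (hq.dvd_of_dvd_pow hqp)
    exact h (this ▸ hpT)
  · exact hq.one_lt.ne' (Nat.dvd_one.1 hqp)

/-- Numbers that agree up to a factor q are not distinguished by the T-part when q is not in T. -/
theorem primesPart_congr {T : Set ℕ} {q : ℕ} (hq : q.Prime) (h : q ∉ T) {a b : ℕ} (ha : a ≠ 0)
    (hb : b ≠ 0) (hab : a ∣ q * b) (hba : b ∣ q * a) : primesPart T a = primesPart T b := by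
  refine Nat.dvd_antisymm ?_ ?_
  · have := primesPart_dvd_of_dvd T (mul_ne_zero hq.ne_zero hb) hab
    rwa [primesPart_mul T hq.ne_zero hb, primesPart_of_prime_of_notMem hq h, one_mul] at this
  · have := primesPart_dvd_of_dvd T (mul_ne_zero hq.ne_zero ha) hba
    rwa [primesPart_mul T hq.ne_zero ha, primesPart_of_prime_of_notMem hq h, one_mul] at this

theorem sum_nthRootsFinset_eq (n : ℕ) (hn : n ≠ 0) {M : Type*} [AddCommMonoid M]
    (F : ℂ → ℕ → M) :
    ∑ ζ ∈ Polynomial.nthRootsFinset n (1 : ℂ), F ζ (orderOf ζ) =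
      ∑ d ∈ n.divisors, ∑ ζ ∈ primitiveRoots d ℂ, F ζ d := by
  classical
  have : NeZero n := ⟨hn⟩
  rw [IsPrimitiveRoot.nthRoots_one_eq_biUnion_primitiveRoots, Finset.sum_biUnion]
  · refine Finset.sum_congr rfl fun d hd => Finset.sum_congr rfl fun ζ hζ => ?_
    rw [← (isPrimitiveRoot_of_mem_primitiveRoots hζ).eq_orderOf]
  · intro d _ e _ hde
    exact IsPrimitiveRoot.disjoint hde

/-- If l is in P(T), so is the order of ζ; this order then divides the exponent and every term is 1.
Otherwise a prime q outside T divides l. Multiplying ζ by q-th roots of unity does not change the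
exponent, which is prime to q, so the terms cancel. -/
theorem sum_pow_primesPart (T : Set ℕ) {m l : ℕ} (hm : m ≠ 0) (hl : l ≠ 0) :
    ∑ ζ ∈ Polynomial.nthRootsFinset l (1 : ℂ), ζ ^ primesPart T (m * orderOf ζ) =
      open Classical in if l ∈ primeMonoid T then (l : ℂ) else 0 := by
  have hl' := Nat.pos_of_ne_zero hl
  have hord : ∀ ζ ∈ Polynomial.nthRootsFinset l (1 : ℂ), orderOf ζ ∣ l := fun ζ hζ =>
    orderOf_dvd_of_pow_eq_one ((Polynomial.mem_nthRootsFinset hl' _).1 hζ)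
  have hord0 : ∀ ζ ∈ Polynomial.nthRootsFinset l (1 : ℂ), orderOf ζ ≠ 0 := fun ζ hζ h =>
    hl (Nat.eq_zero_of_zero_dvd (h ▸ hord ζ hζ))
  split_ifs with h
  · have h1 : ∀ ζ ∈ Polynomial.nthRootsFinset l (1 : ℂ), ζ ^ primesPart T (m * orderOf ζ) = 1 := by
      intro ζ hζ
      rw [← orderOf_dvd_iff_pow_eq_one, primesPart_mul T hm (hord0 ζ hζ),
        primesPart_of_mem (n := orderOf ζ) ⟨Nat.pos_of_ne_zero (hord0 ζ hζ),
          fun q hq hqd => h.2 q hq (hqd.trans (hord ζ hζ))⟩]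
      exact Dvd.intro_left _ rfl
    rw [Finset.sum_congr rfl h1, Finset.sum_const, nsmul_one,
      (Complex.isPrimitiveRoot_exp l hl).card_nthRootsFinset]
  · obtain ⟨q, hq, hql, hqT⟩ : ∃ q : ℕ, q.Prime ∧ q ∣ l ∧ q ∉ T := by
      by_contra! h2
      exact h ⟨hl', h2⟩
    have hη := Complex.isPrimitiveRoot_exp q hq.ne_zero
    set η := Complex.exp (2 * Real.pi * Complex.I / q)
    have hη0 : η ≠ 0 := hη.ne_zero hq.ne_zero
    have hηl : η ^ l = 1 := (hη.pow_eq_one_iff_dvd l).2 hql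
    have hmem : ∀ (j : ℕ) (ζ : ℂ), ζ ∈ Polynomial.nthRootsFinset l (1 : ℂ) →
        ζ * η ^ j ∈ Polynomial.nthRootsFinset l (1 : ℂ) := by
      intro j ζ hζ
      rw [Polynomial.mem_nthRootsFinset hl'] at hζ ⊢
      rw [mul_pow, hζ, ← pow_mul, mul_comm j, pow_mul, hηl, one_pow, one_mul]
    have hshift : ∀ j : ℕ, ∑ ζ ∈ Polynomial.nthRootsFinset l (1 : ℂ),
        ζ ^ primesPart T (m * orderOf ζ) = ∑ ζ ∈ Polynomial.nthRootsFinset l (1 : ℂ),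
          (ζ * η ^ j) ^ primesPart T (m * orderOf (ζ * η ^ j)) := by
      intro j
      symm
      refine Finset.sum_nbij (fun ζ => ζ * η ^ j) (hmem j) ?_ ?_ fun ζ _ => rfl
      · intro a _ b _ hab
        exact mul_right_cancel₀ (pow_ne_zero j hη0) hab
      · refine Finset.surjOn_of_injOn_of_card_le _ (hmem j) ?_ le_rfl
        intro a _ b _ hab
        exact mul_right_cancel₀ (pow_ne_zero j hη0) hab
    have hpart : ∀ (j : ℕ) (ζ : ℂ), ζ ∈ Polynomial.nthRootsFinset l (1 : ℂ) →
        primesPart T (m * orderOf (ζ * η ^ j)) = primesPart T (m * orderOf ζ) := by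
      intro j ζ hζ
      have hηq : ∀ a : ℕ, (η ^ j) ^ (q * a) = 1 := fun a => by
        rw [pow_mul, ← pow_mul η, mul_comm j, pow_mul η, hη.pow_eq_one, one_pow, one_pow]
      rw [primesPart_mul T hm (hord0 _ (hmem j ζ hζ)), primesPart_mul T hm (hord0 ζ hζ)]
      congr 1
      refine primesPart_congr hq hqT (hord0 _ (hmem j ζ hζ)) (hord0 ζ hζ) ?_ ?_
      · refine orderOf_dvd_of_pow_eq_one ?_
        rw [mul_pow, hηq, mul_one, mul_comm q, pow_mul, pow_orderOf_eq_one, one_pow]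
      · refine orderOf_dvd_of_pow_eq_one ?_
        have h1 : (ζ * η ^ j) ^ (q * orderOf (ζ * η ^ j)) = 1 := by
          rw [mul_comm q, pow_mul, pow_orderOf_eq_one, one_pow]
        rwa [mul_pow, hηq, mul_one] at h1
    -- The exponent does not depend on j and is prime to q, so this is a multiple of the full
    -- geometric sum of a primitive q-th root of unity.
    have hzero : ∀ ζ ∈ Polynomial.nthRootsFinset l (1 : ℂ),
        ∑ j ∈ Finset.range q, (ζ * η ^ j) ^ primesPart T (m * orderOf (ζ * η ^ j)) = 0 := by
      intro ζ hζ
      rw [Finset.sum_congr rfl fun j _ => by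
        rw [hpart j ζ hζ, mul_pow, ← pow_mul, mul_comm j, pow_mul], ← Finset.mul_sum]
      have h1 : IsPrimitiveRoot (η ^ primesPart T (m * orderOf ζ)) q :=
        hη.pow_of_coprime _ ((Nat.Prime.coprime_iff_not_dvd hq).2 (not_dvd_primesPart hq hqT _)).symm
      rw [h1.geom_sum_eq_zero hq.one_lt, mul_zero]
    have hq0 : (q : ℂ) ≠ 0 := Nat.cast_ne_zero.2 hq.ne_zero
    refine (mul_eq_zero.1 ?_).resolve_left hq0
    rw [← nsmul_eq_mul, ← Finset.card_range q, ← Finset.sum_const,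
      Finset.sum_congr rfl fun j _ => hshift j, Finset.sum_comm]
    exact Finset.sum_eq_zero fun ζ hζ => by simpa using hzero ζ hζ

/-- For fixed d, the map i ↦ (j / i) d is an involution on the i with d ∣ i ∣ j. -/
theorem sum_divisors_divisors {M : Type*} [AddCommMonoid M] (j : ℕ) (F : ℕ → ℕ → M) :
    ∑ i ∈ j.divisors, ∑ d ∈ i.divisors, F i d =
      ∑ l ∈ j.divisors, ∑ d ∈ l.divisors, F (j / l * d) d := by
  rw [Finset.sum_sigma', Finset.sum_sigma']
  have key : ∀ x : (_ : ℕ) × ℕ, x ∈ j.divisors.sigma (fun i => i.divisors) →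
      (⟨j / x.1 * x.2, x.2⟩ : (_ : ℕ) × ℕ) ∈ j.divisors.sigma (fun i => i.divisors) ∧
        j / (j / x.1 * x.2) * x.2 = x.1 := by
    rintro ⟨i, d⟩ hx
    simp only [Finset.mem_sigma, Nat.mem_divisors] at hx ⊢
    obtain ⟨⟨⟨e, rfl⟩, hj⟩, ⟨m, rfl⟩, hi⟩ := hx
    have hd : 0 < d := Nat.pos_of_ne_zero (left_ne_zero_of_mul hi)
    have hm : 0 < m := Nat.pos_of_ne_zero (right_ne_zero_of_mul hi)
    have he : 0 < e := Nat.pos_of_ne_zero (right_ne_zero_of_mul hj)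
    rw [Nat.mul_div_cancel_left e (Nat.mul_pos hd hm)]
    refine ⟨⟨⟨⟨m, by ring⟩, hj⟩, ⟨e, by ring⟩, (Nat.mul_pos he hd).ne'⟩, ?_⟩
    rw [show d * m * e = m * (e * d) by ring, Nat.mul_div_cancel _ (Nat.mul_pos he hd), mul_comm]
  refine Finset.sum_bij' (fun x _ => ⟨j / x.1 * x.2, x.2⟩) (fun x _ => ⟨j / x.1 * x.2, x.2⟩)
    (fun x hx => (key x hx).1) (fun x hx => (key x hx).1) (fun x hx => ?_) (fun x hx => ?_)
    fun x hx => ?_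
  · simp only [(key x hx).2]
  · simp only [(key x hx).2]
  · simp only [(key x hx).2]

/-- A root of order d in i L_i contributes a power of p_l with l = (j / i) d. Regrouping by l, the
primitive roots of all orders d ∣ l make up all l-th roots of unity, and `sum_pow_primesPart`
evaluates the coefficient. -/
theorem sum_powerPlethysm_modL (T : Set ℕ) {j : ℕ} (hj : j ≠ 0) :
    ∑ i ∈ j.divisors, (i : SymPS) * powerPlethysm (j / i) (modL T i) =
      ∑ i ∈ j.divisors, (i : SymPS) *
        open Classical in if i ∈ primeMonoid T then powerSum i ^ (j / i) else 0 := by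
  have h1 : ∀ i ∈ j.divisors, (i : SymPS) * powerPlethysm (j / i) (modL T i) =
      ∑ d ∈ i.divisors, ∑ ζ ∈ primitiveRoots d ℂ,
        ζ ^ primesPart T i • powerSum (j / i * d) ^ (i / d) := by
    intro i hi
    obtain ⟨hij, -⟩ := Nat.mem_divisors.1 hi
    have hi0 : i ≠ 0 := ne_zero_of_dvd_ne_zero hj hij
    have hji : j / i ≠ 0 := (Nat.div_pos (Nat.le_of_dvd (Nat.pos_of_ne_zero hj) hij)
      (Nat.pos_of_ne_zero hi0)).ne'
    rw [← nsmul_eq_mul, ← Nat.cast_smul_eq_nsmul ℂ, ← powerPlethysm_smul,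
      modL_eq_sum_nthRootsFinset T hi0, sum_nthRootsFinset_eq i hi0
      fun ζ d => ζ ^ primesPart T i • powerSum d ^ (i / d), powerPlethysm_sum]
    refine Finset.sum_congr rfl fun d hd => ?_
    rw [powerPlethysm_sum]
    refine Finset.sum_congr rfl fun ζ _ => ?_
    rw [powerPlethysm_smul, powerPlethysm_powerSum_pow hji
      (Nat.pos_of_mem_divisors hd).ne']
  rw [Finset.sum_congr rfl h1, sum_divisors_divisors]
  refine Finset.sum_congr rfl fun l hl => ?_
  obtain ⟨⟨m, rfl⟩, -⟩ := Nat.mem_divisors.1 hl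
  have hl0 : l ≠ 0 := left_ne_zero_of_mul hj
  have hm0 : m ≠ 0 := right_ne_zero_of_mul hj
  rw [Nat.mul_div_cancel_left m (Nat.pos_of_ne_zero hl0)]
  have h2 : ∀ d ∈ l.divisors, ∑ ζ ∈ primitiveRoots d ℂ,
      ζ ^ primesPart T (m * d) • powerSum (l * m / (m * d) * d) ^ (m * d / d) =
      (∑ ζ ∈ primitiveRoots d ℂ, ζ ^ primesPart T (m * d)) • powerSum l ^ m := by
    intro d hd
    rw [Nat.mul_div_cancel m (Nat.pos_of_mem_divisors hd), mul_comm l m,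
      Nat.mul_div_mul_left _ _ (Nat.pos_of_ne_zero hm0),
      Nat.div_mul_cancel (Nat.dvd_of_mem_divisors hd), Finset.sum_smul]
  rw [Finset.sum_congr rfl h2, ← Finset.sum_smul,
    ← sum_nthRootsFinset_eq l hl0 fun ζ d => ζ ^ primesPart T (m * d),
    sum_pow_primesPart T hm0 hl0]
  split_ifs
  · rw [Nat.cast_smul_eq_nsmul, nsmul_eq_mul]
  · rw [zero_smul, mul_zero]

/-! ### Comparison of the two recursions -/

open Classical in
/-- The weights whose partition sums are the sums of power sums with parts in `P`. -/
noncomputable def powerSumWeight (P : Set ℕ) (i m : ℕ) : SymPS :=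
  -- The clause `m = 0` gives absent parts weight 1, as `newton_recursion` requires.
  if i ∈ P ∨ m = 0 then powerSum i ^ m else 0

theorem powerSumSum_eq (P : Set ℕ) (n : ℕ) :
    powerSumSum P n = ∑ lam : n.Partition, multiplicityWeight (powerSumWeight P) lam.parts := by
  classical
  rw [powerSumSum, Finset.sum_filter]
  refine Finset.sum_congr rfl fun lam _ => ?_
  split_ifs with h
  · rw [powerSumPart, Finset.prod_multiset_map_count, multiplicityWeight]
    exact Finset.prod_congr rfl fun i hi =>
      (if_pos (Or.inl (h i (Multiset.mem_toFinset.1 hi)))).symm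
  · push Not at h
    obtain ⟨k, hk, hkP⟩ := h
    refine (Finset.prod_eq_zero (Multiset.mem_toFinset.2 hk) (if_neg ?_)).symm
    rintro (h | h)
    · exact hkP h
    · exact Multiset.count_ne_zero.2 hk h

/-- For i in P the weights form the geometric series 1 / (1 - p_i t), whose logarithmic derivative
has coefficients p_i^k. -/
theorem powerSumWeight_recursion (P : Set ℕ) (i m : ℕ) :
    (m : SymPS) * powerSumWeight P i m = ∑ k ∈ Finset.Icc 1 m,
      (open Classical in if i ∈ P then powerSum i ^ k else 0) * powerSumWeight P i (m - k) := by
  classical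
  by_cases h : i ∈ P
  · rw [Finset.sum_congr rfl (g := fun _ => powerSum i ^ m), Finset.sum_const, Nat.card_Icc,
      Nat.add_sub_cancel, nsmul_eq_mul, powerSumWeight, if_pos (Or.inl h)]
    intro k hk
    rw [Finset.mem_Icc] at hk
    rw [if_pos h, powerSumWeight, if_pos (Or.inl h), ← pow_add, Nat.add_sub_cancel' hk.2]
  · rw [Finset.sum_eq_zero fun k _ => by rw [if_neg h, zero_mul]]
    rcases Nat.eq_zero_or_pos m with rfl | hm
    · rw [Nat.cast_zero, zero_mul]
    · rw [powerSumWeight, if_neg (by rintro (h' | h') <;> [exact h h'; omega]), mul_zero]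

theorem powerSumSum_eq_symmetricPower (T : Set ℕ) (n : ℕ) :
    powerSumSum (primeMonoid T) n = symmetricPower (modL T) n := by
  classical
  have hA : ∀ n, symmetricPower (modL T) n = ∑ lam : n.Partition,
      multiplicityWeight (fun i m => hPlethysm m (modL T i)) lam.parts := fun n => rfl
  have hB0 : ∀ i, powerSumWeight (primeMonoid T) i 0 = 1 := fun i => by
    rw [powerSumWeight, if_pos (Or.inr rfl), pow_zero]
  -- These coefficients come directly from the geometric series of the power sums; for the symmetric
  -- power they come from `sum_powerPlethysm_modL`.
  refine newton_unique (b := fun j => ∑ i ∈ j.divisors, (i : SymPS) *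
    if i ∈ primeMonoid T then powerSum i ^ (j / i) else 0) ?_ (fun n => ?_) (fun n => ?_) n
  · rw [powerSumSum_eq, hA]
    simp [multiplicityWeight]
  · simp only [powerSumSum_eq]
    rw [newton_recursion hB0 (powerSumWeight_recursion _)]
  · simp only [hA]
    rw [newton_recursion (f := fun i m => hPlethysm m (modL T i))
      (c := fun i k => powerPlethysm k (modL T i))
      (fun i => hPlethysm_zero _) fun i m => natCast_mul_hPlethysm m _]
    refine Finset.sum_congr rfl fun j hj => ?_
    rw [Finset.mem_Icc] at hj
    rw [sum_powerPlethysm_modL T (by omega)]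

theorem mainTheorem8 (S : Set ℕ) (hS : ∀ q ∈ S, q.Prime) (n : ℕ) :
    (SchurPositive (powerSumSum (primeMonoid S) n) ∧
      powerSumSum (primeMonoid S) n = symmetricPower (modL S) n) ∧
    (SchurPositive (powerSumSum (primeMonoid (primesCompl S)) n) ∧
      powerSumSum (primeMonoid (primesCompl S)) n = symmetricPower (modL (primesCompl S)) n) := by
  have key : ∀ T : Set ℕ, SchurPositive (powerSumSum (primeMonoid T) n) ∧
      powerSumSum (primeMonoid T) n = symmetricPower (modL T) n := fun T => by
    rw [powerSumSum_eq_symmetricPower]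
    exact ⟨schurPositive_symmetricPower_modL T n, rfl⟩
  exact ⟨key S, key (primesCompl S)⟩
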